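/- Let $p$ be an odd prime, let $\mathbb F_q$ be a finite field with $q=p^f$ elements, and let $K=\mathbb F_q(t)$. For an integer $d\ge 1$ let $E_d/K$ be the elliptic curve $y^2=x(x^2+t^{2d}x-4t^{2d})$. For a place $v$ of $K$ with residue field $\mathbb F_v$, let $q_v=|\mathbb F_v|$ and $\deg v=[\mathbb F_v:\mathbb F_q]$, let $(\widetilde{E_d})_v$ be the plane cubic over $\mathbb F_v$ obtained by reducing a minimal $v$-integral Weierstrass model of $E_d$ modulo $v$, and let $a_v=q_v+1-|(\widetilde{E_d})_v(\mathbb F_v)|$. Put $$L(E_d/K,T)=\prod_{v\text{ good}}\bigl(1-a_vT^{\deg v}+q_vT^{2\deg v}\bigr)^{-1}\prod_{v\text{ bad}}\bigl(1-a_vT^{\deg v}\bigr)^{-1}\in\mathbb Z[[T]],$$ where $v$ runs over the places of good, respectively bad, reduction of $E_d$. Let $\bar{\mathbb Q}$ be an algebraic closure of $\mathbb Q$, $\bar{\mathbb Z}$ its ring of algebraic integers and $\mathfrak P$ a maximal ideal of $\bar{\mathbb Z}$ above $p$. Reduction modulo $\mathfrak P$ is an isomorphism from the group of roots of unity of order prime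 to $p$ in $\bar{\mathbb Z}$ to $(\bar{\mathbb Z}/\mathfrak P)^\times$; let $\mathbf t$ be its inverse. For $m\ge1$, regard $\mathbb F_{q^m}$ as the subfield with $q^m$ elements of $\bar{\mathbb Z}/\mathfrak P$. Let $d\ge 2$ be coprime to $q$, and let $Z_{2d}\subset\mathbb Z/2d\mathbb Z$ be the complement of $\{0,d/2,d,3d/2\}$ if $d$ is even, and of $\{0,d\}$ if $d$ is odd. Let $\mathcal O_q(Z_{2d})$ be the set of orbits of multiplication by $q$ on $Z_{2d}$, and write $|\mathbf n|$ for the number of elements of an orbit $\mathbf n$. For $n\in\mathbf n\in\mathcal O_q(Z_{2d})$ put $Q=q^{|\mathbf n|}$, let $\mathbf t_n$ be the character $x\mapsto\mathbf t(x)^{(Q-1)n/2d}$ of $\mathbb F_Q^\times$, and let $\lambda$ be the character of order $2$ of $\mathbb F_Q^\times$. Put $$\beta(\mathbf n)=\beta(n)=\mathbf t_n^2(4)\cdot j(\mathbf t_n,\mathbf t_n)\cdot j(\lambda\mathbf t_n^2,\mathbf t_n^{-1}),\qquad j(\chi,\psi)=-\sum_{x\in\mathbb F_Q}\chi(x)\psi(1-x),$$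 where the characters, all nontrivial, are extended by $0$ at $0$; this does not depend on the choice of $n\in\mathbf n$. Then the product defining $L(E_d/K,T)$ converges coefficientwise, $L(E_d/K,T)$ is a polynomial with integer coefficients, and its order of vanishing at $T=q^{-1}$ is $$\operatorname{ord}_{T=q^{-1}}L(E_d/K,T)=1+\bigl|\{\mathbf n\in\mathcal O_q(Z_{2d}):\beta(\mathbf n)=q^{|\mathbf n|}\}\bigr|.$$ -/

import Mathlib

noncomputable section

open Polynomial

namespace GriffonRank

/-! ### Places of `K = F(t)` -/

section Places

variable (F : Type*) [Field F]

/-- The places of `F(t)`: the finite ones, given by the monic irreducible polynomials of `F[t]`,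
and the place at infinity. -/
inductive Place : Type _ where
  | finite (P : F[X]) (hm : P.Monic) (hi : Irreducible P) : Place
  | infinite : Place

variable {F}

namespace Place

/-- The prime ideal of `F[t]` generated by an irreducible polynomial. -/
def primeOf (P : F[X]) (hi : Irreducible P) : IsDedekindDomain.HeightOneSpectrum F[X] where
  asIdeal := Ideal.span {P}
  isPrime := (Ideal.span_singleton_prime hi.ne_zero).mpr hi.prime
  ne_bot := by simpa using hi.ne_zero

open Classical in
/-- The normalized (multiplicative) valuation of `F(t)` at a place. -/
def valuation : Place F → Valuation (RatFunc F) (WithZero (Multiplicative ℤ))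
  | finite P _ hi => (primeOf P hi).valuation (RatFunc F)
  | infinite => RatFunc.inftyValuation F

/-- The degree of a place, i.e. the degree over `F` of its residue field. -/
def degree : Place F → ℕ
  | finite P _ _ => P.natDegree
  | infinite => 1

/-- The valuation ring of a place. -/
abbrev ring (v : Place F) : ValuationSubring (RatFunc F) := v.valuation.valuationSubring

instance valuation_isNontrivial (v : Place F) : v.valuation.IsNontrivial := by
  classical
  cases v with
  | finite P hm hi =>
    obtain ⟨π, hπ⟩ := (primeOf P hi).valuation_exists_uniformizer (RatFunc F)
    refine ⟨π, ?_, ?_⟩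
    · change (primeOf P hi).valuation (RatFunc F) π ≠ 0
      rw [hπ]; simp
    · change (primeOf P hi).valuation (RatFunc F) π ≠ 1
      rw [hπ, ← WithZero.exp_zero]
      simp
  | infinite =>
    change (RatFunc.inftyValuation F).IsNontrivial
    infer_instance

instance ring_isDiscreteValuationRing (v : Place F) : IsDiscreteValuationRing v.ring :=
  v.valuation.valuationSubring_isDiscreteValuationRing

end Place

end Places

/-! ### The `L`-function of a Weierstrass curve over `F(t)` -/

section LFunction

open PowerSeries

variable {F : Type*} [Field F]

/-- The reduction at `v` of a minimal `v`-integral model of `W`. -/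
def reductionAt (W : WeierstrassCurve (RatFunc F)) (v : Place F) :
    WeierstrassCurve (IsLocalRing.ResidueField v.ring) :=
  (W.minimal v.ring).reduction v.ring

/-- The cardinality `q_v` of the residue field at `v`. -/
def residueCard (v : Place F) : ℕ := Nat.card (IsLocalRing.ResidueField v.ring)

/-- The number of rational points of the projective plane cubic defined by a Weierstrass equation:
all the affine solutions (a singular point included) and the point at infinity. -/
def cubicPointCount {k : Type*} [Field k] (W : WeierstrassCurve k) : ℕ :=
  Nat.card {P : k × k // W.toAffine.Equation P.1 P.2} + 1

/-- `a_v = q_v + 1 - |(reduced cubic)(F_v)|`. -/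
def traceAt (W : WeierstrassCurve (RatFunc F)) (v : Place F) : ℤ :=
  (residueCard v : ℤ) + 1 - cubicPointCount (reductionAt W v)

open Classical in
/-- The denominator of the Euler factor at `v`: `1 - a_v T ^ deg v + q_v T ^ (2 deg v)` if `v` is a
place of good reduction, and `1 - a_v T ^ deg v` if `v` is a place of bad reduction. -/
def eulerPolynomial (W : WeierstrassCurve (RatFunc F)) (v : Place F) : ℤ[X] :=
  if (W.minimal v.ring).HasGoodReduction v.ring then
    1 - Polynomial.C (traceAt W v) * Polynomial.X ^ v.degree
      + Polynomial.C (residueCard v : ℤ) * Polynomial.X ^ (2 * v.degree)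
  else 1 - Polynomial.C (traceAt W v) * Polynomial.X ^ v.degree

/-- The Euler factor at `v`, the inverse power series of `eulerPolynomial W v` (whose constant
term is `1`). -/
def eulerFactor (W : WeierstrassCurve (RatFunc F)) (v : Place F) : PowerSeries ℤ :=
  PowerSeries.invOfUnit (eulerPolynomial W v : PowerSeries ℤ) 1

open scoped PowerSeries.WithPiTopology in
/-- The Euler product converges coefficientwise. -/
def EulerProductConverges (W : WeierstrassCurve (RatFunc F)) : Prop :=
  Multipliable (eulerFactor W)

open scoped PowerSeries.WithPiTopology in
/-- The `L`-function `L(W/F(t), T)`: the product of the Euler factors over all places. -/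
def lFunction (W : WeierstrassCurve (RatFunc F)) : PowerSeries ℤ :=
  ∏' v : Place F, eulerFactor W v

end LFunction

/-- The curve `E_d : y ^ 2 = x (x ^ 2 + t ^ (2 d) x - 4 t ^ (2 d))` over `F(t)`. -/
def curve (F : Type*) [Field F] (d : ℕ) : WeierstrassCurve (RatFunc F) where
  a₁ := 0
  a₂ := RatFunc.X ^ (2 * d)
  a₃ := 0
  a₄ := -4 * RatFunc.X ^ (2 * d)
  a₆ := 0

/-! ### The action of `q` on `ℤ / 2d` -/

section Orbits

/-- The orbit `{n, q n, q ^ 2 n, …}` of `n` in `ℤ / D`. -/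
def qOrbit (q : ℕ) {D : ℕ} (n : ZMod D) : Set (ZMod D) :=
  Set.range fun j : ℕ => (q : ZMod D) ^ j * n

/-- The set `O_q(Z)` of orbits of a stable subset `Z`. -/
def orbits (q : ℕ) {D : ℕ} (Z : Set (ZMod D)) : Set (Set (ZMod D)) := qOrbit q '' Z

/-- The set `Z_{2d}`. -/
def indexSet (d : ℕ) : Set (ZMod (2 * d)) :=
  if Even d then {0, ((d / 2 : ℕ) : ZMod (2 * d)), (d : ZMod (2 * d)),
    ((3 * (d / 2) : ℕ) : ZMod (2 * d))}ᶜ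
  else {0, (d : ZMod (2 * d))}ᶜ

theorem qOrbit_ncard_ne_zero (q : ℕ) {D : ℕ} [NeZero D] (n : ZMod D) : (qOrbit q n).ncard ≠ 0 := by
  exact ((Set.ncard_pos (Set.toFinite _)).mpr (Set.range_nonempty _)).ne'

end Orbits

/-! ### The Teichmüller character -/

section Teichmuller

theorem exists_pow_eq_one (p : ℕ) [Fact p.Prime] {k : Type*} [Field k] [CharP k p] (x : k)
    (hx : IsIntegral ℤ x) (hx0 : x ≠ 0) : ∃ m : ℕ, m.Coprime p ∧ 0 < m ∧ x ^ m = 1 := by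
  let _ : Algebra (ZMod p) k := ZMod.algebra _ p
  have hint : IsIntegral (ZMod p) x := hx.tower_top
  let A := IntermediateField.adjoin (ZMod p) {x}
  have : FiniteDimensional (ZMod p) A := IntermediateField.adjoin.finiteDimensional hint
  have : Finite A := Module.finite_of_finite (ZMod p)
  let _ : Fintype A := Fintype.ofFinite A
  have : CharP A p := charP_of_injective_algebraMap (algebraMap (ZMod p) A).injective p
  let a : A := ⟨x, IntermediateField.mem_adjoin_simple_self _ _⟩
  have ha : a ≠ 0 := fun h => hx0 (congrArg Subtype.val h)
  obtain ⟨n, _, hn⟩ := FiniteField.card A p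
  refine ⟨Fintype.card A - 1, ?_, ?_, ?_⟩
  · have hp := (Fact.out : p.Prime)
    rw [Nat.coprime_comm, hp.coprime_iff_not_dvd]
    intro hd
    have h1 : 0 < Fintype.card A := Fintype.card_pos
    have h2 : p ∣ Fintype.card A := hn ▸ dvd_pow_self p n.ne_zero
    have h3 : p ∣ 1 := by
      have := Nat.dvd_sub h2 hd
      rwa [Nat.sub_sub_self h1] at this
    exact hp.one_lt.ne' (Nat.dvd_one.mp h3)
  · have := Fintype.one_lt_card (α := A)
    omega
  · exact congrArg Subtype.val (FiniteField.pow_card_sub_one_eq_one a ha)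

variable (p : ℕ) {L : Type*} [Field L] (𝔓 : Ideal (integralClosure ℤ L))

/-- The group of roots of unity of order prime to `p` in the ring of algebraic integers of `L`. -/
def primeToRoots (L : Type*) [Field L] : Subgroup (integralClosure ℤ L)ˣ where
  carrier := {ζ | ∃ m : ℕ, m.Coprime p ∧ 0 < m ∧ ζ ^ m = 1}
  one_mem' := ⟨1, by simp⟩
  mul_mem' := by
    rintro a b ⟨m, hm, hm0, ha⟩ ⟨n, hn, hn0, hb⟩
    refine ⟨m * n, Nat.Coprime.mul_left hm hn, Nat.mul_pos hm0 hn0, ?_⟩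
    rw [mul_pow, pow_mul, ha, one_pow, mul_comm m n, pow_mul, hb, one_pow, one_mul]
  inv_mem' := by
    rintro a ⟨m, hm, hm0, ha⟩
    exact ⟨m, hm, hm0, by rw [inv_pow, ha, inv_one]⟩

/-- Reduction modulo `𝔓` on the roots of unity of order prime to `p`. -/
def rootReduction : primeToRoots p L →* (integralClosure ℤ L ⧸ 𝔓)ˣ :=
  (Units.map (Ideal.Quotient.mk 𝔓 : integralClosure ℤ L →* integralClosure ℤ L ⧸ 𝔓)).comp
    (primeToRoots p L).subtype

variable [Fact p.Prime] [CharP (integralClosure ℤ L ⧸ 𝔓) p]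

theorem rootReduction_injective : Function.Injective (rootReduction p 𝔓) := by
  rw [injective_iff_map_eq_one]
  rintro ⟨ζ, m, hm, hm0, hζ⟩ h
  have h1 : Ideal.Quotient.mk 𝔓 (ζ : integralClosure ℤ L) = 1 := congrArg Units.val h
  have hζ' : (ζ : integralClosure ℤ L) ^ m = 1 := by
    simpa using congrArg Units.val hζ
  by_contra hne
  have hne' : (ζ : integralClosure ℤ L) - 1 ≠ 0 := by
    intro h0
    apply hne
    ext
    simpa using congrArg Subtype.val (sub_eq_zero.mp h0)
  have hs : ∑ i ∈ Finset.range m, (ζ : integralClosure ℤ L) ^ i = 0 := by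
    have := geom_sum_mul (ζ : integralClosure ℤ L) m
    rw [hζ', sub_self] at this
    exact (mul_eq_zero.mp this).resolve_right hne'
  have h2 := congrArg (Ideal.Quotient.mk 𝔓) hs
  simp only [map_sum, map_pow, h1, one_pow, Finset.sum_const, Finset.card_range, nsmul_eq_mul,
    mul_one, map_zero] at h2
  rw [CharP.cast_eq_zero_iff _ p] at h2
  exact ((Fact.out : p.Prime).coprime_iff_not_dvd.mp hm.symm) h2

variable [𝔓.IsMaximal]

theorem rootReduction_surjective [IsAlgClosed L] [CharZero L] :
    Function.Surjective (rootReduction p 𝔓) := by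
  intro x
  obtain ⟨y, hy⟩ := Ideal.Quotient.mk_surjective (x : integralClosure ℤ L ⧸ 𝔓)
  let _ : Field (integralClosure ℤ L ⧸ 𝔓) := Ideal.Quotient.field 𝔓
  obtain ⟨m, hm, hm0, hx'⟩ := exists_pow_eq_one p (x : integralClosure ℤ L ⧸ 𝔓)
    (hy ▸ (integralClosure.isIntegral y).map (Ideal.Quotient.mk 𝔓).toIntAlgHom) x.ne_zero
  have : NeZero m := ⟨hm0.ne'⟩
  have : NeZero (m : L) := ⟨by exact_mod_cast hm0.ne'⟩
  obtain ⟨ω, hω⟩ := HasEnoughRootsOfUnity.exists_primitiveRoot L m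
  have hωi : IsIntegral ℤ ω := hω.isIntegral hm0
  let w : integralClosure ℤ L := ⟨ω, hωi⟩
  have hw : IsPrimitiveRoot w m :=
    IsPrimitiveRoot.of_map_of_injective (f := (integralClosure ℤ L).val) hω Subtype.val_injective
  have hprod := X_pow_sub_one_eq_prod hm0 hw
  have h1 := congrArg (fun P => Ideal.Quotient.mk 𝔓 (P.eval y)) hprod
  simp only [eval_sub, eval_pow, eval_X, eval_one, map_sub, map_pow, hy, map_one,
    eval_prod, eval_C, map_prod] at h1
  rw [hx', sub_self] at h1
  obtain ⟨ζ, hζ, h0⟩ := Finset.prod_eq_zero_iff.mp h1.symm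
  rw [mem_nthRootsFinset hm0] at hζ
  let u : (integralClosure ℤ L)ˣ := Units.ofPowEqOne ζ m hζ hm0.ne'
  refine ⟨⟨u, m, hm, hm0, ?_⟩, ?_⟩
  · exact Units.pow_ofPowEqOne _ _
  · ext
    exact (sub_eq_zero.mp h0).symm

/-- The Teichmüller character `𝐭` of the residue field of `𝔓`, with values in `Lˣ`: the inverse of the reduction isomorphism
from the roots of unity of order prime to `p` to the units of the residue field. -/
def teichmuller [IsAlgClosed L] [CharZero L] : (integralClosure ℤ L ⧸ 𝔓)ˣ →* Lˣ :=
  ((Units.map ((integralClosure ℤ L).val : integralClosure ℤ L →* L)).comp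
    (primeToRoots p L).subtype).comp
    (MulEquiv.ofBijective (rootReduction p 𝔓)
      ⟨rootReduction_injective p 𝔓, rootReduction_surjective p 𝔓⟩).symm.toMonoidHom

end Teichmuller

/-! ### Jacobi sums and the numbers `β(n)` -/

section Beta

/-- The subfield with `p ^ e` elements, i.e. the set of `x` such that `x ^ (p ^ e) = x`, of an
algebraic closure `k` of `𝔽_p`. -/
def finiteSubfield (k : Type*) [Field k] (p : ℕ) [Fact p.Prime] [CharP k p] (e : ℕ) : Subfield k :=
  (iterateFrobenius k p e).eqLocusField (RingHom.id k)

instance finiteSubfield_finite (k : Type*) [Field k] (p : ℕ) [Fact p.Prime] [CharP k p] (e : ℕ)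
    [NeZero e] : Finite (finiteSubfield k p e) := by
  have hp := (Fact.out : p.Prime)
  have h1 : 1 < p ^ e := Nat.one_lt_pow (NeZero.ne e) hp.one_lt
  classical
  have h0 : (X ^ (p ^ e) - X : k[X]) ≠ 0 := FiniteField.X_pow_card_sub_X_ne_zero k h1
  refine Set.Finite.to_subtype (Set.Finite.subset (X ^ (p ^ e) - X : k[X]).roots.toFinset.finite_toSet
    fun x hx => ?_)
  have hx' : x ^ (p ^ e) = x := by
    have : iterateFrobenius k p e x = x := hx
    rwa [iterateFrobenius_def] at this
  simp [h0, hx']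

/-- The Jacobi sum `j_k(χ, ψ) = - ∑_{x + y = 1} χ(x) ψ(y)`. A `MulChar` vanishes at `0`, as the
extension by zero of a nontrivial character does; only nontrivial characters are used below. -/
def jac {k L : Type*} [Field k] [Fintype k] [Field L] (χ ψ : MulChar k L) : L := -jacobiSum χ ψ

open Classical in
/-- The character `λ` of order two of a finite field of odd characteristic, with values in `L`. -/
def quadChar (k L : Type*) [Field k] [Fintype k] [Field L] : MulChar k L :=
  (quadraticChar k).ringHomComp (Int.castRingHom L)

/-- `χ ^ 2 (4) · j(χ, χ) · j(λ χ ^ 2, χ⁻¹)`, for a character `χ` of a finite field. -/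
def jacobiProduct {k L : Type*} [Field k] [Fintype k] [Field L] (χ : MulChar k L) : L :=
  (χ ^ 2) 4 * jac χ χ * jac (quadChar k L * χ ^ 2) χ⁻¹

variable (p f d : ℕ) [Fact p.Prime] {L : Type*} [Field L] [IsAlgClosed L] [CharZero L]
  (𝔓 : Ideal (integralClosure ℤ L)) [𝔓.IsMaximal] [CharP (integralClosure ℤ L ⧸ 𝔓) p]

attribute [local instance] Ideal.Quotient.field

/-- The field `𝔽_{q ^ m}`, where `q = p ^ f`, as a subfield of the residue field of `𝔓`. -/
abbrev residueSubfield (m : ℕ) : Subfield (integralClosure ℤ L ⧸ 𝔓) :=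
  finiteSubfield (integralClosure ℤ L ⧸ 𝔓) p (f * m)

/-- The character `𝐭_n : x ↦ 𝐭(x) ^ ((q ^ |n| - 1) n / 2d)` of `𝔽_{q ^ |n|}`, where `q = p ^ f` and
`|n|` is the length of the orbit of `n` (so that the division is exact). -/
def teichmullerChar (n : ZMod (2 * d)) :
    MulChar (residueSubfield p f 𝔓 (qOrbit (p ^ f) n).ncard) L :=
  MulChar.ofUnitHom
    (((teichmuller p 𝔓).comp
      (Units.map ((residueSubfield p f 𝔓 (qOrbit (p ^ f) n).ncard).subtype :
        residueSubfield p f 𝔓 (qOrbit (p ^ f) n).ncard →* integralClosure ℤ L ⧸ 𝔓))) ^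
      (((p ^ f) ^ (qOrbit (p ^ f) n).ncard - 1) * n.val / (2 * d)))

/-- The number `β(n) = 𝐭_n ^ 2 (4) · j(𝐭_n, 𝐭_n) · j(λ 𝐭_n ^ 2, 𝐭_n⁻¹)`, the Jacobi sums being those
of `𝔽_{q ^ |n|}`, where `q = p ^ f`. -/
def beta [NeZero f] [NeZero d] (n : ZMod (2 * d)) : L :=
  haveI : NeZero (f * (qOrbit (p ^ f) n).ncard) :=
    ⟨mul_ne_zero (NeZero.ne f) (qOrbit_ncard_ne_zero (p ^ f) n)⟩
  letI : Fintype (residueSubfield p f 𝔓 (qOrbit (p ^ f) n).ncard) := Fintype.ofFinite _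
  jacobiProduct (teichmullerChar p f d 𝔓 n)

end Beta

end GriffonRank

end

noncomputable section

namespace GriffonRank

/-! ### Logarithmic derivatives of power series -/

section LogDeriv

open PowerSeries

variable {R : Type*} [CommRing R]

/-! The logarithmic derivative `T L' / L` turns the Euler product into power sums, and these can be
evaluated by character sums. Over an algebraically closed field `L` of characteristic zero every
Euler polynomial factors as `(1 - α T ^ deg v) (1 - β T ^ deg v)`, with `α β = 0` at the bad places.
The traces of the reduced cubic over extensions of the residue field are `α ^ n + β ^ n`, so the
places of degree dividing `m`, weighted by their degree, add up to a sum over the points `τ` of the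
field with `q ^ m` elements of the trace of the fibre at `τ`. The place at infinity has a split node
and contributes `1`. This is `isLogDeriv_lFunction_curve`, which rests on explicit minimal models
(`exists_model_finite`, `eulerPolynomial_infinite`).

For `τ ≠ 0` the fibre is `y ^ 2 = x (x ^ 2 + s x - 4 s)` with `s = τ ^ (2 d)`. The number of such
`τ` over a given `s` is a sum of characters of order dividing `2 d`, and since the cubic is linear
in `s` each twisted sum is a product of two Jacobi sums (`sum_twisted_cubic`). The trivial character
gives `q ^ m`. The quadratic character gives `1`, which cancels the place at infinity. For even `d`
the characters of order four, when they exist, cancel the fibre at `τ = 0`; otherwise that fibre has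
trace zero. What is left is the sum over `Z_{2d}` (`sum_fiber`).

The Hasse–Davenport relation rewrites the Jacobi sums over the large field as powers of `β(n)`, and
`β` is constant on orbits. The power sums are therefore those of `(1 - q T) ∏ (1 - β(o) T ^ |o|)`,
and comparison of the constant terms gives equality with the `L`-function (`map_lFunction_curve`).
In characteristic zero a factor `1 - β T ^ k` has at most a simple zero at `1 / q`, and has one
exactly when `β = q ^ k`; the factor `1 - q T` accounts for the summand `1`.

Both Hasse–Davenport and the formula `α ^ n + β ^ n` come from one mechanism. A multiplicative
function on monic polynomials whose sums vanish in large degree has a polynomial as generating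
series, of degree one for Jacobi sums and two for cubics. Newton's identities
(`isLogDeriv_monicSum`) then give its power sums, which `primePowerSum_finrank` reads as sums over
the extension fields. -/

/-- `T G' = G · ∑ p_i T ^ i`: the coefficients `p_i` are the power sums attached to `G`. -/
def IsLogDeriv (G : PowerSeries R) (p : ℕ → R) : Prop :=
  (PowerSeries.X : PowerSeries R) * d⁄dX R G = G * PowerSeries.mk p

theorem coeff_X_mul_derivative (G : PowerSeries R) (n : ℕ) :
    coeff n ((PowerSeries.X : PowerSeries R) * d⁄dX R G) = n * coeff n G := by
  cases n with
  | zero => simp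
  | succ n =>
    rw [coeff_succ_X_mul, coeff_derivative]
    push_cast
    ring

theorem isLogDeriv_iff {G : PowerSeries R} {p : ℕ → R} :
    IsLogDeriv G p ↔
      ∀ n : ℕ, n * coeff n G = ∑ ij ∈ Finset.HasAntidiagonal.antidiagonal n, coeff ij.1 G * p ij.2 := by
  rw [IsLogDeriv, PowerSeries.ext_iff]
  refine forall_congr' fun n => ?_
  rw [coeff_X_mul_derivative, coeff_mul]
  simp only [coeff_mk]

theorem IsLogDeriv.congr {G : PowerSeries R} {p p' : ℕ → R} (h : IsLogDeriv G p)
    (hp : ∀ n, p n = p' n) : IsLogDeriv G p' := by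
  rwa [← funext hp]

theorem isLogDeriv_one : IsLogDeriv (1 : PowerSeries R) 0 := by
  rw [IsLogDeriv, derivative_one, mul_zero, one_mul]
  ext
  simp

theorem IsLogDeriv.mul {G H : PowerSeries R} {p r : ℕ → R} (hG : IsLogDeriv G p)
    (hH : IsLogDeriv H r) : IsLogDeriv (G * H) (p + r) := by
  have h : PowerSeries.mk (p + r) = PowerSeries.mk p + PowerSeries.mk r := by
    ext; simp
  rw [IsLogDeriv] at *
  rw [Derivation.leibniz, h, smul_eq_mul, smul_eq_mul]
  linear_combination G * hH + H * hG

theorem IsLogDeriv.prod {ι : Type*} (s : Finset ι) {G : ι → PowerSeries R} {p : ι → ℕ → R}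
    (h : ∀ i ∈ s, IsLogDeriv (G i) (p i)) :
    IsLogDeriv (∏ i ∈ s, G i) (fun n => ∑ i ∈ s, p i n) := by
  classical
  induction s using Finset.induction_on with
  | empty => simpa using isLogDeriv_one.congr (p' := fun _ => 0) (fun n => rfl)
  | insert a s ha ih =>
    rw [Finset.prod_insert ha]
    refine ((h a (by simp)).mul (ih fun i hi => h i (by simp [hi]))).congr fun n => ?_
    rw [Finset.sum_insert ha]
    rfl

theorem IsLogDeriv.of_mul_eq_one {G H : PowerSeries R} {p : ℕ → R} (hG : IsLogDeriv G p)
    (h : G * H = 1) : IsLogDeriv H (-p) := by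
  have h1 := congrArg (d⁄dX R) h
  rw [Derivation.leibniz, derivative_one, smul_eq_mul, smul_eq_mul] at h1
  have hp : PowerSeries.mk (-p) = -PowerSeries.mk p := by ext; simp
  rw [IsLogDeriv] at *
  rw [hp]
  linear_combination (PowerSeries.X * H) * h1 - H * H * hG -
    ((PowerSeries.X : PowerSeries R) * d⁄dX R H + H * PowerSeries.mk p) * h

/-- This is the expansion `-k β T ^ k / (1 - β T ^ k) = -k ∑ β ^ j T ^ (k j)` over `j ≥ 1`. The
clause `n ≠ 0` is needed because `k` divides `0`. -/
theorem isLogDeriv_one_sub (β : R) {k : ℕ} (hk : k ≠ 0) :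
    IsLogDeriv (1 - C β * (PowerSeries.X : PowerSeries R) ^ k)
      (fun n => if k ∣ n ∧ n ≠ 0 then -(k * β ^ (n / k)) else 0) := by
  rw [isLogDeriv_iff]
  intro n
  have hc : ∀ i, coeff i (1 - C β * (PowerSeries.X : PowerSeries R) ^ k) =
      (if i = 0 then 1 else 0) - if i = k then β else 0 := by
    intro i
    rw [map_sub, coeff_one, coeff_C_mul, coeff_X_pow]
    simp
  simp only [hc, sub_mul, ite_mul, one_mul, zero_mul, Finset.sum_sub_distrib]
  rw [Finset.Nat.sum_antidiagonal_eq_sum_range_succ_mk,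
    Finset.Nat.sum_antidiagonal_eq_sum_range_succ_mk]
  simp only [Finset.sum_ite_eq', Finset.mem_range]
  rw [if_pos (Nat.succ_pos n), Nat.sub_zero]
  rcases Nat.eq_zero_or_pos n with rfl | hn
  · simp [hk]
  have hn0 : n ≠ 0 := hn.ne'
  by_cases hkn : k ≤ n
  -- With `n = k + r` the identity to check is `p (k + r) = β p r`, except for `r = 0`, where the
  -- left side supplies the initial value `p k = -k β`.
  · obtain ⟨r, rfl⟩ := Nat.exists_eq_add_of_le hkn
    have h1 : k < (k + r).succ := by omega
    simp only [hn0, h1, Nat.add_sub_cancel_left, if_true, if_false, ne_eq, not_false_eq_true,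
      and_true]
    by_cases hr : r = 0
    · subst hr
      simp [Nat.div_self (Nat.pos_of_ne_zero hk)]
    have h2 : k + r ≠ k := by omega
    by_cases hd : k ∣ r
    · obtain ⟨e, rfl⟩ := hd
      have h3 : k + k * e = k * (e + 1) := by ring
      have h4 : k ∣ k + k * e := by simp
      simp only [hr, h2, h4, dvd_mul_right, if_true, if_false, not_false_eq_true, and_true]
      rw [h3, Nat.mul_div_cancel_left _ (Nat.pos_of_ne_zero hk),
        Nat.mul_div_cancel_left _ (Nat.pos_of_ne_zero hk)]
      ring
    · have h4 : ¬ k ∣ k + r := by simpa using hd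
      simp [h4, hd, hr]
  · have h1 : ¬ k < n.succ := by omega
    have h2 : n ≠ k := by omega
    have h4 : ¬ k ∣ n := fun h => hkn (Nat.le_of_dvd hn h)
    simp [hn0, h1, h2, h4]

theorem IsLogDeriv.right_unique [IsDomain R] {G : PowerSeries R} {p r : ℕ → R} (hG : G ≠ 0)
    (hp : IsLogDeriv G p) (hr : IsLogDeriv G r) : p = r := by
  have h : PowerSeries.mk p = PowerSeries.mk r := mul_left_cancel₀ hG (hp.symm.trans hr)
  funext n
  simpa using congrArg (coeff n) h

/-- Newton's recursion expresses `n` times the `n`-th coefficient through lower ones, because `p 0 =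
0` removes the term containing the `n`-th coefficient itself; characteristic zero allows division by
`n`. -/
theorem IsLogDeriv.left_unique [IsDomain R] [CharZero R] {G H : PowerSeries R} {p : ℕ → R}
    (h0 : constantCoeff G = constantCoeff H) (hp0 : p 0 = 0)
    (hG : IsLogDeriv G p) (hH : IsLogDeriv H p) : G = H := by
  rw [isLogDeriv_iff] at hG hH
  ext n
  induction n using Nat.strong_induction_on with
  | _ n ih =>
    rcases Nat.eq_zero_or_pos n with rfl | hn
    · simpa using h0
    refine mul_left_cancel₀ (Nat.cast_ne_zero.mpr hn.ne') ((hG n).trans (Eq.trans ?_ (hH n).symm))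
    refine Finset.sum_congr rfl fun ij hij => ?_
    rw [Finset.HasAntidiagonal.mem_antidiagonal] at hij
    by_cases hj : ij.2 = 0
    · simp [hj, hp0]
    · rw [ih ij.1 (by omega)]

/-- A logarithmic derivative may be computed up to any given order on an approximation. -/
theorem IsLogDeriv.of_approx {G : PowerSeries R} {p : ℕ → R}
    (h : ∀ N : ℕ, ∃ (H : PowerSeries R) (r : ℕ → R), IsLogDeriv H r ∧
      ∀ i ≤ N, coeff i G = coeff i H ∧ p i = r i) : IsLogDeriv G p := by
  rw [isLogDeriv_iff]
  intro n
  obtain ⟨H, r, hH, hi⟩ := h n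
  rw [(hi n le_rfl).1, isLogDeriv_iff.mp hH n]
  refine Finset.sum_congr rfl fun ij hij => ?_
  rw [Finset.HasAntidiagonal.mem_antidiagonal] at hij
  rw [(hi ij.1 (by omega)).1, (hi ij.2 (by omega)).2]

theorem IsLogDeriv.map {S : Type*} [CommRing S] (φ : R →+* S) {G : PowerSeries R} {p : ℕ → R}
    (h : IsLogDeriv G p) : IsLogDeriv (PowerSeries.map φ G) (fun n => φ (p n)) := by
  rw [isLogDeriv_iff] at *
  intro n
  have := congrArg φ (h n)
  simpa [map_sum] using this

end LogDeriv

/-! ### Infinite products of power series with few factors in each degree -/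

section Products

open PowerSeries

variable {R : Type*} [CommRing R] {ι : Type*} {f : ι → PowerSeries R} {w : ι → ℕ}

theorem X_pow_dvd_prod_sub_one (s : Finset ι) {N : ℕ}
    (h : ∀ i ∈ s, (PowerSeries.X : PowerSeries R) ^ N ∣ f i - 1) :
    (PowerSeries.X : PowerSeries R) ^ N ∣ ∏ i ∈ s, f i - 1 := by
  classical
  induction s using Finset.induction_on with
  | empty => simp
  | insert a s ha ih =>
    rw [Finset.prod_insert ha]
    have h1 := h a (by simp)
    have h2 := ih fun i hi => h i (by simp [hi])
    have : f a * ∏ i ∈ s, f i - 1 = f a * (∏ i ∈ s, f i - 1) + (f a - 1) := by ring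
    rw [this]
    exact dvd_add (h2.mul_left _) h1

/-- The factors outside `s` have weight greater than `N`, so their product is congruent to `1`
modulo `X ^ (N + 1)`. -/
theorem coeff_prod_eq_of_subset (hf : ∀ i, (PowerSeries.X : PowerSeries R) ^ w i ∣ f i - 1)
    {s t : Finset ι} (hst : s ⊆ t) {N : ℕ} (hs : ∀ i, w i ≤ N → i ∈ s) {n : ℕ} (hn : n ≤ N) :
    coeff n (∏ i ∈ t, f i) = coeff n (∏ i ∈ s, f i) := by
  classical
  rw [← Finset.prod_sdiff hst]
  have h : (PowerSeries.X : PowerSeries R) ^ (N + 1) ∣ ∏ i ∈ t \ s, f i - 1 := by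
    refine X_pow_dvd_prod_sub_one _ fun i hi => ?_
    rw [Finset.mem_sdiff] at hi
    have : N + 1 ≤ w i := by
      by_contra hlt
      exact hi.2 (hs i (by omega))
    exact (pow_dvd_pow _ this).trans (hf i)
  have h2 := h.mul_right (∏ i ∈ s, f i)
  rw [X_pow_dvd_iff] at h2
  have h3 := h2 n (by omega)
  rwa [sub_mul, one_mul, map_sub, sub_eq_zero] at h3

open scoped PowerSeries.WithPiTopology in
/-- An infinite product in which only finitely many factors matter for each coefficient. -/
theorem hasProd_of_X_pow_dvd [TopologicalSpace R]
    (hf : ∀ i, (PowerSeries.X : PowerSeries R) ^ w i ∣ f i - 1)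
    (hw : ∀ N, {i | w i ≤ N}.Finite) :
    HasProd f (PowerSeries.mk fun n => coeff n (∏ i ∈ (hw n).toFinset, f i)) := by
  rw [HasProd, PowerSeries.WithPiTopology.tendsto_iff_coeff_tendsto]
  intro n
  refine tendsto_const_nhds.congr' ?_
  filter_upwards [Filter.eventually_ge_atTop (hw n).toFinset] with t ht
  rw [coeff_mk, coeff_prod_eq_of_subset hf ht (N := n) (fun i hi => by simpa using hi) le_rfl]

open scoped PowerSeries.WithPiTopology in
theorem coeff_tprod_eq [TopologicalSpace R] [T2Space R]
    (hf : ∀ i, (PowerSeries.X : PowerSeries R) ^ w i ∣ f i - 1)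
    (hw : ∀ N, {i | w i ≤ N}.Finite) {n N : ℕ} (hn : n ≤ N) :
    coeff n (∏' i, f i) = coeff n (∏ i ∈ (hw N).toFinset, f i) := by
  rw [(hasProd_of_X_pow_dvd hf hw).tprod_eq, coeff_mk]
  refine (coeff_prod_eq_of_subset hf (N := n) ?_ (fun i hi => by simpa using hi) le_rfl).symm
  intro i hi
  simp only [Set.Finite.mem_toFinset, Set.mem_ofPred_eq] at hi ⊢
  exact hi.trans hn

end Products

end GriffonRank

end

noncomputable section

open Polynomial

namespace GriffonRank

/-! ### Sums of multiplicative functions over monic polynomials -/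

section Newton

variable {k : Type*} [Field k] [Finite k]

theorem finite_setOf_natDegree_le (n : ℕ) : {h : k[X] | h.natDegree ≤ n}.Finite := by
  refine Set.Finite.of_injOn (f := fun h (i : Fin (n + 1)) => h.coeff i) (t := Set.univ)
    (fun _ _ => Set.mem_univ _) ?_ Set.finite_univ
  intro g hg h hh hgh
  ext i
  by_cases hi : i < n + 1
  · exact congrFun hgh ⟨i, hi⟩
  · have h1 : g.natDegree ≤ n := hg
    have h2 : h.natDegree ≤ n := hh
    rw [coeff_eq_zero_of_natDegree_lt (by omega), coeff_eq_zero_of_natDegree_lt (by omega)]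

variable (k) in
open Classical in
/-- The monic polynomials of degree `n` over a finite field. -/
def monics (n : ℕ) : Finset k[X] :=
  (finite_setOf_natDegree_le n).toFinset.filter fun h => h.Monic ∧ h.natDegree = n

theorem mem_monics {n : ℕ} {h : k[X]} : h ∈ monics k n ↔ h.Monic ∧ h.natDegree = n := by
  simp only [monics, Finset.mem_filter, Set.Finite.mem_toFinset, Set.mem_ofPred_eq]
  exact ⟨fun h => h.2, fun h => ⟨h.2.le, h⟩⟩

variable (k) in
open Classical in
/-- The monic irreducible polynomials of degree at most `n` over a finite field. -/
def irreds (n : ℕ) : Finset k[X] :=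
  (finite_setOf_natDegree_le n).toFinset.filter fun h => h.Monic ∧ Irreducible h

theorem mem_irreds {n : ℕ} {h : k[X]} :
    h ∈ irreds k n ↔ h.Monic ∧ Irreducible h ∧ h.natDegree ≤ n := by
  simp only [irreds, Finset.mem_filter, Set.Finite.mem_toFinset, Set.mem_ofPred_eq]
  tauto

variable {R : Type*} [CommRing R]

/-- The sum of `Φ` over the monic polynomials of degree `n`. -/
def monicSum (Φ : k[X] → R) (n : ℕ) : R := ∑ h ∈ monics k n, Φ h

/-- The sum of `deg P · Φ(P) ^ (n / deg P)` over the monic irreducible `P` of degree dividing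
`n`. -/
def primePowerSum (Φ : k[X] → R) (n : ℕ) : R :=
  ∑ P ∈ (irreds k n).filter (fun P => P.natDegree ∣ n),
    (P.natDegree : R) * Φ P ^ (n / P.natDegree)

theorem primePowerSum_zero (Φ : k[X] → R) : primePowerSum Φ 0 = 0 := by
  rw [primePowerSum, Finset.sum_eq_zero]
  intro P hP
  rw [Finset.mem_filter, mem_irreds] at hP
  have := hP.1.2.1.natDegree_pos
  omega

theorem primePowerSum_eq_of_le (Φ : k[X] → R) {i n : ℕ} (hi : i ≠ 0) (hin : i ≤ n) :
    primePowerSum Φ i = ∑ P ∈ irreds k n,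
      if P.natDegree ∣ i then (P.natDegree : R) * Φ P ^ (i / P.natDegree) else 0 := by
  rw [primePowerSum, ← Finset.sum_filter]
  refine Finset.sum_congr ?_ fun _ _ => rfl
  ext P
  simp only [Finset.mem_filter, mem_irreds]
  refine ⟨fun h => ⟨⟨h.1.1, h.1.2.1, h.1.2.2.trans hin⟩, h.2⟩, fun h => ⟨⟨h.1.1, h.1.2.1, ?_⟩, h.2⟩⟩
  exact Nat.le_of_dvd (Nat.pos_of_ne_zero hi) h.2

-- The degree of `h` is the sum of `deg P` times the multiplicity of `P`, and the multiplicity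
-- counts the exponents `e ≥ 1` with `P ^ e ∣ h`. Indexing by `i = e deg P` prepares the convolution
-- in Newton's identities; this is the analogue of `log n = ∑ Λ(d)` over the divisors `d` of `n`.
open Classical in
theorem natDegree_eq_sum_pow_dvd {n : ℕ} {h : k[X]} (hm : h.Monic) (hn : h.natDegree = n) :
    n = ∑ P ∈ irreds k n, ∑ i ∈ Finset.Icc 1 n,
      if P.natDegree ∣ i ∧ P ^ (i / P.natDegree) ∣ h then P.natDegree else 0 := by
  set s := UniqueFactorizationMonoid.normalizedFactors h with hs
  have hprod : s.prod = h := by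
    rw [hs, UniqueFactorizationMonoid.prod_normalizedFactors_eq hm.ne_zero, hm.normalize_eq_self]
  have hmem : ∀ P ∈ s, Irreducible P ∧ P.Monic ∧ P ∣ h := fun P hP =>
    (Polynomial.mem_normalizedFactors_iff hm.ne_zero).mp hP
  have hsum : n = (s.map natDegree).sum := by
    rw [← natDegree_multiset_prod_of_monic _ fun P hP => (hmem P hP).2.1, hprod, hn]
  have hsub : s.toFinset ⊆ irreds k n := by
    intro P hP
    obtain ⟨h1, h2, h3⟩ := hmem P (Multiset.mem_toFinset.mp hP)
    exact mem_irreds.mpr ⟨h2, h1, hn ▸ natDegree_le_of_dvd h3 hm.ne_zero⟩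
  rw [Finset.sum_multiset_map_count] at hsum
  conv_lhs => rw [hsum]
  rw [Finset.sum_subset hsub (fun P _ hP => by
    rw [Multiset.count_eq_zero_of_notMem (by simpa using hP), zero_smul])]
  refine Finset.sum_congr rfl fun P hP => ?_
  obtain ⟨hPm, hPi, -⟩ := mem_irreds.mp hP
  have hdvd : ∀ e, P ^ e ∣ h ↔ e ≤ s.count P := by
    intro e
    rw [pow_dvd_iff_le_emultiplicity,
      UniqueFactorizationMonoid.emultiplicity_eq_count_normalizedFactors hPi hm.ne_zero,
      hPm.normalize_eq_self]
    exact Nat.cast_le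
  have hpos := hPi.natDegree_pos
  rw [← Finset.sum_filter, Finset.sum_const]
  congr 1
  have himg : (Finset.Icc 1 n).filter
      (fun i => P.natDegree ∣ i ∧ P ^ (i / P.natDegree) ∣ h) =
      (Finset.Icc 1 (s.count P)).image (fun e => P.natDegree * e) := by
    ext i
    simp only [Finset.mem_filter, Finset.mem_Icc, Finset.mem_image, hdvd]
    constructor
    · rintro ⟨⟨h1, h2⟩, ⟨e, rfl⟩, h3⟩
      rw [Nat.mul_div_cancel_left _ hpos] at h3
      exact ⟨e, ⟨Nat.pos_of_ne_zero (by rintro rfl; simp at h1), h3⟩, rfl⟩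
    · rintro ⟨e, ⟨h1, h2⟩, rfl⟩
      refine ⟨⟨Nat.mul_pos hpos h1, ?_⟩, dvd_mul_right _ _, ?_⟩
      · have h3 := natDegree_le_of_dvd ((hdvd e).mpr h2) hm.ne_zero
        rwa [natDegree_pow, hn, mul_comm] at h3
      · rwa [Nat.mul_div_cancel_left _ hpos]
  rw [himg, Finset.card_image_of_injective _ fun a b hab => Nat.eq_of_mul_eq_mul_left hpos hab]
  simp

theorem sum_monics_filter_dvd {Φ : k[X] → R} (hmul : ∀ g h : k[X], g.Monic → h.Monic →
    Φ (g * h) = Φ g * Φ h) {Q : k[X]} (hQ : Q.Monic) (n : ℕ)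
    [DecidablePred fun h : k[X] => Q ∣ h] (hn : Q.natDegree ≤ n) :
    ∑ h ∈ (monics k n).filter (fun h => Q ∣ h), Φ h =
      Φ Q * monicSum Φ (n - Q.natDegree) := by
  rw [monicSum, Finset.mul_sum]
  symm
  refine Finset.sum_bij (fun h _ => Q * h) ?_ ?_ ?_ ?_
  · intro h hh
    obtain ⟨h1, h2⟩ := mem_monics.mp hh
    rw [Finset.mem_filter, mem_monics, hQ.natDegree_mul h1, h2]
    exact ⟨⟨hQ.mul h1, by omega⟩, dvd_mul_right _ _⟩
  · intro g _ h _ hgh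
    exact mul_left_cancel₀ hQ.ne_zero hgh
  · rintro h hh
    rw [Finset.mem_filter, mem_monics] at hh
    obtain ⟨⟨h1, h2⟩, g, rfl⟩ := hh
    have hg : g.Monic := hQ.of_mul_monic_left h1
    refine ⟨g, mem_monics.mpr ⟨hg, ?_⟩, rfl⟩
    rw [hQ.natDegree_mul hg] at h2
    omega
  · intro h hh
    exact (hmul Q h hQ (mem_monics.mp hh).1).symm

end Newton

section NewtonExtension

theorem map_pow_of_monic {k R : Type*} [Field k] [CommRing R] {Φ : k[X] → R} (hone : Φ 1 = 1) (hmul : ∀ g h : k[X], g.Monic →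
    h.Monic → Φ (g * h) = Φ g * Φ h) {P : k[X]} (hP : P.Monic) (e : ℕ) : Φ (P ^ e) = Φ P ^ e := by
  induction e with
  | zero => simpa using hone
  | succ e ih => rw [pow_succ, hmul _ _ (hP.pow e) hP, ih, pow_succ]

variable {k : Type*} [Field k] [Finite k] {R : Type*} [CommRing R]

/-- Newton's identities for a multiplicative function on monic polynomials. -/
theorem isLogDeriv_monicSum {Φ : k[X] → R} (hone : Φ 1 = 1) (hmul : ∀ g h : k[X], g.Monic →
    h.Monic → Φ (g * h) = Φ g * Φ h) :
    IsLogDeriv (PowerSeries.mk (monicSum Φ)) (primePowerSum Φ) := by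
  classical
  rw [isLogDeriv_iff]
  intro n
  simp only [PowerSeries.coeff_mk]
  -- The factor `n` is the degree of every `h` in the sum and is expanded over prime powers dividing
  -- `h`. After the sums are exchanged, the inner one runs over the multiples of `P ^ e`, where
  -- multiplicativity applies.
  have h1 : (n : R) * monicSum Φ n = ∑ P ∈ irreds k n, ∑ i ∈ Finset.Icc 1 n,
      if P.natDegree ∣ i then (P.natDegree : R) * Φ P ^ (i / P.natDegree) * monicSum Φ (n - i)
      else 0 := by
    rw [monicSum, Finset.mul_sum]
    have h2 : ∀ h ∈ monics k n, (n : R) * Φ h = ∑ P ∈ irreds k n, ∑ i ∈ Finset.Icc 1 n,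
        if P.natDegree ∣ i ∧ P ^ (i / P.natDegree) ∣ h then (P.natDegree : R) * Φ h else 0 := by
      intro h hh
      obtain ⟨hm, hd⟩ := mem_monics.mp hh
      conv_lhs => rw [natDegree_eq_sum_pow_dvd hm hd]
      push_cast
      simp only [Finset.sum_mul, ite_mul, zero_mul]
    rw [Finset.sum_congr rfl h2, Finset.sum_comm]
    refine Finset.sum_congr rfl fun P hP => ?_
    obtain ⟨hPm, hPi, -⟩ := mem_irreds.mp hP
    rw [Finset.sum_comm]
    refine Finset.sum_congr rfl fun i hi => ?_
    rw [Finset.mem_Icc] at hi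
    split_ifs with hd
    · simp only [hd, true_and]
      obtain ⟨e, rfl⟩ := hd
      rw [Nat.mul_div_cancel_left _ hPi.natDegree_pos, ← Finset.sum_filter, ← Finset.mul_sum,
        sum_monics_filter_dvd hmul (hPm.pow e) n (by rw [natDegree_pow, mul_comm]; exact hi.2),
        natDegree_pow, map_pow_of_monic hone hmul hPm, mul_comm e]
      ring
    · simp [hd]
  rw [h1, Finset.sum_comm, Finset.Nat.antidiagonal_eq_map', Finset.sum_map]
  rw [← Finset.sum_subset (s₁ := Finset.Icc 1 n) (s₂ := Finset.range n.succ)]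
  · refine Finset.sum_congr rfl fun i hi => ?_
    rw [Finset.mem_Icc] at hi
    change _ = monicSum Φ (n - i) * primePowerSum Φ i
    rw [primePowerSum_eq_of_le Φ (by omega) hi.2, Finset.mul_sum]
    refine Finset.sum_congr rfl fun P _ => ?_
    split_ifs
    · ring
    · simp
  · intro i hi
    simp only [Finset.mem_Icc, Finset.mem_range] at *
    omega
  · intro i hi hi'
    simp only [Finset.mem_Icc, Finset.mem_range] at *
    have : i = 0 := by omega
    change monicSum Φ (n - i) * primePowerSum Φ i = 0
    rw [this, primePowerSum_zero, mul_zero]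

theorem monicSum_zero {Φ : k[X] → R} (hone : Φ 1 = 1) : monicSum Φ 0 = 1 := by
  have : monics k 0 = {1} := by
    ext h
    rw [mem_monics, Finset.mem_singleton]
    refine ⟨fun hh => hh.1.natDegree_eq_zero.mp hh.2, ?_⟩
    rintro rfl
    exact ⟨monic_one, natDegree_one⟩
  rw [monicSum, this, Finset.sum_singleton, hone]

theorem sum_monics_add {n : ℕ} {r : k[X]} (hr : r.degree < n) (Φ : k[X] → R) :
    ∑ h ∈ monics k n, Φ (h + r) = monicSum Φ n := by
  have key : ∀ s : k[X], s.degree < n → ∀ h ∈ monics k n, h + s ∈ monics k n := by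
    intro s hs h hh
    obtain ⟨h1, h2⟩ := mem_monics.mp hh
    have h3 : s.degree < h.degree := by rwa [degree_eq_natDegree h1.ne_zero, h2]
    exact mem_monics.mpr ⟨h1.add_of_left h3, by rw [natDegree_add_eq_left_of_degree_lt h3, h2]⟩
  refine Finset.sum_bij' (fun h _ => h + r) (fun h _ => h - r) (fun h hh => key r hr h hh) ?_
    ?_ ?_ ?_
  · intro h hh
    rw [sub_eq_add_neg]
    exact key _ (by rwa [degree_neg]) h hh
  · intros; simp
  · intros; simp
  · intros; simp

/-- If `Φ` averages to zero along the multiples of a fixed polynomial of degree `< n`, its sum over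
the monic polynomials of degree `n` vanishes. -/
theorem monicSum_eq_zero [Fintype k] [IsDomain R] [CharZero R] {n : ℕ} {r : k[X]}
    (hr : r.degree < n) {Φ : k[X] → R} (h : ∀ g ∈ monics k n, ∑ c : k, Φ (g + C c * r) = 0) :
    monicSum Φ n = 0 := by
  -- Translation by `c r` permutes the monic polynomials of degree `n`, so this double sum is `|k|`
  -- times the sum in question.
  have h1 : ∑ c : k, ∑ g ∈ monics k n, Φ (g + C c * r) = 0 := by
    rw [Finset.sum_comm]
    exact Finset.sum_eq_zero h
  have h2 : ∀ c : k, ∑ g ∈ monics k n, Φ (g + C c * r) = monicSum Φ n := fun c =>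
    sum_monics_add
    (by rw [← smul_eq_C_mul]; exact (degree_smul_le _ _).trans_lt hr) Φ
  rw [Finset.sum_congr rfl fun c _ => h2 c, Finset.sum_const, nsmul_eq_mul] at h1
  refine (mul_eq_zero.mp h1).resolve_left ?_
  exact Nat.cast_ne_zero.mpr (Finset.card_pos.mpr ⟨0, Finset.mem_univ _⟩).ne'

theorem monicSum_one [Fintype k] (Φ : k[X] → R) : monicSum Φ 1 = ∑ c : k, Φ (X - C c) := by
  rw [monicSum]
  symm
  refine Finset.sum_bij (fun c _ => X - C c) ?_ ?_ ?_ ?_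
  · intro c _
    exact mem_monics.mpr ⟨monic_X_sub_C c, natDegree_X_sub_C c⟩
  · intro a _ b _ hab
    exact C_injective (sub_right_injective hab)
  · intro h hh
    obtain ⟨h1, h2⟩ := mem_monics.mp hh
    refine ⟨-h.coeff 0, Finset.mem_univ _, ?_⟩
    rw [C_neg, sub_neg_eq_add]
    exact (h1.eq_X_add_C h2).symm
  · intros; rfl

theorem monicSum_two [Fintype k] (Φ : k[X] → R) :
    monicSum Φ 2 = ∑ u : k, ∑ w : k, Φ (X ^ 2 + C u * X + C w) := by
  rw [monicSum, ← Finset.sum_product']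
  symm
  refine Finset.sum_bij (fun c _ => X ^ 2 + C c.1 * X + C c.2) ?_ ?_ ?_ ?_
  · intro c _
    refine mem_monics.mpr ⟨?_, ?_⟩
    · monicity!
    · compute_degree!
  · intro a _ b _ hab
    have h1 := congrArg (fun f => f.coeff 1) hab
    have h0 := congrArg (fun f => f.coeff 0) hab
    simp [coeff_X, coeff_C] at h0 h1
    exact Prod.ext h1 h0
  · intro h hh
    obtain ⟨h1, h2⟩ := mem_monics.mp hh
    refine ⟨(h.coeff 1, h.coeff 0), Finset.mem_univ _, ?_⟩
    conv_rhs => rw [h1.as_sum, h2]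
    simp [Finset.sum_range_succ]
    ring
  · intros; rfl

end NewtonExtension

end GriffonRank

end

noncomputable section

open Polynomial

namespace GriffonRank

/-! ### Conjugates and norms over finite fields -/

section Conjugates

variable {k K : Type*} [Field k] [Field K] [Algebra k K] [Fintype k]

theorem pow_card_pow_injective (i : ℕ) :
    Function.Injective fun x : K => x ^ Fintype.card k ^ i := by
  have h : ∀ x : K, x ^ Fintype.card k ^ i = (FiniteField.frobeniusAlgHom k K ^ i) x := by
    intro x
    rw [AlgHom.coe_pow, FiniteField.coe_frobeniusAlgHom, pow_iterate]
  intro x y hxy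
  simp only [h] at hxy
  exact (FiniteField.frobeniusAlgHom k K ^ i).toRingHom.injective hxy

theorem aeval_pow_card_pow (g : k[X]) (x : K) (i : ℕ) :
    aeval (x ^ Fintype.card k ^ i) g = aeval x g ^ Fintype.card k ^ i := by
  have h : ∀ x : K, x ^ Fintype.card k ^ i = (FiniteField.frobeniusAlgHom k K ^ i) x := by
    intro x
    rw [AlgHom.coe_pow, FiniteField.coe_frobeniusAlgHom, pow_iterate]
  rw [h, h, aeval_algHom_apply]

variable [Fintype K]

theorem pow_card_pow_eq_self_iff (x : K) (i : ℕ) :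
    x ^ Fintype.card k ^ i = x ↔ (minpoly k x).natDegree ∣ i := by
  rw [(minpoly.irreducible (Algebra.IsIntegral.isIntegral x)).natDegree_dvd_iff_dvd_X_pow_card_pow_sub_X,
    minpoly.dvd_iff, Nat.card_eq_fintype_card]
  simp [sub_eq_zero]

theorem map_minpoly_eq_prod (x : K) :
    (minpoly k x).map (algebraMap k K) =
      ∏ i ∈ Finset.range (minpoly k x).natDegree, (X - C (x ^ Fintype.card k ^ i)) := by
  classical
  set e := (minpoly k x).natDegree
  have hinj : Set.InjOn (fun i => x ^ Fintype.card k ^ i) (Finset.range e : Set ℕ) := by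
    -- If two conjugates coincided, the Frobenius would cancel and leave `x` fixed by its `(b -
    -- a)`-th power, whence `e ∣ b - a` with `0 < b - a < e`.
    have key : ∀ a b, a < b → b < e → x ^ Fintype.card k ^ a ≠ x ^ Fintype.card k ^ b := by
      intro a b hab hb h
      obtain ⟨c, rfl⟩ := Nat.exists_eq_add_of_lt hab
      have h1 : x = x ^ Fintype.card k ^ (c + 1) := by
        apply pow_card_pow_injective (k := k) a
        change x ^ _ = (x ^ _) ^ _
        rw [h, ← pow_mul, ← pow_add]
        congr 2
        ring
      have h2 := Nat.le_of_dvd (by omega) ((pow_card_pow_eq_self_iff x (c + 1)).mp h1.symm)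
      omega
    intro a ha b hb hab
    simp only [Finset.coe_range, Set.mem_Iio] at ha hb
    rcases lt_trichotomy a b with h | h | h
    · exact (key a b h hb hab).elim
    · exact h
    · exact (key b a h ha hab.symm).elim
  have hm : (minpoly k x).Monic := minpoly.monic (Algebra.IsIntegral.isIntegral x)
  apply eq_of_monic_of_dvd_of_natDegree_le (monic_prod_of_monic _ _ fun i _ => monic_X_sub_C _)
    (hm.map _)
  · refine Finset.prod_dvd_of_coprime ?_ ?_
    · intro a ha b hb hab
      exact pairwise_coprime_X_sub_C (s := id) Function.injective_id
        (fun h => hab (hinj ha hb h))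
    · intro i _
      rw [dvd_iff_isRoot, IsRoot, eval_map_algebraMap, aeval_pow_card_pow, minpoly.aeval,
        zero_pow (pow_ne_zero _ Fintype.card_ne_zero)]
  · rw [natDegree_prod_of_monic _ _ fun i _ => monic_X_sub_C _]
    simp only [natDegree_X_sub_C, hm.natDegree_map]
    simp [e]

/-- The `[K : k]` Frobenius conjugates of `x` run through the roots of its minimal polynomial `[K :
k] / deg` times. The right side is the characteristic polynomial of `x`. -/
theorem prod_conjugates_eq (x : K) :
    ∏ i ∈ Finset.range (Module.finrank k K), (X - C (x ^ Fintype.card k ^ i)) =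
      (minpoly k x ^ (Module.finrank k K / (minpoly k x).natDegree)).map (algebraMap k K) := by
  set e := (minpoly k x).natDegree with he
  have key : ∀ r, ∏ i ∈ Finset.range (e * r), (X - C (x ^ Fintype.card k ^ i)) =
      ((minpoly k x).map (algebraMap k K)) ^ r := by
    intro r
    induction r with
    | zero => simp
    | succ r ih =>
      rw [mul_add, mul_one, Finset.prod_range_add, ih, pow_succ, map_minpoly_eq_prod]
      congr 1
      refine Finset.prod_congr rfl fun i _ => ?_
      rw [pow_add, pow_mul, (pow_card_pow_eq_self_iff x (e * r)).mpr (dvd_mul_right _ _)]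
  rw [Polynomial.map_pow, ← key, Nat.mul_div_cancel' (minpoly.degree_dvd (Algebra.IsIntegral.isIntegral x))]

theorem algebraMap_norm_eq_prod (y : K) : algebraMap k K (Algebra.norm k y) =
    ∏ i ∈ Finset.range (Module.finrank k K), y ^ Fintype.card k ^ i := by
  rw [FiniteField.algebraMap_norm_eq_pow_sum, Finset.prod_pow_eq_pow_sum]
  simp [Nat.card_eq_fintype_card]

theorem algebraMap_norm_aeval_eq_prod (g : k[X]) (x : K) :
    algebraMap k K (Algebra.norm k (aeval x g)) =
    ∏ i ∈ Finset.range (Module.finrank k K), aeval (x ^ Fintype.card k ^ i) g := by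
  rw [algebraMap_norm_eq_prod]
  exact Finset.prod_congr rfl fun i _ => (aeval_pow_card_pow g x i).symm

/-- The sum over an extension of a function of the minimal polynomial. -/
theorem sum_minpoly {R : Type*} [CommRing R] (G : k[X] → R) :
    ∑ x : K, G (minpoly k x) = ∑ P ∈ (irreds k (Module.finrank k K)).filter
      (fun P => P.natDegree ∣ Module.finrank k K), (P.natDegree : R) * G P := by
  classical
  have hpos : 0 < Module.finrank k K := Module.finrank_pos
  rw [← Finset.sum_fiberwise_of_maps_to (g := fun x : K => minpoly k x)
    (t := (irreds k (Module.finrank k K)).filter (fun P => P.natDegree ∣ Module.finrank k K))]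
  · refine Finset.sum_congr rfl fun P hP => ?_
    rw [Finset.mem_filter, mem_irreds] at hP
    obtain ⟨⟨hPm, hPi, -⟩, hPd⟩ := hP
    rw [Finset.sum_congr rfl (g := fun _ => G P) fun x hx => by
      rw [(Finset.mem_filter.mp hx).2], Finset.sum_const, nsmul_eq_mul]
    congr 2
    -- The fibre over `P` has `deg P` elements: `P` is separable and, its degree dividing `[K : k]`,
    -- splits in `K`; the elements with minimal polynomial `P` are its roots.
    have hsep : P.Separable := PerfectField.separable_of_irreducible hPi
    have hsplit : (P.map (algebraMap k K)).Splits := by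
      have h1 := hPi.natDegree_dvd_iff_dvd_X_pow_card_pow_sub_X.mp hPd
      rw [← Module.natCard_eq_pow_finrank (K := k) (V := K), Nat.card_eq_fintype_card] at h1
      have h2 := Polynomial.map_dvd (algebraMap k K) h1
      refine Splits.of_dvd ?_ ?_ h2
      · simpa using Polynomial.splits_X_pow_nat_card_sub_X (K := K)
      · simpa using FiniteField.X_pow_card_sub_X_ne_zero K Fintype.one_lt_card
    rw [← card_rootSet_eq_natDegree hsep hsplit, ← Set.toFinset_card]
    congr 1
    ext x
    rw [Finset.mem_filter, Set.mem_toFinset, mem_rootSet]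
    simp only [Finset.mem_univ, true_and]
    constructor
    · rintro rfl
      exact ⟨hPi.ne_zero, minpoly.aeval _ _⟩
    · rintro ⟨-, h⟩
      exact (minpoly.eq_of_irreducible_of_monic hPi h hPm).symm
  · intro x _
    rw [Finset.mem_filter, mem_irreds]
    have hx : IsIntegral k x := Algebra.IsIntegral.isIntegral x
    exact ⟨⟨minpoly.monic hx, minpoly.irreducible hx,
      Nat.le_of_dvd hpos (minpoly.degree_dvd (Algebra.IsIntegral.isIntegral x))⟩, minpoly.degree_dvd (Algebra.IsIntegral.isIntegral x)⟩

/-- The bridge from prime polynomials to points: an element `x` of `K` contributes the value of `Φ`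
at its characteristic polynomial, where `Φ` becomes a norm from `K`. -/
theorem primePowerSum_finrank {R : Type*} [CommRing R] {Φ : k[X] → R} (hone : Φ 1 = 1)
    (hmul : ∀ g h : k[X], g.Monic → h.Monic → Φ (g * h) = Φ g * Φ h) :
    primePowerSum Φ (Module.finrank k K) =
      ∑ x : K, Φ (minpoly k x ^ (Module.finrank k K / (minpoly k x).natDegree)) := by
  rw [primePowerSum, ← sum_minpoly (fun P => Φ P ^ (Module.finrank k K / P.natDegree))]
  exact Finset.sum_congr rfl fun x _ => (map_pow_of_monic hone hmul
    (minpoly.monic (Algebra.IsIntegral.isIntegral x)) _).symm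

end Conjugates

end GriffonRank

end

noncomputable section

open Polynomial

namespace GriffonRank

/-! ### The Hasse–Davenport relation for Jacobi sums -/

section HasseDavenport

variable {k : Type*} [Field k] {R : Type*} [CommRing R]

/-- The function `h ↦ χ(∏ r) ψ(∏ (1 - r))` on monic polynomials `h = ∏ (X - r)`. -/
def jacobiWeight (χ ψ : MulChar k R) (h : k[X]) : R :=
  χ ((-1) ^ h.natDegree * h.eval 0) * ψ (h.eval 1)

theorem jacobiWeight_one (χ ψ : MulChar k R) : jacobiWeight χ ψ 1 = 1 := by
  simp [jacobiWeight]

theorem jacobiWeight_mul (χ ψ : MulChar k R) (g h : k[X]) (hg : g.Monic) (hh : h.Monic) :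
    jacobiWeight χ ψ (g * h) = jacobiWeight χ ψ g * jacobiWeight χ ψ h := by
  simp only [jacobiWeight, hg.natDegree_mul hh, eval_mul, pow_add, map_mul]
  ring

variable [Fintype k]

theorem monicSum_jacobiWeight_one (χ ψ : MulChar k R) :
    monicSum (jacobiWeight χ ψ) 1 = jacobiSum χ ψ := by
  rw [monicSum_one, jacobiSum]
  refine Finset.sum_congr rfl fun c _ => ?_
  simp [jacobiWeight]

theorem sum_mulChar_affine [IsDomain R] {χ : MulChar k R} (hχ : χ ≠ 1) (a : k) {b : k}
    (hb : b ≠ 0) : ∑ c : k, χ (a + c * b) = 0 := by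
  rw [← MulChar.sum_eq_zero_of_ne_one hχ]
  exact Fintype.sum_equiv ((Equiv.mulRight₀ b hb).trans (Equiv.addLeft a)) _ _ fun c => rfl

/-- Adding `c (1 - X)` to `h` leaves `h(1)` unchanged and moves `h(0)` through all of `k`, and `χ`
sums to zero there. Since `1 - X` has degree one this works in every degree at least two. -/
theorem monicSum_jacobiWeight_eq_zero [IsDomain R] [CharZero R] {χ : MulChar k R} (hχ : χ ≠ 1)
    (ψ : MulChar k R) {n : ℕ} (hn : 2 ≤ n) : monicSum (jacobiWeight χ ψ) n = 0 := by
  have hdeg : (1 - X : k[X]).degree < n := by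
    refine lt_of_le_of_lt (degree_sub_le _ _) ?_
    rw [degree_one, degree_X]
    simp only [zero_le_one, sup_of_le_right]
    exact_mod_cast hn
  refine monicSum_eq_zero hdeg fun g hg => ?_
  obtain ⟨h1, h2⟩ := mem_monics.mp hg
  have h3 : ∀ c : k, (g + C c * (1 - X)).natDegree = n := by
    intro c
    rw [natDegree_add_eq_left_of_degree_lt, h2]
    rw [degree_eq_natDegree h1.ne_zero, h2, ← smul_eq_C_mul]
    exact (degree_smul_le _ _).trans_lt hdeg
  simp only [jacobiWeight, h3]
  simp only [eval_add, eval_mul, eval_C, eval_sub, eval_one, eval_X, sub_zero, mul_one, sub_self,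
    mul_zero, add_zero]
  rw [← Finset.sum_mul, ← sum_mulChar_affine hχ ((-1) ^ n * g.eval 0) (b := (-1) ^ n)
    (pow_ne_zero _ (by simp))]
  have : ∑ c : k, χ ((-1) ^ n * (g.eval 0 + c)) = 0 := by
    rw [← sum_mulChar_affine hχ ((-1) ^ n * g.eval 0) (b := (-1) ^ n)
      (pow_ne_zero _ (by simp))]
    exact Finset.sum_congr rfl fun c _ => by ring_nf
  rw [this, zero_mul, sum_mulChar_affine hχ _ (pow_ne_zero _ (by simp))]

/-- The generating series is the single factor `1 + J(χ, ψ) T`, so its power sums are pure powers.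
-/
theorem primePowerSum_jacobiWeight [IsDomain R] [CharZero R] {χ : MulChar k R} (hχ : χ ≠ 1)
    (ψ : MulChar k R) {n : ℕ} (hn : n ≠ 0) :
    primePowerSum (jacobiWeight χ ψ) n = -(-jacobiSum χ ψ) ^ n := by
  have h1 := isLogDeriv_monicSum (jacobiWeight_one χ ψ) (jacobiWeight_mul χ ψ)
  have h2 : PowerSeries.mk (monicSum (jacobiWeight χ ψ)) =
      1 - PowerSeries.C (-jacobiSum χ ψ) * PowerSeries.X ^ 1 := by
    ext i
    rw [PowerSeries.coeff_mk, map_sub, PowerSeries.coeff_one, PowerSeries.coeff_C_mul,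
      PowerSeries.coeff_X_pow]
    rcases i with _ | _ | i
    · simp [monicSum_zero (jacobiWeight_one χ ψ)]
    · simp [monicSum_jacobiWeight_one]
    · simp [monicSum_jacobiWeight_eq_zero hχ ψ (n := i + 1 + 1) (by omega)]
  rw [h2] at h1
  have h3 := isLogDeriv_one_sub (-jacobiSum χ ψ) one_ne_zero
  have h4 : (1 - PowerSeries.C (-jacobiSum χ ψ) * PowerSeries.X ^ 1 : PowerSeries R) ≠ 0 := by
    intro h
    simpa using congrArg PowerSeries.constantCoeff h
  rw [h1.right_unique h4 h3]
  simp [hn]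

variable {K : Type*} [Field K] [Fintype K] [Algebra k K]

/-- The Hasse–Davenport relation: for the characteristic polynomial `h` of `x`, the values `(-1) ^ n
h(0)` and `h(1)` are the norms of `x` and `1 - x`. -/
theorem sum_norm_eq_neg_jacobiSum_pow [IsDomain R] [CharZero R] {χ : MulChar k R} (hχ : χ ≠ 1)
    (ψ : MulChar k R) :
    ∑ x : K, χ (Algebra.norm k x) * ψ (Algebra.norm k (1 - x)) =
      -(-jacobiSum χ ψ) ^ Module.finrank k K := by
  rw [← primePowerSum_jacobiWeight hχ ψ (Module.finrank_pos (R := k) (M := K)).ne',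
    primePowerSum_finrank (K := K) (jacobiWeight_one χ ψ) (jacobiWeight_mul χ ψ)]
  refine Finset.sum_congr rfl fun x _ => ?_
  have hC := prod_conjugates_eq (k := k) x
  set h := minpoly k x ^ (Module.finrank k K / (minpoly k x).natDegree)
  have hinj := (algebraMap k K).injective
  have hdeg : h.natDegree = Module.finrank k K := by
    rw [← natDegree_map (algebraMap k K), ← hC, natDegree_prod_of_monic _ _ fun i _ =>
      monic_X_sub_C _]
    simp only [natDegree_X_sub_C]
    simp
  have hev : ∀ c : k, algebraMap k K (h.eval c) =
      ∏ i ∈ Finset.range (Module.finrank k K),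
        (algebraMap k K c - x ^ Fintype.card k ^ i) := by
    intro c
    rw [← eval₂_at_apply, ← eval_map, ← hC, eval_prod]
    simp
  rw [jacobiWeight, hdeg]
  congr 2
  · apply hinj
    rw [map_mul, hev, map_zero, algebraMap_norm_eq_prod, map_pow, map_neg, map_one]
    simp only [zero_sub]
    rw [Finset.prod_neg]
    simp [← mul_assoc, ← mul_pow]
  · apply hinj
    rw [hev, map_one]
    have := algebraMap_norm_aeval_eq_prod (1 - X : k[X]) x
    simpa using this

end HasseDavenport

end GriffonRank

end

noncomputable section

open Polynomial

namespace GriffonRank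

/-! ### Cubic character sums -/

section QuadraticChar

open scoped Classical

variable {k : Type*} [Field k] [Fintype k]

/-- An element `z` has `1 + λ(z)` square roots. -/
theorem sum_sq {R : Type*} [CommRing R] (hk : ringChar k ≠ 2) (f : k → R) :
    ∑ v : k, f (v ^ 2) = ∑ z : k, (1 + (quadraticChar k z : R)) * f z := by
  rw [← Finset.sum_fiberwise Finset.univ (fun v : k => v ^ 2)]
  refine Finset.sum_congr rfl fun z _ => ?_
  rw [Finset.sum_congr rfl (g := fun _ => f z) fun v hv => by rw [(Finset.mem_filter.mp hv).2],
    Finset.sum_const, nsmul_eq_mul]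
  congr 1
  have h := quadraticChar_card_sqrts hk z
  have h2 : (Finset.univ.filter fun v : k => v ^ 2 = z) = {x : k | x ^ 2 = z}.toFinset := by
    ext; simp
  rw [h2]
  have h3 := congrArg (Int.cast : ℤ → R) h
  push_cast at h3
  rw [h3, add_comm]

theorem sum_quadraticChar_affine (hk : ringChar k ≠ 2) (a : k) {b : k} (hb : b ≠ 0) :
    ∑ c : k, quadraticChar k (a + c * b) = 0 :=
  sum_mulChar_affine (quadraticChar_ne_one hk) a hb

theorem quadraticChar_mul_self {a : k} (ha : a ≠ 0) :
    quadraticChar k a * quadraticChar k a = 1 := by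
  rw [← sq, quadraticChar_sq_one ha]

theorem quadraticChar_sq_mul {a : k} (ha : a ≠ 0) (b : k) :
    quadraticChar k (a ^ 2 * b) = quadraticChar k b := by
  rw [map_mul, quadraticChar_sq_one' ha, one_mul]

theorem inv_quadraticChar : (quadraticChar k)⁻¹ = quadraticChar k :=
  quadraticChar_isQuadratic k |>.inv

theorem sum_quadraticChar_sq_sub (hk : ringChar k ≠ 2) {D : k} (hD : D ≠ 0) :
    ∑ v : k, quadraticChar k (v ^ 2 - D) = -1 := by
  rw [sum_sq hk fun z => quadraticChar k (z - D)]
  simp only [add_mul, one_mul, Finset.sum_add_distrib, Int.cast_id]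
  have h1 : ∑ z : k, quadraticChar k (z - D) = 0 := by
    rw [← sum_quadraticChar_affine hk (-D) one_ne_zero]
    exact Finset.sum_congr rfl fun z _ => by ring_nf
  have h2 : ∑ z : k, quadraticChar k z * quadraticChar k (z - D) =
      quadraticChar k (-1) * jacobiSum (quadraticChar k) (quadraticChar k)⁻¹ := by
    rw [inv_quadraticChar, jacobiSum, Finset.mul_sum]
    refine (Fintype.sum_equiv (Equiv.mulLeft₀ D hD) _ _ fun y => ?_).symm
    change _ = quadraticChar k (D * y) * quadraticChar k (D * y - D)
    rw [← map_mul, ← map_mul, ← map_mul, ← quadraticChar_sq_mul hD]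
    ring_nf
  rw [h1, h2, jacobiSum_nontrivial_inv (quadraticChar_ne_one hk), zero_add, mul_neg,
    quadraticChar_mul_self (by simp)]

/-- Completing the square with `v = 2 A u + B` gives `(2 A) ^ 2 (A u ^ 2 + B u + C) = A (v ^ 2 -
disc)`, which reduces to the sum of `λ(v ^ 2 - D)`. -/
theorem sum_quadraticChar_quadratic (hk : ringChar k ≠ 2) {A : k} (hA : A ≠ 0) (B C : k) :
    ∑ u : k, quadraticChar k (A * u ^ 2 + B * u + C) =
      if B ^ 2 - 4 * A * C = 0 then ((Fintype.card k : ℤ) - 1) * quadraticChar k A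
      else -quadraticChar k A := by
  have h2 : (2 : k) ≠ 0 := Ring.two_ne_zero hk
  have h1 : ∑ u : k, quadraticChar k (A * u ^ 2 + B * u + C) =
      quadraticChar k A * ∑ v : k, quadraticChar k (v ^ 2 - (B ^ 2 - 4 * A * C)) := by
    rw [Finset.mul_sum]
    refine Fintype.sum_equiv ((Equiv.mulLeft₀ (2 * A) (mul_ne_zero h2 hA)).trans
      (Equiv.addRight B)) _ _ fun u => ?_
    change _ = _ * quadraticChar k ((2 * A * u + B) ^ 2 - _)
    rw [← map_mul, ← quadraticChar_sq_mul (mul_ne_zero h2 hA)]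
    ring_nf
  rw [h1]
  split_ifs with h
  · rw [h, mul_comm]
    congr 1
    rw [← Finset.sum_erase_add _ _ (Finset.mem_univ (0 : k))]
    rw [Finset.sum_congr rfl (g := fun _ => (1 : ℤ)) fun v hv => by
      rw [sub_zero, quadraticChar_sq_one' (Finset.ne_of_mem_erase hv)]]
    simp [Finset.card_erase_of_mem, Nat.cast_sub Fintype.card_pos]
  · rw [sum_quadraticChar_sq_sub hk h, mul_neg, mul_one]

variable {K : Type*} [Field K] [Fintype K] [Algebra k K]

/-- Euler's criterion in both fields: the norm is the power with exponent `1 + q + … + q ^ (n - 1)`,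
and this exponent times `(q - 1) / 2` is `(q ^ n - 1) / 2`. -/
theorem quadraticChar_norm (hk : ringChar k ≠ 2) (y : K) :
    quadraticChar k (Algebra.norm k y) = quadraticChar K y := by
  have hK : ringChar K ≠ 2 := by rwa [← Algebra.ringChar_eq k K]
  have h1 := congrArg (algebraMap k K)
    (quadraticChar_eq_pow_of_char_ne_two' hk (Algebra.norm k y))
  have h2 := quadraticChar_eq_pow_of_char_ne_two' hK y
  rw [map_pow, FiniteField.algebraMap_norm_eq_pow_sum, ← pow_mul, map_intCast,
    Nat.card_eq_fintype_card] at h1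
  have hodd := FiniteField.odd_card_of_char_ne_two hk
  have hodd' := FiniteField.odd_card_of_char_ne_two hK
  have h3 : (∑ i ∈ Finset.range (Module.finrank k K), Fintype.card k ^ i) * (Fintype.card k / 2) =
      Fintype.card K / 2 := by
    have h4 : Fintype.card K = Fintype.card k ^ Module.finrank k K := Module.card_eq_pow_finrank
    have h5 : Fintype.card k = 2 * (Fintype.card k / 2) + 1 := by omega
    have h6 := geom_sum_mul_add (2 * (Fintype.card k / 2)) (Module.finrank k K)
    rw [← h5, ← h4, mul_left_comm] at h6
    omega
  rw [h3, ← h2] at h1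
  exact (quadraticChar_isQuadratic k).eq_of_eq_coe (quadraticChar_isQuadratic K) hK h1

end QuadraticChar

/-! ### Norms modulo a quadratic polynomial -/

section EllipticWeight

theorem exists_add_eq_mul_eq {E : Type*} [Field E] [IsAlgClosed E] (s m : E) :
    ∃ α β : E, α + β = s ∧ α * β = m := by
  obtain ⟨α, hα⟩ := IsAlgClosed.exists_root (X ^ 2 + C (-s) * X + C m : E[X]) (by
    have : (X ^ 2 + C (-s) * X + C m : E[X]).degree = 2 := by compute_degree!
    rw [this]; simp)
  refine ⟨α, s - α, by ring, ?_⟩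
  simp only [IsRoot, eval_add, eval_mul, eval_pow, eval_X, eval_C] at hα
  linear_combination -hα

variable {k : Type*} [Field k]

/-- The norm of `h` modulo `X ^ 2 + a X + b`, that is the product of the values of `h` at the two
roots. -/
def normForm (a b : k) (h : k[X]) : k :=
  (h %ₘ (X ^ 2 + C a * X + C b)).coeff 0 ^ 2
    - a * (h %ₘ (X ^ 2 + C a * X + C b)).coeff 1 * (h %ₘ (X ^ 2 + C a * X + C b)).coeff 0
    + b * (h %ₘ (X ^ 2 + C a * X + C b)).coeff 1 ^ 2

theorem algebraMap_normForm {Ω : Type*} [Field Ω] [Algebra k Ω] {a b : k} {s₁ s₂ : Ω}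
    (hs : s₁ + s₂ = algebraMap k Ω (-a)) (hm : s₁ * s₂ = algebraMap k Ω b) (h : k[X]) :
    algebraMap k Ω (normForm a b h) = aeval s₁ h * aeval s₂ h := by
  have hg : (X ^ 2 + C a * X + C b : k[X]).Monic := by monicity!
  have hdeg : (X ^ 2 + C a * X + C b : k[X]).degree = 2 := by compute_degree!
  rw [map_neg] at hs
  have h1 : aeval s₁ (X ^ 2 + C a * X + C b) = 0 := by
    simp only [map_add, map_mul, map_pow, aeval_X, aeval_C]
    linear_combination s₁ * hs - hm
  have h2 : aeval s₂ (X ^ 2 + C a * X + C b) = 0 := by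
    simp only [map_add, map_mul, map_pow, aeval_X, aeval_C]
    linear_combination s₂ * hs - hm
  have key : ∀ s : Ω, aeval s (X ^ 2 + C a * X + C b) = 0 → aeval s h =
      algebraMap k Ω ((h %ₘ (X ^ 2 + C a * X + C b)).coeff 1) * s +
      algebraMap k Ω ((h %ₘ (X ^ 2 + C a * X + C b)).coeff 0) := by
    intro s hs
    conv_lhs => rw [← modByMonic_add_div h (X ^ 2 + C a * X + C b)]
    rw [map_add, map_mul, hs, zero_mul, add_zero]
    have hd : (h %ₘ (X ^ 2 + C a * X + C b)).degree ≤ 1 := by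
      have := degree_modByMonic_lt h hg
      rw [hdeg] at this
      exact Order.le_of_lt_succ this
    conv_lhs => rw [eq_X_add_C_of_degree_le_one hd]
    simp
  rw [key s₁ h1, key s₂ h2, normForm]
  simp only [map_add, map_sub, map_mul, map_pow]
  linear_combination (-(algebraMap k Ω ((h %ₘ (X ^ 2 + C a * X + C b)).coeff 1) *
    algebraMap k Ω ((h %ₘ (X ^ 2 + C a * X + C b)).coeff 0))) * hs -
    algebraMap k Ω ((h %ₘ (X ^ 2 + C a * X + C b)).coeff 1) ^ 2 * hm

/-- Identities for the norm form are checked in the algebraic closure, where it is the product of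
the values at the two roots; only their sum and product matter, so a repeated root is allowed. -/
theorem normForm_eq {a b : k} {h : k[X]} {c : k}
    (H : ∀ s₁ s₂ : AlgebraicClosure k, s₁ + s₂ = algebraMap k _ (-a) →
      s₁ * s₂ = algebraMap k _ b → aeval s₁ h * aeval s₂ h = algebraMap k _ c) :
    normForm a b h = c := by
  obtain ⟨s₁, s₂, hs, hm⟩ := exists_add_eq_mul_eq (algebraMap k (AlgebraicClosure k) (-a))
    (algebraMap k _ b)
  apply (algebraMap k (AlgebraicClosure k)).injective
  rw [algebraMap_normForm hs hm, H s₁ s₂ hs hm]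

theorem normForm_mul (a b : k) (g h : k[X]) :
    normForm a b (g * h) = normForm a b g * normForm a b h := by
  refine normForm_eq fun s₁ s₂ hs hm => ?_
  rw [map_mul (algebraMap k _), algebraMap_normForm hs hm, algebraMap_normForm hs hm, map_mul,
    map_mul]
  ring

theorem normForm_one (a b : k) : normForm a b 1 = 1 :=
  normForm_eq fun s₁ s₂ _ _ => by simp

theorem normForm_X_sub_C (a b c : k) : normForm a b (X - C c) = c ^ 2 + a * c + b := by
  refine normForm_eq fun s₁ s₂ hs hm => ?_
  rw [map_neg] at hs
  simp only [map_add, map_sub, map_mul, map_pow, aeval_X, aeval_C]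
  linear_combination hm - algebraMap k (AlgebraicClosure k) c * hs

theorem normForm_quadratic (a b u w : k) : normForm a b (X ^ 2 + C u * X + C w) =
    b * (u - a) ^ 2 - a * (w - b) * (u - a) + (w - b) ^ 2 := by
  refine normForm_eq fun s₁ s₂ hs hm => ?_
  rw [map_neg] at hs
  simp only [map_add, map_sub, map_mul, map_pow, aeval_X, aeval_C]
  have h1 : s₁ ^ 2 = -algebraMap k _ a * s₁ - algebraMap k _ b := by
    linear_combination s₁ * hs - hm
  have h2 : s₂ ^ 2 = -algebraMap k _ a * s₂ - algebraMap k _ b := by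
    linear_combination s₂ * hs - hm
  rw [h1, h2, ← hm, show s₂ = -algebraMap k _ a - s₁ by linear_combination hs]
  ring

theorem normForm_add_mul (a b c : k) (h : k[X]) :
    normForm a b (h + C c * (X ^ 2 + C a * X + C b)) = normForm a b h := by
  refine normForm_eq fun s₁ s₂ hs hm => ?_
  rw [algebraMap_normForm hs hm]
  rw [map_neg] at hs
  have h1 : aeval s₁ (X ^ 2 + C a * X + C b) = 0 := by
    simp only [map_add, map_mul, map_pow, aeval_X, aeval_C]
    linear_combination s₁ * hs - hm
  have h2 : aeval s₂ (X ^ 2 + C a * X + C b) = 0 := by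
    simp only [map_add, map_mul, map_pow, aeval_X, aeval_C]
    linear_combination s₂ * hs - hm
  rw [map_add, map_add, map_mul, map_mul, h1, h2]
  simp

end EllipticWeight

/-! ### The numerator of the zeta function of a cubic -/

section CubicSum

open scoped Classical

variable {k : Type*} [Field k] [Fintype k]

/-- The opposite of the quadratic character sum of the cubic `x (x ^ 2 + a x + b)`. -/
def cubicTrace (a b : k) : ℤ := -∑ x : k, quadraticChar k (x * (x ^ 2 + a * x + b))

/-- The function `∏ (X - r) ↦ λ(∏ r (r ^ 2 + a r + b))` on monic polynomials. -/
def cubicWeight (a b : k) (h : k[X]) : ℤ :=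
  quadraticChar k ((-1) ^ h.natDegree * h.eval 0 * normForm a b h)

theorem cubicWeight_one (a b : k) : cubicWeight a b 1 = 1 := by
  simp [cubicWeight, normForm_one]

theorem cubicWeight_mul (a b : k) (g h : k[X]) (hg : g.Monic) (hh : h.Monic) :
    cubicWeight a b (g * h) = cubicWeight a b g * cubicWeight a b h := by
  simp only [cubicWeight, hg.natDegree_mul hh, eval_mul, pow_add, map_mul, normForm_mul]
  ring

theorem monicSum_cubicWeight_one (a b : k) : monicSum (cubicWeight a b) 1 = -cubicTrace a b := by
  rw [monicSum_one, cubicTrace, neg_neg]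
  refine Finset.sum_congr rfl fun c _ => ?_
  simp [cubicWeight, normForm_X_sub_C]

/-- For fixed constant term `w` the weight is `λ(w)` times `λ` of a quadratic in the shifted linear
coefficient, with leading coefficient `b` and discriminant `(w - b) ^ 2 (a ^ 2 - 4 b)`. Only `w = b`
is degenerate and adds `|k|`; the generic terms `-λ(b) λ(w)` sum to zero over `w`. -/
theorem monicSum_cubicWeight_two (hk : ringChar k ≠ 2) {a b : k} (hb : b ≠ 0)
    (hab : a ^ 2 - 4 * b ≠ 0) : monicSum (cubicWeight a b) 2 = Fintype.card k := by
  rw [monicSum_two, Finset.sum_comm]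
  have h1 : ∀ w : k, ∑ u : k, cubicWeight a b (X ^ 2 + C u * X + C w) =
      quadraticChar k w * (-quadraticChar k b) +
        if w = b then (Fintype.card k : ℤ) else 0 := by
    intro w
    have h2 : ∀ u : k, (X ^ 2 + C u * X + C w : k[X]).natDegree = 2 := by
      intro u; compute_degree!
    simp only [cubicWeight, h2, normForm_quadratic]
    have h3 : ∑ u : k, quadraticChar k ((-1) ^ 2 * (X ^ 2 + C u * X + C w : k[X]).eval 0 *
        (b * (u - a) ^ 2 - a * (w - b) * (u - a) + (w - b) ^ 2)) =
        quadraticChar k w * ∑ u : k, quadraticChar k (b * u ^ 2 + (-(a * (w - b))) * u +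
          (w - b) ^ 2) := by
      rw [Finset.mul_sum]
      refine Fintype.sum_equiv (Equiv.subRight a) _ _ fun u => ?_
      rw [← map_mul]
      simp
      ring_nf
    rw [h3, sum_quadraticChar_quadratic hk hb]
    have h4 : (-(a * (w - b))) ^ 2 - 4 * b * (w - b) ^ 2 = (w - b) ^ 2 * (a ^ 2 - 4 * b) := by ring
    rw [h4]
    by_cases hw : w = b
    · subst hw
      simp only [sub_self, ne_eq, OfNat.ofNat_ne_zero, not_false_eq_true, zero_pow, zero_mul,
        if_true]
      linear_combination (Fintype.card k : ℤ) * quadraticChar_mul_self hb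
    · rw [if_neg (mul_ne_zero (pow_ne_zero _ (sub_ne_zero.mpr hw)) hab), if_neg hw, add_zero]
  rw [Finset.sum_congr rfl fun w _ => h1 w, Finset.sum_add_distrib, ← Finset.sum_mul,
    quadraticChar_sum_zero hk]
  simp

/-- Adding `c (X ^ 2 + a X + b)` keeps the norm form and shifts `h(0)` by `c b`, which runs through
`k` because `b ≠ 0`. -/
theorem monicSum_cubicWeight_eq_zero (hk : ringChar k ≠ 2) (a : k) {b : k} (hb : b ≠ 0) {n : ℕ}
    (hn : 3 ≤ n) : monicSum (cubicWeight a b) n = 0 := by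
  have hdeg : (X ^ 2 + C a * X + C b : k[X]).degree < n := by
    have : (X ^ 2 + C a * X + C b : k[X]).degree = 2 := by compute_degree!
    rw [this]
    exact_mod_cast hn
  refine monicSum_eq_zero hdeg fun g hg => ?_
  obtain ⟨h1, h2⟩ := mem_monics.mp hg
  have h3 : ∀ c : k, (g + C c * (X ^ 2 + C a * X + C b)).natDegree = n := by
    intro c
    rw [natDegree_add_eq_left_of_degree_lt, h2]
    rw [degree_eq_natDegree h1.ne_zero, h2, ← smul_eq_C_mul]
    exact (degree_smul_le _ _).trans_lt hdeg
  simp only [cubicWeight, h3, normForm_add_mul]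
  by_cases hN : normForm a b g = 0
  · simp [hN]
  rw [← sum_quadraticChar_affine hk ((-1) ^ n * g.eval 0 * normForm a b g)
    (b := (-1) ^ n * b * normForm a b g) (by simp [hN, hb])]
  refine Finset.sum_congr rfl fun c _ => ?_
  simp
  ring_nf

/-- For each conjugate `y` of `x` and the roots `s₁`, `s₂` of the quadratic, `(-1) (0 - y) (s₁ - y)
(s₂ - y) = y (y ^ 2 + a y + b)`. So the weight of the characteristic polynomial is `λ` of the norm
of the cubic at `x`, that is, the quadratic character of `K`. -/
theorem cubicTrace_extension_aux (hk : ringChar k ≠ 2) (a b : k) {K : Type*} [Field K] [Fintype K]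
    [Algebra k K] : primePowerSum (cubicWeight a b) (Module.finrank k K) =
      -cubicTrace (algebraMap k K a) (algebraMap k K b) := by
  rw [primePowerSum_finrank (K := K) (cubicWeight_one a b) (cubicWeight_mul a b), cubicTrace,
    neg_neg]
  refine Finset.sum_congr rfl fun x _ => ?_
  have hC := prod_conjugates_eq (k := k) x
  set h := minpoly k x ^ (Module.finrank k K / (minpoly k x).natDegree)
  have hdeg : h.natDegree = Module.finrank k K := by
    rw [← natDegree_map (algebraMap k K), ← hC, natDegree_prod_of_monic _ _ fun i _ =>
      monic_X_sub_C _]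
    simp only [natDegree_X_sub_C]
    simp
  rw [← quadraticChar_norm hk, cubicWeight, hdeg]
  congr 1
  let Ω := AlgebraicClosure K
  have hinj : Function.Injective (algebraMap k Ω) := (algebraMap k Ω).injective
  obtain ⟨s₁, s₂, hs, hm⟩ := exists_add_eq_mul_eq (algebraMap k Ω (-a)) (algebraMap k Ω b)
  apply hinj
  have hev : ∀ s : Ω, aeval s h = ∏ i ∈ Finset.range (Module.finrank k K),
        (s - algebraMap K Ω (x ^ Fintype.card k ^ i)) := by
    intro s
    rw [← aeval_map_algebraMap K, ← hC, map_prod]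
    simp
  have h0 : algebraMap k Ω (h.eval 0) = aeval (0 : Ω) h := by
    rw [← map_zero (algebraMap k Ω), aeval_algebraMap_apply]
    simp
  have hx : x * (x ^ 2 + algebraMap k K a * x + algebraMap k K b) =
      aeval x (X * (X ^ 2 + C a * X + C b) : k[X]) := by simp
  rw [map_mul, algebraMap_normForm hs hm, map_mul, h0, hev, hev, hev, hx,
    IsScalarTower.algebraMap_apply k K Ω (Algebra.norm k _), algebraMap_norm_aeval_eq_prod,
    map_prod, map_pow, map_neg, map_one]
  have hpow : (-1 : Ω) ^ Module.finrank k K = ∏ i ∈ Finset.range (Module.finrank k K), (-1) := by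
    simp
  rw [hpow, ← Finset.prod_mul_distrib, ← Finset.prod_mul_distrib, ← Finset.prod_mul_distrib]
  refine Finset.prod_congr rfl fun i _ => ?_
  set y := x ^ Fintype.card k ^ i
  rw [map_neg] at hs
  simp only [map_add, map_mul, map_pow, aeval_X, aeval_C, ← IsScalarTower.algebraMap_apply]
  rw [← hm, show algebraMap k Ω a = -(s₁ + s₂) by rw [hs, neg_neg]]
  ring

variable {L : Type*} [Field L] [IsAlgClosed L] [CharZero L]

/-- The sums over monic polynomials in degrees `0`, `1`, `2` and beyond show that the generating
series is `1 - cubicTrace T + |k| T ^ 2`; `α` and `β` are its reciprocal roots. -/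
theorem exists_cubicTrace_extension_of_ne (hk : ringChar k ≠ 2) {a b : k} (hb : b ≠ 0)
    (hab : a ^ 2 - 4 * b ≠ 0) : ∃ α β : L, α + β = cubicTrace a b ∧ α * β = Fintype.card k ∧
      ∀ n ≠ 0, ((primePowerSum (cubicWeight a b) n : ℤ) : L) = -(α ^ n + β ^ n) := by
  obtain ⟨α, β, hs, hm⟩ := exists_add_eq_mul_eq (cubicTrace a b : L) (Fintype.card k : L)
  refine ⟨α, β, hs, hm, fun n hn => ?_⟩
  have h1 := (isLogDeriv_monicSum (cubicWeight_one a b) (cubicWeight_mul a b)).map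
    (Int.castRingHom L)
  have h2 : PowerSeries.map (Int.castRingHom L) (PowerSeries.mk (monicSum (cubicWeight a b))) =
      (1 - PowerSeries.C α * PowerSeries.X ^ 1) * (1 - PowerSeries.C β * PowerSeries.X ^ 1) := by
    have h3 : (1 - PowerSeries.C α * PowerSeries.X ^ 1) *
        (1 - PowerSeries.C β * PowerSeries.X ^ 1) =
        1 - PowerSeries.C (cubicTrace a b : L) * PowerSeries.X ^ 1 +
          PowerSeries.C (Fintype.card k : L) * PowerSeries.X ^ 2 := by
      rw [← hs, ← hm, map_add, map_mul]
      ring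
    rw [h3]
    ext i
    rw [PowerSeries.coeff_map, PowerSeries.coeff_mk, map_add, map_sub, PowerSeries.coeff_one,
      PowerSeries.coeff_C_mul, PowerSeries.coeff_X_pow, PowerSeries.coeff_C_mul,
      PowerSeries.coeff_X_pow]
    rcases i with _ | _ | _ | i
    · simp [monicSum_zero (cubicWeight_one a b)]
    · simp [monicSum_cubicWeight_one]
    · simp [monicSum_cubicWeight_two hk hb hab]
    · simp [monicSum_cubicWeight_eq_zero hk a hb (n := i + 1 + 1 + 1) (by omega)]
  rw [h2] at h1
  have h3 := (isLogDeriv_one_sub α one_ne_zero).mul (isLogDeriv_one_sub β one_ne_zero)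
  have h4 : ((1 - PowerSeries.C α * PowerSeries.X ^ 1) *
      (1 - PowerSeries.C β * PowerSeries.X ^ 1) : PowerSeries L) ≠ 0 := by
    intro h
    simpa using congrArg PowerSeries.constantCoeff h
  have h5 := congrFun (h1.right_unique h4 h3) n
  simp only [eq_intCast, Pi.add_apply, isUnit_one, IsUnit.dvd, ne_eq, hn, not_false_eq_true,
    and_self, if_true, Nat.cast_one, one_mul, Nat.div_one] at h5
  rw [h5]
  ring

theorem cubicTrace_zero_right (hk : ringChar k ≠ 2) (a : k) :
    cubicTrace a 0 = quadraticChar k a := by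
  have h1 : ∀ x : k, quadraticChar k (x * (x ^ 2 + a * x + 0)) =
      quadraticChar k (a + x * 1) - if x = 0 then quadraticChar k a else 0 := by
    intro x
    split_ifs with hx
    · simp [hx]
    · rw [sub_zero, ← quadraticChar_sq_mul hx (a + x * 1)]
      ring_nf
  rw [cubicTrace, Finset.sum_congr rfl fun x _ => h1 x, Finset.sum_sub_distrib,
    sum_quadraticChar_affine hk a one_ne_zero]
  simp

/-- The cubic is `x (x + c) ^ 2`: away from the double root its character is `λ(x)`, and the
complete sum of `λ` vanishes. -/
theorem cubicTrace_of_eq_sq (hk : ringChar k ≠ 2) (c : k) :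
    cubicTrace (2 * c) (c ^ 2) = quadraticChar k (-c) := by
  have h1 : ∀ x : k, quadraticChar k (x * (x ^ 2 + 2 * c * x + c ^ 2)) =
      quadraticChar k (0 + x * 1) - if x = -c then quadraticChar k (-c) else 0 := by
    intro x
    have : x * (x ^ 2 + 2 * c * x + c ^ 2) = (x + c) ^ 2 * x := by ring
    rw [this]
    split_ifs with hx
    · simp [hx]
    · rw [sub_zero, quadraticChar_sq_mul fun h => hx (eq_neg_of_add_eq_zero_left h)]
      ring_nf
  rw [cubicTrace, Finset.sum_congr rfl fun x _ => h1 x, Finset.sum_sub_distrib,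
    sum_quadraticChar_affine hk 0 one_ne_zero]
  simp

theorem quadraticChar_algebraMap (hk : ringChar k ≠ 2) {K : Type*} [Field K] [Fintype K]
    [Algebra k K] (a : k) :
    quadraticChar K (algebraMap k K a) = quadraticChar k a ^ Module.finrank k K := by
  rw [← quadraticChar_norm hk, Algebra.norm_algebraMap, map_pow]

/-- The cubic character sums over the extensions of `k` are power sums of two numbers. -/
theorem exists_cubicTrace_extension (L : Type*) [Field L] [IsAlgClosed L] [CharZero L]
    (hk : ringChar k ≠ 2) (a b : k) :
    ∃ α β : L, α + β = cubicTrace a b ∧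
      α * β = (if b * (a ^ 2 - 4 * b) = 0 then 0 else (Fintype.card k : L)) ∧
      ∀ (K : Type*) [Field K] [Fintype K] [Algebra k K],
        (cubicTrace (algebraMap k K a) (algebraMap k K b) : L) =
          α ^ Module.finrank k K + β ^ Module.finrank k K := by
  by_cases hb : b = 0
  · subst hb
    -- A singular cubic needs only one number, so `β = 0`; its powers vanish since the degree of an
    -- extension is positive.
    refine ⟨quadraticChar k a, 0, by simp [cubicTrace_zero_right hk], by simp, ?_⟩
    intro K _ _ _
    rw [map_zero, cubicTrace_zero_right (Algebra.ringChar_eq k K ▸ hk), quadraticChar_algebraMap hk, zero_pow Module.finrank_pos.ne']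
    simp
  by_cases hab : a ^ 2 - 4 * b = 0
  · have h2 : (2 : k) ≠ 0 := Ring.two_ne_zero hk
    obtain ⟨c, rfl⟩ : ∃ c, a = 2 * c := ⟨a / 2, by field_simp⟩
    obtain rfl : b = c ^ 2 := by
      apply mul_left_cancel₀ (mul_ne_zero h2 h2)
      linear_combination -hab
    refine ⟨quadraticChar k (-c), 0, by simp [cubicTrace_of_eq_sq hk], ?_, ?_⟩
    · rw [hab]; simp
    intro K _ _ _
    rw [map_pow, map_mul, map_ofNat, cubicTrace_of_eq_sq (Algebra.ringChar_eq k K ▸ hk), ← map_neg,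
      quadraticChar_algebraMap hk, zero_pow Module.finrank_pos.ne']
    simp
  · obtain ⟨α, β, hs, hm, hp⟩ := exists_cubicTrace_extension_of_ne (L := L) hk hb hab
    refine ⟨α, β, hs, ?_, ?_⟩
    · rw [if_neg (mul_ne_zero hb hab), hm]
    intro K _ _ _
    have h1 := hp (Module.finrank k K) Module.finrank_pos.ne'
    rw [cubicTrace_extension_aux hk] at h1
    push_cast at h1
    exact neg_injective h1

end CubicSum

end GriffonRank

end

noncomputable section

open Polynomial

namespace GriffonRank

/-! ### Jacobi sums and the family of cubics `x (x ^ 2 + s x - 4 s)` -/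

section JacobiProduct

open scoped Classical

variable {k : Type*} [Field k] {L : Type*} [Field L]

theorem mulChar_mul_inv_apply (χ : MulChar k L) {a : k} (ha : a ≠ 0) : χ a * χ⁻¹ a = 1 := by
  rw [← MulChar.mul_apply, mul_inv_cancel, MulChar.one_apply ha.isUnit]

theorem four_ne_zero_of_ringChar (hk : ringChar k ≠ 2) : (4 : k) ≠ 0 := by
  have h2 : (2 : k) ≠ 0 := Ring.two_ne_zero hk
  have : (4 : k) = 2 * 2 := by norm_num
  rw [this]
  exact mul_ne_zero h2 h2

variable [Fintype k]

theorem quadChar_apply (x : k) : quadChar k L x = (quadraticChar k x : L) := rfl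

theorem quadChar_mul_self : quadChar k L * quadChar k L = 1 := by
  ext x
  rw [MulChar.mul_apply, MulChar.one_apply_coe, quadChar_apply, ← Int.cast_mul,
    quadraticChar_mul_self x.ne_zero, Int.cast_one]

theorem quadChar_inv : (quadChar k L)⁻¹ = quadChar k L :=
  inv_eq_of_mul_eq_one_right quadChar_mul_self

theorem quadChar_ne_one [CharZero L] (hk : ringChar k ≠ 2) : quadChar k L ≠ 1 := by
  intro h
  apply quadraticChar_ne_one hk
  ext x
  have := congrArg (fun χ : MulChar k L => χ x) h
  simp only [quadChar_apply, MulChar.one_apply_coe] at this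
  rw [MulChar.one_apply_coe]
  exact_mod_cast this

theorem quadChar_sq {a : k} (ha : a ≠ 0) : quadChar k L (a ^ 2) = 1 := by
  rw [quadChar_apply, quadraticChar_sq_one' ha, Int.cast_one]

/-- The duplication formula for Jacobi sums. -/
theorem jacobiSum_quadChar (hk : ringChar k ≠ 2) {χ : MulChar k L} (hχ : χ ≠ 1) :
    jacobiSum χ (quadChar k L) = χ 4 * jacobiSum χ χ := by
  have h2 : (2 : k) ≠ 0 := Ring.two_ne_zero hk
  -- The substitution `v = 2 x - 1` turns `4 x (1 - x)` into `1 - v ^ 2`.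
  have h1 : χ 4 * jacobiSum χ χ = ∑ v : k, χ (1 - v ^ 2) := by
    rw [jacobiSum, Finset.mul_sum]
    refine Fintype.sum_equiv ((Equiv.mulLeft₀ (2 : k) h2).trans (Equiv.subRight 1)) _ _ fun x => ?_
    change _ = χ (1 - (2 * x - 1) ^ 2)
    rw [← map_mul, ← map_mul]
    ring_nf
  rw [h1, sum_sq hk fun z => χ (1 - z)]
  simp only [add_mul, one_mul, Finset.sum_add_distrib]
  have h3 : ∑ z : k, χ (1 - z) = 0 := by
    rw [← sum_mulChar_affine hχ 1 (b := -1) (by simp)]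
    exact Finset.sum_congr rfl fun z _ => by ring_nf
  rw [h3, zero_add, jacobiSum_comm, jacobiSum]
  rfl

/-- The cubic equals `x ^ 3 + s x (x - 4)`, linear in `s`. For `x ≠ 0, 4` the substitution `s = x ^
2 u / (4 - x)` makes it `x ^ 2 · x (1 - u)`, and the sum over `u` is a Jacobi sum. For `x = 0` and
`x = 4` both sides vanish. -/
theorem sum_twisted_cubic_inner (hk : ringChar k ≠ 2) {χ : MulChar k L} (hχ : χ ≠ 1) (x : k) :
    ∑ s : k, χ s * quadChar k L (x * (x ^ 2 + s * x + -4 * s)) =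
      χ x ^ 2 * χ⁻¹ (4 - x) * quadChar k L x * jacobiSum χ (quadChar k L) := by
  have h4 : (4 : k) ≠ 0 := four_ne_zero_of_ringChar hk
  by_cases hx : x = 0
  · simp [hx, MulChar.map_zero]
  by_cases hx4 : x = 4
  · subst hx4
    have h5 : ∀ s : k, (4 : k) * (4 ^ 2 + s * 4 + -4 * s) = (8 : k) ^ 2 := by intro s; ring
    simp only [h5, ← Finset.sum_mul, MulChar.sum_eq_zero_of_ne_one hχ]
    simp [MulChar.map_zero]
  have h4x : 4 - x ≠ 0 := sub_ne_zero.mpr (Ne.symm hx4)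
  have hne : x ^ 2 * (4 - x)⁻¹ ≠ 0 := mul_ne_zero (pow_ne_zero _ hx) (inv_ne_zero h4x)
  rw [jacobiSum, Finset.mul_sum]
  refine (Fintype.sum_equiv (Equiv.mulLeft₀ _ hne) _ _ fun u => ?_).symm
  change _ = χ (x ^ 2 * (4 - x)⁻¹ * u) *
    quadChar k L (x * (x ^ 2 + x ^ 2 * (4 - x)⁻¹ * u * x + -4 * (x ^ 2 * (4 - x)⁻¹ * u)))
  have h5 : x * (x ^ 2 + x ^ 2 * (4 - x)⁻¹ * u * x + -4 * (x ^ 2 * (4 - x)⁻¹ * u)) =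
      x ^ 2 * (x * (1 - u)) := by
    field_simp
    ring
  rw [h5, map_mul (quadChar k L), quadChar_sq hx, map_mul, map_mul, map_mul, map_pow,
    MulChar.inv_apply']
  ring

/-- The sum of the cubic character sums, twisted by a nontrivial character. -/
theorem sum_twisted_cubic (hk : ringChar k ≠ 2) {χ : MulChar k L} (hχ : χ ≠ 1) :
    ∑ s : k, χ s * ∑ x : k, quadChar k L (x * (x ^ 2 + s * x + -4 * s)) = jacobiProduct χ := by
  have h4 : (4 : k) ≠ 0 := four_ne_zero_of_ringChar hk
  simp only [Finset.mul_sum]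
  rw [Finset.sum_comm, Finset.sum_congr rfl fun x _ => sum_twisted_cubic_inner hk hχ x,
    ← Finset.sum_mul]
  -- Rescaling by `x = 4 z` exposes the second Jacobi sum; `λ(4) = 1`, and of the three factors
  -- `χ(4)` one is cancelled by `χ⁻¹(4)`.
  have h1 : ∑ x : k, χ x ^ 2 * χ⁻¹ (4 - x) * quadChar k L x =
      χ 4 * jacobiSum (quadChar k L * χ ^ 2) χ⁻¹ := by
    rw [jacobiSum, Finset.mul_sum]
    refine (Fintype.sum_equiv (Equiv.mulLeft₀ _ h4) _ _ fun z => ?_).symm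
    change _ = χ (4 * z) ^ 2 * χ⁻¹ (4 - 4 * z) * quadChar k L (4 * z)
    have h5 : (4 : k) - 4 * z = 4 * (1 - z) := by ring
    have h6 : quadChar k L 4 = 1 := by
      rw [show (4 : k) = 2 ^ 2 by norm_num, quadChar_sq (Ring.two_ne_zero hk)]
    rw [h5, map_mul χ, map_mul χ⁻¹, map_mul (quadChar k L), h6, MulChar.mul_apply, sq χ,
      MulChar.mul_apply]
    linear_combination (-(χ 4 * χ z ^ 2 * χ⁻¹ (1 - z) * quadChar k L z)) *
      mulChar_mul_inv_apply χ h4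
  rw [h1, jacobiSum_quadChar hk hχ, jacobiProduct, jac, jac, sq χ, MulChar.mul_apply]
  ring

/-- The term `s = 0` of the inner sum is already zero, so the trivial character may be dropped. For
fixed `x` the sum over `s` vanishes, by linearity in `s`, unless `x = 4`, where the cubic is the
constant `8 ^ 2`. -/
theorem sum_untwisted_cubic (hk : ringChar k ≠ 2) [CharZero L] :
    ∑ s : k, (1 : MulChar k L) s * ∑ x : k, quadChar k L (x * (x ^ 2 + s * x + -4 * s)) =
      Fintype.card k := by
  have h4 : (4 : k) ≠ 0 := four_ne_zero_of_ringChar hk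
  have h0 : ∀ s : k, (1 : MulChar k L) s * ∑ x : k, quadChar k L (x * (x ^ 2 + s * x + -4 * s)) =
      ∑ x : k, quadChar k L (x * (x ^ 2 + s * x + -4 * s)) := by
    intro s
    by_cases hs : s = 0
    · subst hs
      rw [MulChar.map_zero, zero_mul, ← MulChar.sum_eq_zero_of_ne_one (quadChar_ne_one hk)]
      refine Finset.sum_congr rfl fun x _ => ?_
      by_cases hx : x = 0
      · simp [hx]
      · rw [show x * (x ^ 2 + 0 * x + -4 * 0) = x ^ 2 * x by ring, map_mul, quadChar_sq hx,
          one_mul]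
    · rw [MulChar.one_apply (Ne.isUnit hs), one_mul]
  rw [Finset.sum_congr rfl fun s _ => h0 s, Finset.sum_comm]
  have h1 : ∀ x : k, ∑ s : k, quadChar k L (x * (x ^ 2 + s * x + -4 * s)) =
      if x = 4 then (Fintype.card k : L) else 0 := by
    intro x
    split_ifs with hx4
    · subst hx4
      have h5 : ∀ s : k, (4 : k) * (4 ^ 2 + s * 4 + -4 * s) = (8 : k) ^ 2 := by intro s; ring
      have h8 : (8 : k) ≠ 0 := by
        rw [show (8 : k) = 4 * 2 by norm_num]
        exact mul_ne_zero h4 (Ring.two_ne_zero hk)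
      simp only [h5, quadChar_sq h8]
      simp
    · by_cases hx : x = 0
      · simp [hx, MulChar.map_zero]
      rw [← sum_mulChar_affine (quadChar_ne_one (L := L) hk) (x * x ^ 2)
        (mul_ne_zero hx (sub_ne_zero.mpr hx4))]
      exact Finset.sum_congr rfl fun s _ => by ring_nf
  rw [Finset.sum_congr rfl fun x _ => h1 x]
  simp

/-- Both Jacobi sums are `J(λ, λ) = -λ(-1)`. This value `1` is what cancels the contribution of the
place at infinity. -/
theorem jacobiProduct_quadChar [CharZero L] (hk : ringChar k ≠ 2) :
    jacobiProduct (quadChar k L) = 1 := by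
  have h1 : jacobiSum (quadChar k L) (quadChar k L) = -quadChar k L (-1) := by
    have := jacobiSum_nontrivial_inv (quadChar_ne_one (L := L) hk)
    rwa [quadChar_inv] at this
  rw [jacobiProduct, jac, jac, sq, quadChar_mul_self, mul_one, quadChar_inv, h1,
    MulChar.one_apply (four_ne_zero_of_ringChar hk).isUnit]
  have : quadChar k L (-1) * quadChar k L (-1) = 1 := by
    rw [← map_mul]; simp
  linear_combination this

theorem ne_one_of_sq_eq_quadChar [CharZero L] (hk : ringChar k ≠ 2) {χ : MulChar k L}
    (hχ : χ ^ 2 = quadChar k L) : χ ≠ 1 := by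
  rintro rfl
  exact quadChar_ne_one hk (by rw [← hχ, one_pow])

/-- Here `λ χ ^ 2` is trivial, so the second Jacobi sum degenerates to `J(1, χ⁻¹) = -1`. -/
theorem jacobiProduct_of_sq_eq [CharZero L] (hk : ringChar k ≠ 2) {χ : MulChar k L}
    (hχ : χ ^ 2 = quadChar k L) : jacobiProduct χ = -jacobiSum χ χ := by
  have h1 : jacobiSum 1 χ⁻¹ = -1 :=
    jacobiSum_one_nontrivial (inv_ne_one.mpr (ne_one_of_sq_eq_quadChar hk hχ))
  have h6 : quadChar k L 4 = 1 := by
    rw [show (4 : k) = 2 ^ 2 by norm_num, quadChar_sq (Ring.two_ne_zero hk)]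
  rw [jacobiProduct, hχ, quadChar_mul_self, jac, jac, h1, h6]
  ring

/-- As `λ(x) = χ(x ^ 2)`, the summand depends on `x ^ 2` only; counting square roots introduces `χ`
and `λ χ = χ⁻¹`, and the duplication formula finishes. It matches the fibre at `τ = 0` for even `d`
with the two characters of order four. -/
theorem cubicTrace_zero_neg_four [CharZero L] (hk : ringChar k ≠ 2) {χ : MulChar k L}
    (hχ : χ ^ 2 = quadChar k L) :
    (cubicTrace (0 : k) (-4) : L) = jacobiProduct χ + jacobiProduct χ⁻¹ := by
  have h4 : (4 : k) ≠ 0 := four_ne_zero_of_ringChar hk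
  have hχ1 := ne_one_of_sq_eq_quadChar hk hχ
  have hχi : (χ⁻¹) ^ 2 = quadChar k L := by rw [inv_pow, hχ, quadChar_inv]
  rw [jacobiProduct_of_sq_eq hk hχ, jacobiProduct_of_sq_eq hk hχi]
  have hsq : ∀ x : k, quadChar k L x = χ (x ^ 2) := by
    intro x
    rw [← hχ, map_pow, sq, sq, MulChar.mul_apply]
  have hq : quadChar k L * χ = χ⁻¹ := by
    rw [eq_inv_iff_mul_eq_one, mul_assoc, ← sq, hχ, quadChar_mul_self]
  have hm1 : quadChar k L (-1) = 1 := by rw [hsq]; simp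
  have h44 : χ 4 * χ 4 = 1 := by
    rw [show (4 : k) = 2 ^ 2 by norm_num, ← hsq, ← map_mul, ← sq,
      quadChar_sq (Ring.two_ne_zero hk)]
  have h1 : ∑ x : k, quadChar k L (x * (x ^ 2 + 0 * x + -4)) =
      χ 4 * (jacobiSum χ (quadChar k L) + jacobiSum χ⁻¹ (quadChar k L)) := by
    have h2 : ∀ x : k, quadChar k L (x * (x ^ 2 + 0 * x + -4)) =
        χ (x ^ 2) * quadChar k L (x ^ 2 - 4) := by
      intro x
      rw [map_mul, hsq x]
      ring_nf
    rw [Finset.sum_congr rfl fun x _ => h2 x, sum_sq hk fun z => χ z * quadChar k L (z - 4),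
      jacobiSum, jacobiSum, ← Finset.sum_add_distrib, Finset.mul_sum]
    refine (Fintype.sum_equiv (Equiv.mulLeft₀ _ h4) _ _ fun y => ?_).symm
    change _ = (1 + quadChar k L (4 * y)) * (χ (4 * y) * quadChar k L (4 * y - 4))
    have h6 : quadChar k L 4 = 1 := by
      rw [show (4 : k) = 2 ^ 2 by norm_num, quadChar_sq (Ring.two_ne_zero hk)]
    rw [show 4 * y - 4 = 4 * (-1 * (1 - y)) by ring, map_mul, map_mul, map_mul, map_mul, h6, hm1,
      ← hq, MulChar.mul_apply]
    ring
  have hcast : (cubicTrace (0 : k) (-4) : L) =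
      -∑ x : k, quadChar k L (x * (x ^ 2 + 0 * x + -4)) := by
    rw [cubicTrace]
    push_cast
    rfl
  rw [hcast, h1, jacobiSum_quadChar hk hχ1, jacobiSum_quadChar hk (inv_ne_one.mpr hχ1)]
  linear_combination (-jacobiSum χ χ) * h44 -
    jacobiSum χ⁻¹ χ⁻¹ * mulChar_mul_inv_apply χ h4

/-- The cubic is odd in `x` and `-1` is not a square, so `x ↦ -x` changes the sign of the sum. -/
theorem cubicTrace_zero_eq_zero (hk : Fintype.card k % 4 = 3) (b : k) :
    cubicTrace (0 : k) b = 0 := by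
  have hk2 : ringChar k ≠ 2 := by
    intro h
    have := FiniteField.even_card_of_char_two h
    omega
  have hm1 : quadraticChar k (-1) = -1 := by
    rw [quadraticChar_neg_one_iff_not_isSquare, FiniteField.isSquare_neg_one_iff]
    simpa using hk
  have h1 : ∑ x : k, quadraticChar k (x * (x ^ 2 + 0 * x + b)) =
      -∑ x : k, quadraticChar k (x * (x ^ 2 + 0 * x + b)) := by
    rw [← Finset.sum_neg_distrib]
    refine Fintype.sum_equiv (Equiv.neg k) _ _ fun x => ?_
    change _ = -quadraticChar k (-x * ((-x) ^ 2 + 0 * -x + b))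
    rw [show -x * ((-x) ^ 2 + 0 * -x + b) = -1 * (x * (x ^ 2 + 0 * x + b)) by ring, map_mul _ (-1), hm1]
    ring
  rw [cubicTrace]
  omega

variable {K : Type*} [Field K] [Fintype K] [Algebra k K]

theorem neg_jacobiSum_extension [CharZero L] {χ ψ : MulChar k L} (hχ : χ ≠ 1) {χ' ψ' : MulChar K L}
    (h : ∀ x, χ' x = χ (Algebra.norm k x)) (h' : ∀ x, ψ' x = ψ (Algebra.norm k x)) :
    -jacobiSum χ' ψ' = (-jacobiSum χ ψ) ^ Module.finrank k K := by
  rw [← neg_inj, neg_neg, ← sum_norm_eq_neg_jacobiSum_pow (K := K) hχ ψ, jacobiSum]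
  simp only [h, h']

/-- The Hasse–Davenport relation for `jacobiProduct`. -/
theorem jacobiProduct_extension [CharZero L] (hk : ringChar k ≠ 2) {χ : MulChar k L} (hχ : χ ≠ 1)
    {χ' : MulChar K L} (h : ∀ x, χ' x = χ (Algebra.norm k x)) :
    jacobiProduct χ' = jacobiProduct χ ^ Module.finrank k K := by
  have h1 : ∀ x, (χ' ^ 2) x = (χ ^ 2) (Algebra.norm k x) := by
    intro x
    rw [sq, sq, MulChar.mul_apply, MulChar.mul_apply, h]
  have h2 : ∀ x, χ'⁻¹ x = χ⁻¹ (Algebra.norm k x) := by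
    intro x
    rw [MulChar.inv_apply', MulChar.inv_apply', h, Algebra.norm_inv]
  have h3 : ∀ x, (quadChar K L * χ' ^ 2) x = (quadChar k L * χ ^ 2) (Algebra.norm k x) := by
    intro x
    rw [MulChar.mul_apply, MulChar.mul_apply, h1, quadChar_apply, quadChar_apply,
      quadraticChar_norm hk]
  have h4 : (χ' ^ 2) 4 = (χ ^ 2) 4 ^ Module.finrank k K := by
    rw [h1, ← map_ofNat (algebraMap k K) 4, Algebra.norm_algebraMap, map_pow]
  -- The second Jacobi sum is commuted because Hasse–Davenport is available when the first character
  -- is nontrivial, which is certain for `χ⁻¹` but not for `λ χ ^ 2`.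
  rw [jacobiProduct, jacobiProduct, jac, jac, jac, jac, h4, neg_jacobiSum_extension hχ h h,
    jacobiSum_comm (quadChar K L * _), jacobiSum_comm (quadChar k L * _),
    neg_jacobiSum_extension (inv_ne_one.mpr hχ) h2 h3, mul_pow, mul_pow]

end JacobiProduct

end GriffonRank

end

noncomputable section

open Polynomial

namespace GriffonRank

/-! ### Minimal models and their reductions -/

section PointCount

open WeierstrassCurve

variable {k : Type*} [Field k]

theorem equation_variableChange_iff (W : WeierstrassCurve k) (C : VariableChange k) (x y : k) :
    (C • W).toAffine.Equation x y ↔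
      W.toAffine.Equation (C.u ^ 2 * x + C.r) (C.u ^ 3 * y + C.u ^ 2 * C.s * x + C.t) := by
  have hu : (C.u : k) ≠ 0 := C.u.ne_zero
  rw [Affine.equation_iff', Affine.equation_iff', ← mul_eq_zero_iff_left (pow_ne_zero 6 hu)]
  simp only [variableChange_a₁, variableChange_a₂, variableChange_a₃, variableChange_a₄,
    variableChange_a₆, Units.val_inv_eq_inv_val]
  refine Eq.congr ?_ rfl
  field_simp
  ring

/-- The affine transformation of the plane attached to a change of variables. -/
def planeEquiv (C : VariableChange k) : k × k ≃ k × k where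
  toFun P := (C.u ^ 2 * P.1 + C.r, C.u ^ 3 * P.2 + C.u ^ 2 * C.s * P.1 + C.t)
  invFun P := ((C.u : k)⁻¹ ^ 2 * (P.1 - C.r), (C.u : k)⁻¹ ^ 3 * (P.2 - C.s * (P.1 - C.r) - C.t))
  left_inv P := by
    have hu : (C.u : k) * (C.u : k)⁻¹ = 1 := mul_inv_cancel₀ C.u.ne_zero
    have h2 : (C.u : k)⁻¹ ^ 2 * C.u ^ 2 = 1 := by rw [← mul_pow, mul_comm, hu, one_pow]
    have h3 : (C.u : k)⁻¹ ^ 3 * C.u ^ 3 = 1 := by rw [← mul_pow, mul_comm, hu, one_pow]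
    refine Prod.ext ?_ ?_
    · change (C.u : k)⁻¹ ^ 2 * (C.u ^ 2 * P.1 + C.r - C.r) = P.1
      linear_combination P.1 * h2
    · change (C.u : k)⁻¹ ^ 3 * (C.u ^ 3 * P.2 + C.u ^ 2 * C.s * P.1 + C.t -
        C.s * (C.u ^ 2 * P.1 + C.r - C.r) - C.t) = P.2
      linear_combination P.2 * h3
  right_inv P := by
    have hu : (C.u : k) * (C.u : k)⁻¹ = 1 := mul_inv_cancel₀ C.u.ne_zero
    have h2 : (C.u : k) ^ 2 * (C.u : k)⁻¹ ^ 2 = 1 := by rw [← mul_pow, hu, one_pow]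
    have h3 : (C.u : k) ^ 3 * (C.u : k)⁻¹ ^ 3 = 1 := by rw [← mul_pow, hu, one_pow]
    refine Prod.ext ?_ ?_
    · change (C.u : k) ^ 2 * ((C.u : k)⁻¹ ^ 2 * (P.1 - C.r)) + C.r = P.1
      linear_combination (P.1 - C.r) * h2
    · change (C.u : k) ^ 3 * ((C.u : k)⁻¹ ^ 3 * (P.2 - C.s * (P.1 - C.r) - C.t)) +
        C.u ^ 2 * C.s * ((C.u : k)⁻¹ ^ 2 * (P.1 - C.r)) + C.t = P.2
      linear_combination (P.2 - C.s * (P.1 - C.r) - C.t) * h3 + C.s * (P.1 - C.r) * h2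

theorem cubicPointCount_variableChange (W : WeierstrassCurve k) (C : VariableChange k) :
    cubicPointCount (C • W) = cubicPointCount W := by
  exact congrArg (· + 1) (Nat.card_congr ((planeEquiv C).subtypeEquiv fun P =>
    equation_variableChange_iff W C P.1 P.2))

open scoped Classical in
theorem cubicPointCount_eq [Fintype k] (hk : ringChar k ≠ 2) (a b : k) :
    (cubicPointCount (⟨0, a, 0, b, 0⟩ : WeierstrassCurve k) : ℤ) =
      Fintype.card k + 1 - cubicTrace a b := by
  have h1 : Nat.card {P : k × k //
      (⟨0, a, 0, b, 0⟩ : WeierstrassCurve k).toAffine.Equation P.1 P.2} =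
      Nat.card (Σ x : k, {y : k // y ^ 2 = x * (x ^ 2 + a * x + b)}) := by
    refine Nat.card_congr
      { toFun := fun P => ⟨P.1.1, P.1.2, ?_⟩
        invFun := fun P => ⟨(P.1, P.2.1), ?_⟩
        left_inv := fun P => rfl
        right_inv := fun P => rfl }
    · have := P.2
      rw [Affine.equation_iff] at this
      linear_combination this
    · rw [Affine.equation_iff]
      linear_combination P.2.2
  rw [cubicPointCount, h1, Nat.card_eq_fintype_card, Fintype.card_sigma]
  have h2 : ∀ x : k, (Fintype.card {y : k // y ^ 2 = x * (x ^ 2 + a * x + b)} : ℤ) =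
      quadraticChar k (x * (x ^ 2 + a * x + b)) + 1 := by
    intro x
    rw [← quadraticChar_card_sqrts hk, Fintype.card_subtype]
    congr 2
    ext; simp
  push_cast
  rw [Finset.sum_congr rfl fun x _ => h2 x, Finset.sum_add_distrib, cubicTrace]
  simp
  ring

end PointCount

/-! ### A criterion for minimality in residue characteristic different from two -/

section Minimal

open WeierstrassCurve

variable {R : Type*} [CommRing R] [IsDomain R] [IsDiscreteValuationRing R]
  {K : Type*} [Field K] [Algebra R K] [IsFractionRing R K]

/-- A minimal model differs from an integral model which cannot be scaled down by an integral
change of variables. -/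
theorem exists_integralModel_minimal_eq (h2 : IsUnit (2 : R)) (W : WeierstrassCurve K)
    (C₀ : VariableChange K) (W₀ : WeierstrassCurve R) (hW : C₀ • W = W₀.map (algebraMap R K))
    (hΔ : W₀.Δ ≠ 0) (hmin : ∀ u : R, u ^ 12 ∣ W₀.Δ → u ^ 4 ∣ W₀.c₄ → IsUnit u) :
    ∃ C : VariableChange R, integralModel R (W.minimal R) = C • W₀ := by
  have hinj : Function.Injective (algebraMap R K) := IsFractionRing.injective R K
  set Wi := integralModel R (W.minimal R) with hWi
  have hWiK : Wi.map (algebraMap R K) = W.minimal R := baseChange_integralModel_eq R _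
  obtain ⟨D, hD⟩ : ∃ D : VariableChange K,
      Wi.map (algebraMap R K) = D • W₀.map (algebraMap R K) := by
    refine ⟨(W.exists_isMinimal R).choose * C₀⁻¹, ?_⟩
    rw [hWiK, ← hW, mul_smul, inv_smul_smul]
    rfl
  have hu0 : (D.u : K) ≠ 0 := D.u.ne_zero
  have hΔD : (D.u : K) ^ 12 * algebraMap R K Wi.Δ = algebraMap R K W₀.Δ := by
    have := congrArg WeierstrassCurve.Δ hD
    rw [variableChange_Δ, map_Δ, map_Δ, Units.val_inv_eq_inv_val] at this
    rw [this, ← mul_assoc, ← mul_pow, mul_inv_cancel₀ hu0, one_pow, one_mul]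
  have hc4D : (D.u : K) ^ 4 * algebraMap R K Wi.c₄ = algebraMap R K W₀.c₄ := by
    have := congrArg WeierstrassCurve.c₄ hD
    rw [variableChange_c₄, map_c₄, map_c₄, Units.val_inv_eq_inv_val] at this
    rw [this, ← mul_assoc, ← mul_pow, mul_inv_cancel₀ hu0, one_pow, one_mul]
  let v := (IsDiscreteValuationRing.maximalIdeal R).valuation K
  -- Minimality says that the multiplicative valuation of the discriminant is maximal among integral
  -- models, and `W₀` is one of them.
  have hv : v (algebraMap R K W₀.Δ) ≤ v (algebraMap R K Wi.Δ) := by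
    have hm : IsMinimal R (W.minimal R) := inferInstance
    have hI : D⁻¹ • W.minimal R = W₀.map (algebraMap R K) := by
      rw [← hWiK, hD, inv_smul_smul]
    have hint : WeierstrassCurve.IsIntegral R (D⁻¹ • W.minimal R) := ⟨W₀, hI⟩
    have h1 : valuation_Δ_aux R (D⁻¹ • W.minimal R) ≤
        valuation_Δ_aux R ((1 : VariableChange K) • W.minimal R) := by
      rcases le_total (valuation_Δ_aux R (D⁻¹ • W.minimal R))
        (valuation_Δ_aux R ((1 : VariableChange K) • W.minimal R)) with h | h
      · exact h
      · exact hm.val_Δ_maximal.2 hint h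
    rw [one_smul] at h1
    have h3 : ((valuation_Δ_aux R (D⁻¹ • W.minimal R) : _) : WithZero (Multiplicative ℤ)) ≤
      valuation_Δ_aux R (W.minimal R) := h1
    rw [valuation_Δ_aux_eq_of_isIntegral, valuation_Δ_aux_eq_of_isIntegral, hI, ← hWiK, map_Δ,
      map_Δ] at h3
    exact h3
  -- From `u ^ 12 Δ(Wi) = Δ(W₀)`, a scaling factor of valuation above `1` would contradict the
  -- inequality just obtained. So `u` is integral, and the hypothesis on `W₀` makes it a unit.
  have hvu : v D.u ≤ 1 := by
    rw [← hΔD, map_mul, map_pow] at hv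
    by_contra hlt
    rw [not_le] at hlt
    have hΔi : v (algebraMap R K Wi.Δ) ≠ 0 := by
      rw [Valuation.ne_zero_iff]
      intro h0
      rw [h0, mul_zero] at hΔD
      exact hΔ (hinj (by rw [← hΔD, map_zero]))
    have h5 : (1 : WithZero (Multiplicative ℤ)) < v D.u ^ 12 := one_lt_pow₀ hlt (by norm_num)
    have h6 : v (algebraMap R K Wi.Δ) < v D.u ^ 12 * v (algebraMap R K Wi.Δ) :=
      lt_mul_of_one_lt_left (zero_lt_iff.mpr hΔi) h5
    exact absurd hv (not_le.mpr h6)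
  obtain ⟨u₀, hu₀⟩ := IsDiscreteValuationRing.exists_lift_of_le_one hvu
  have hunit : IsUnit u₀ := by
    apply hmin
    · exact ⟨Wi.Δ, hinj (by rw [map_mul, map_pow, hu₀, hΔD])⟩
    · exact ⟨Wi.c₄, hinj (by rw [map_mul, map_pow, hu₀, hc4D])⟩
  obtain ⟨u, rfl⟩ := hunit
  obtain ⟨i2, hi2⟩ := h2.exists_right_inv
  have hi2K : (2 : K) * algebraMap R K i2 = 1 := by
    rw [← map_ofNat (algebraMap R K) 2, ← map_mul, hi2, map_one]
  have ha1 := congrArg WeierstrassCurve.a₁ hD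
  have ha3 := congrArg WeierstrassCurve.a₃ hD
  have hb6 := congrArg WeierstrassCurve.b₆ hD
  rw [variableChange_a₁, map_a₁, map_a₁, Units.val_inv_eq_inv_val, ← hu₀] at ha1
  rw [variableChange_a₃, map_a₃, map_a₃, map_a₁, Units.val_inv_eq_inv_val, ← hu₀] at ha3
  rw [variableChange_b₆, map_b₆, map_b₆, map_b₄, map_b₂, Units.val_inv_eq_inv_val, ← hu₀] at hb6
  have huK : algebraMap R K u ≠ 0 := by rw [hu₀]; exact hu0
  have hs : D.s = algebraMap R K (i2 * (u * Wi.a₁ - W₀.a₁)) := by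
    rw [map_mul, map_sub, map_mul, ha1, mul_inv_cancel_left₀ huK]
    linear_combination (-D.s) * hi2K
  -- The transformation formula for `b₆`, divided by `4`, is a monic cubic equation for `r` over
  -- `R`; a discrete valuation ring is integrally closed.
  have hr : IsIntegral R D.r := by
    refine ⟨X ^ 3 + C (i2 ^ 2 * W₀.b₂) * X ^ 2 + C (i2 * W₀.b₄) * X +
      C (i2 ^ 2 * (W₀.b₆ - u ^ 6 * Wi.b₆)), by monicity!, ?_⟩
    have h6 : algebraMap R K u ^ 6 * algebraMap R K Wi.b₆ = algebraMap R K W₀.b₆ +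
        2 * D.r * algebraMap R K W₀.b₄ + D.r ^ 2 * algebraMap R K W₀.b₂ + 4 * D.r ^ 3 := by
      rw [hb6]
      field_simp
    simp only [eval₂_add, eval₂_mul, eval₂_pow, eval₂_X, eval₂_C]
    simp only [map_mul, map_sub, map_pow]
    linear_combination (-(algebraMap R K i2) ^ 2) * h6 +
      (-(D.r * algebraMap R K i2 * algebraMap R K W₀.b₄) -
        D.r ^ 3 * (1 + 2 * algebraMap R K i2)) * hi2K
  obtain ⟨r, hr⟩ := IsIntegrallyClosed.isIntegral_iff.mp hr
  have ht : D.t = algebraMap R K (i2 * (u ^ 3 * Wi.a₃ - W₀.a₃ - r * W₀.a₁)) := by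
    rw [map_mul, map_sub, map_sub, map_mul, map_mul, map_pow, ha3, hr, inv_pow,
      mul_inv_cancel_left₀ (pow_ne_zero 3 huK)]
    linear_combination (-D.t) * hi2K
  refine ⟨⟨u, r, i2 * (u * Wi.a₁ - W₀.a₁), i2 * (u ^ 3 * Wi.a₃ - W₀.a₃ - r * W₀.a₁)⟩,
    WeierstrassCurve.map_injective hinj ?_⟩
  change Wi.map (algebraMap R K) = (_ • W₀).map (algebraMap R K)
  rw [hD, ← map_variableChange]
  congr 1
  ext
  · exact hu₀.symm
  · exact hr.symm
  · exact hs
  · exact ht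

variable [Fintype (IsLocalRing.ResidueField R)]

open scoped Classical in
/-- The reduction of `y ^ 2 = x (x ^ 2 + a x + b)` in terms of an integral model with coefficients
`a₀ = a / u ^ 2` and `b₀ = b / u ^ 4`. -/
theorem reduction_minimal (h2 : IsUnit (2 : R)) {a b : K} (u : Kˣ) (a₀ b₀ : R)
    (ha : a = u ^ 2 * algebraMap R K a₀) (hb : b = u ^ 4 * algebraMap R K b₀)
    (hΔ : b₀ * (a₀ ^ 2 - 4 * b₀) ≠ 0)
    (hmin : ∀ u : R, u ^ 12 ∣ b₀ ^ 2 * (a₀ ^ 2 - 4 * b₀) → u ^ 4 ∣ a₀ ^ 2 - 3 * b₀ → IsUnit u) :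
    (((⟨0, a, 0, b, 0⟩ : WeierstrassCurve K).minimal R).HasGoodReduction R ↔
      IsLocalRing.residue R b₀ *
        (IsLocalRing.residue R a₀ ^ 2 - 4 * IsLocalRing.residue R b₀) ≠ 0) ∧
    (cubicPointCount (((⟨0, a, 0, b, 0⟩ : WeierstrassCurve K).minimal R).reduction R) : ℤ) =
      Fintype.card (IsLocalRing.ResidueField R) + 1 -
        cubicTrace (IsLocalRing.residue R a₀) (IsLocalRing.residue R b₀) := by
  set W : WeierstrassCurve K := ⟨0, a, 0, b, 0⟩
  set W₀ : WeierstrassCurve R := ⟨0, a₀, 0, b₀, 0⟩ with hW₀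
  have hu0 : (u : K) ≠ 0 := u.ne_zero
  -- The powers of `2` in `Δ` and `c₄` are units, so the divisibility conditions concern only the
  -- displayed polynomials in `a₀` and `b₀`.
  have hΔ₀ : W₀.Δ = 2 ^ 4 * (b₀ ^ 2 * (a₀ ^ 2 - 4 * b₀)) := by
    simp [hW₀, WeierstrassCurve.Δ, WeierstrassCurve.b₂, WeierstrassCurve.b₄, WeierstrassCurve.b₆,
      WeierstrassCurve.b₈]
    ring
  have hc₄ : W₀.c₄ = 2 ^ 4 * (a₀ ^ 2 - 3 * b₀) := by
    simp [hW₀, WeierstrassCurve.c₄, WeierstrassCurve.b₂, WeierstrassCurve.b₄]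
    ring
  have h24 : IsUnit (2 ^ 4 : R) := h2.pow 4
  obtain ⟨C, hC⟩ := exists_integralModel_minimal_eq h2 W ⟨u, 0, 0, 0⟩ W₀ (by
    ext
    · simp [W, hW₀, variableChange_a₁]
    · simp [W, hW₀, variableChange_a₂, ha, hu0]
    · simp [W, hW₀, variableChange_a₃]
    · simp [W, hW₀, variableChange_a₄, hb, hu0]
    · simp [W, hW₀, variableChange_a₆]) (by
    rw [hΔ₀]
    refine mul_ne_zero h24.ne_zero ?_
    rw [sq, mul_assoc]
    exact mul_ne_zero (left_ne_zero_of_mul hΔ) hΔ) (by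
    intro w h1 h3
    rw [hΔ₀, h24.dvd_mul_left] at h1
    rw [hc₄, h24.dvd_mul_left] at h3
    exact hmin w h1 h3)
  have hred : (W.minimal R).reduction R =
      (C.map (IsLocalRing.residue R)) • W₀.map (IsLocalRing.residue R) := by
    rw [map_variableChange, ← hC]
    rfl
  have hres2 : (2 : IsLocalRing.ResidueField R) ≠ 0 := by
    have := (h2.map (IsLocalRing.residue R)).ne_zero
    rwa [map_ofNat] at this
  constructor
  · rw [hasGoodReduction_iff_isElliptic_reduction, isElliptic_iff, isUnit_iff_ne_zero, hred,
      variableChange_Δ, map_Δ, hΔ₀]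
    simp only [map_mul, map_pow, map_sub, map_ofNat]
    simp [hres2]
  · rw [hred, cubicPointCount_variableChange]
    have : W₀.map (IsLocalRing.residue R) =
        ⟨0, IsLocalRing.residue R a₀, 0, IsLocalRing.residue R b₀, 0⟩ := by
      ext <;> simp [hW₀]
    rw [this, cubicPointCount_eq]
    intro h
    exact hres2 (by
      have := CharP.cast_eq_zero (IsLocalRing.ResidueField R)
        (ringChar (IsLocalRing.ResidueField R))
      rw [h] at this
      exact_mod_cast this)

end Minimal

end GriffonRank

end

noncomputable section

open Polynomial

namespace GriffonRank

/-! ### Residue fields of the places of `F(t)` -/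

section Residue

variable {F : Type*} [Field F]

theorem residue_eq_zero_iff_valuation (v : Place F) (x : v.ring) :
    IsLocalRing.residue v.ring x = 0 ↔ v.valuation (x : RatFunc F) < 1 := by
  rw [IsLocalRing.residue_eq_zero_iff]
  exact Valuation.mem_maximalIdeal_iff _ _

/-- The convention `α β = 0` at a singular reduction lets one factorization cover both the good and
the bad Euler polynomials. -/
theorem eulerPolynomial_eq (W : WeierstrassCurve (RatFunc F)) (v : Place F)
    [Fintype (IsLocalRing.ResidueField v.ring)] {a b : IsLocalRing.ResidueField v.ring}
    (h1 : (W.minimal v.ring).HasGoodReduction v.ring ↔ b * (a ^ 2 - 4 * b) ≠ 0)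
    (h2 : (cubicPointCount (reductionAt W v) : ℤ) =
      Fintype.card (IsLocalRing.ResidueField v.ring) + 1 - cubicTrace a b)
    {L : Type*} [Field L] {α β : L} (hs : α + β = cubicTrace a b)
    (hm : α * β = open scoped Classical in if b * (a ^ 2 - 4 * b) = 0 then 0
      else (Fintype.card (IsLocalRing.ResidueField v.ring) : L)) :
    (eulerPolynomial W v).map (Int.castRingHom L) =
      (1 - C α * X ^ v.degree) * (1 - C β * X ^ v.degree) := by
  have hT : traceAt W v = cubicTrace a b := by
    rw [traceAt, h2, residueCard, Nat.card_eq_fintype_card]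
    ring
  have hq : residueCard v = Fintype.card (IsLocalRing.ResidueField v.ring) := by
    rw [residueCard, Nat.card_eq_fintype_card]
  have hprod : (1 - C α * X ^ v.degree) * (1 - C β * X ^ v.degree) =
      1 - C (α + β) * X ^ v.degree + C (α * β) * X ^ (2 * v.degree) := by
    rw [C_add, C_mul]
    ring
  rw [hprod, hs, hm, eulerPolynomial, hT, hq]
  split_ifs with hg hz hz
  · exact absurd hz (h1.mp hg)
  · simp
  · simp
  · exact absurd (h1.mpr hz) hg

end Residue

section FinitePlace

variable {F : Type*} [Field F] {P : F[X]} (hm : P.Monic) (hi : Irreducible P)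

/-- The inclusion of `F[t]` into the valuation ring of a finite place. -/
def polyToRing : F[X] →+* (Place.finite P hm hi).ring where
  toFun h := ⟨algebraMap F[X] (RatFunc F) h,
    (Place.primeOf P hi).valuation_le_one h⟩
  map_one' := Subtype.ext (map_one _)
  map_mul' _ _ := Subtype.ext (map_mul _ _ _)
  map_zero' := Subtype.ext (map_zero _)
  map_add' _ _ := Subtype.ext (map_add _ _ _)

theorem coe_polyToRing (h : F[X]) :
    ((polyToRing hm hi h : (Place.finite P hm hi).ring) : RatFunc F) =
      algebraMap F[X] (RatFunc F) h := rfl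

theorem polyToRing_injective : Function.Injective (polyToRing hm hi) := fun _ _ hgh =>
  IsFractionRing.injective F[X] (RatFunc F) (congrArg Subtype.val hgh)

/-- Reduction of polynomials at a finite place. -/
def polyResidue : F[X] →+* IsLocalRing.ResidueField (Place.finite P hm hi).ring :=
  (IsLocalRing.residue _).comp (polyToRing hm hi)

theorem polyResidue_eq_zero_iff (h : F[X]) : polyResidue hm hi h = 0 ↔ P ∣ h := by
  change IsLocalRing.residue _ (polyToRing hm hi h) = 0 ↔ _
  rw [residue_eq_zero_iff_valuation, coe_polyToRing]
  change (Place.primeOf P hi).valuation (RatFunc F) (algebraMap F[X] (RatFunc F) h) < 1 ↔ _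
  rw [IsDedekindDomain.HeightOneSpectrum.valuation_lt_one_iff_mem]
  exact Ideal.mem_span_singleton

theorem polyResidue_surjective : Function.Surjective (polyResidue hm hi) := by
  intro y
  obtain ⟨x, rfl⟩ := IsLocalRing.residue_surjective y
  obtain ⟨a, ha⟩ := (Place.primeOf P hi).exists_valuation_sub_lt_of_integer
    (K := RatFunc F) (x := x) x.2 1
  refine ⟨a, ?_⟩
  change IsLocalRing.residue _ (polyToRing hm hi a) = _
  rw [← sub_eq_zero, ← map_sub, residue_eq_zero_iff_valuation]
  exact ha

theorem ker_polyResidue : RingHom.ker (polyResidue hm hi) = Ideal.span {P} := by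
  ext h
  rw [RingHom.mem_ker, polyResidue_eq_zero_iff, Ideal.mem_span_singleton]

/-- The residue field of a finite place is `F[t] / P`. -/
def residueEquiv : AdjoinRoot P ≃+* IsLocalRing.ResidueField (Place.finite P hm hi).ring :=
  (Ideal.quotEquivOfEq (ker_polyResidue hm hi).symm).trans
    (RingHom.quotientKerEquivOfSurjective (polyResidue_surjective hm hi))

theorem natCard_residueField [Finite F] :
    Nat.card (IsLocalRing.ResidueField (Place.finite P hm hi).ring) =
      Nat.card F ^ P.natDegree := by
  have : Fact (Irreducible P) := ⟨hi⟩
  rw [← Nat.card_congr (residueEquiv hm hi).toEquiv]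
  have : Module.Finite F (AdjoinRoot P) := hm.finite_adjoinRoot
  rw [Module.natCard_eq_pow_finrank (K := F), ← finrank_quotient_span_eq_natDegree]
  rfl

theorem finite_residueField [Finite F] :
    Finite (IsLocalRing.ResidueField (Place.finite P hm hi).ring) := by
  apply Nat.finite_of_card_ne_zero
  rw [natCard_residueField]
  exact pow_ne_zero _ Nat.card_pos.ne'

variable {K : Type*} [Field K] [Algebra F K]

/-- The embedding of the residue field of a finite place attached to a root. -/
def residueLift {τ : K} (hτ : minpoly F τ = P) :
    IsLocalRing.ResidueField (Place.finite P hm hi).ring →+* K :=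
  (AdjoinRoot.lift (algebraMap F K) τ (by
    rw [← hτ]; exact minpoly.aeval F τ)).comp (residueEquiv hm hi).symm.toRingHom

theorem residueLift_polyResidue {τ : K} (hτ : minpoly F τ = P) (h : F[X]) :
    residueLift hm hi hτ (polyResidue hm hi h) = aeval τ h := by
  have h1 : (residueEquiv hm hi).symm (polyResidue hm hi h) = AdjoinRoot.mk P h := by
    rw [RingEquiv.symm_apply_eq]
    rfl
  rw [residueLift, RingHom.comp_apply, RingEquiv.toRingHom_eq_coe, RingEquiv.coe_toRingHom, h1,
    AdjoinRoot.lift_mk]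
  rfl

end FinitePlace

section InfinitePlace

variable {F : Type*} [Field F]

theorem valuation_infinite (x : RatFunc F) : (Place.infinite : Place F).valuation x =
    open scoped Classical in RatFunc.inftyValuation F x := rfl

open scoped Classical in
theorem inftyValuation_C_le_one (c : F) : RatFunc.inftyValuation F (RatFunc.C c) ≤ 1 := by
  by_cases hc : c = 0
  · simp [hc]
  · rw [RatFunc.inftyValuation.C F hc]

/-- The constants in the valuation ring of the infinite place. -/
def constToRing : F →+* (Place.infinite : Place F).ring where
  toFun c := ⟨RatFunc.C c, inftyValuation_C_le_one c⟩
  map_one' := Subtype.ext (map_one _)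
  map_mul' _ _ := Subtype.ext (map_mul _ _ _)
  map_zero' := Subtype.ext (map_zero _)
  map_add' _ _ := Subtype.ext (map_add _ _ _)

/-- The uniformizer `1 / t` of the infinite place. -/
def invX : (Place.infinite : Place F).ring :=
  ⟨RatFunc.X⁻¹, by
    change (Place.infinite : Place F).valuation _ ≤ 1
    rw [valuation_infinite, map_inv₀, RatFunc.inftyValuation.X, ← WithZero.exp_neg,
      ← WithZero.exp_zero, WithZero.exp_le_exp]
    norm_num⟩

theorem residue_invX : IsLocalRing.residue _ (invX : (Place.infinite : Place F).ring) = 0 := by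
  rw [residue_eq_zero_iff_valuation]
  change (Place.infinite : Place F).valuation (RatFunc.X⁻¹) < 1
  rw [valuation_infinite, map_inv₀, RatFunc.inftyValuation.X, ← WithZero.exp_neg,
    ← WithZero.exp_zero, WithZero.exp_lt_exp]
  norm_num

theorem residue_constToRing_surjective : Function.Surjective
    ((IsLocalRing.residue (Place.infinite : Place F).ring).comp constToRing) := by
  classical
  intro y
  obtain ⟨⟨x, hx⟩, rfl⟩ := IsLocalRing.residue_surjective y
  by_cases hx0 : x = 0
  · subst hx0
    exact ⟨0, by rw [map_zero]; exact (map_zero _).symm⟩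
  have hx' : RatFunc.inftyValuation F x ≤ 1 := hx
  rw [RatFunc.inftyValuation_apply, RatFunc.inftyValuation_of_nonzero F hx0, ← WithZero.exp_zero, WithZero.exp_le_exp,
    RatFunc.intDegree] at hx'
  -- The value of `x` at infinity: the denominator is monic, so subtracting `c` lowers the degree of
  -- the numerator below that of the denominator. If the numerator already has smaller degree then
  -- `c = 0`.
  set c := (x.num).coeff x.denom.natDegree
  refine ⟨c, ?_⟩
  change IsLocalRing.residue _ (constToRing c) = _
  rw [eq_comm, ← sub_eq_zero, ← map_sub, residue_eq_zero_iff_valuation]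
  change RatFunc.inftyValuation F (x - RatFunc.C c) < 1
  have hden : algebraMap F[X] (RatFunc F) x.denom ≠ 0 :=
    RatFunc.algebraMap_ne_zero x.denom_ne_zero
  have h1 : x - RatFunc.C c = algebraMap F[X] (RatFunc F) (x.num - Polynomial.C c * x.denom) /
      algebraMap F[X] (RatFunc F) x.denom := by
    rw [map_sub, map_mul, sub_div, RatFunc.num_div_denom, RatFunc.algebraMap_C,
      mul_div_cancel_right₀ _ hden]
  by_cases h0 : x.num - Polynomial.C c * x.denom = 0
  · rw [h1, h0, map_zero, zero_div, map_zero]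
    exact zero_lt_one
  rw [h1, map_div₀, RatFunc.inftyValuation_apply, RatFunc.inftyValuation_apply,
    RatFunc.inftyValuation.polynomial F h0,
    RatFunc.inftyValuation.polynomial F x.denom_ne_zero, ← WithZero.exp_sub, ← WithZero.exp_zero,
    WithZero.exp_lt_exp, sub_neg, Nat.cast_lt]
  have hle : (x.num - Polynomial.C c * x.denom).natDegree ≤ x.denom.natDegree := by
    refine (natDegree_sub_le _ _).trans (max_le (by omega) ?_)
    exact natDegree_C_mul_le _ _
  have hcoeff : (x.num - Polynomial.C c * x.denom).coeff x.denom.natDegree = 0 := by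
    rw [coeff_sub, coeff_C_mul, (x.monic_denom).coeff_natDegree, mul_one, sub_self]
  refine lt_of_le_of_ne hle fun h => h0 ?_
  rw [← h] at hcoeff
  exact leadingCoeff_eq_zero.mp hcoeff

end InfinitePlace

end GriffonRank

end

noncomputable section

open Polynomial

namespace GriffonRank

/-! ### The Euler factors of the curves `E_d` -/

section LocalCoefficients

/-- The coefficient of `x ^ 2` of the reduction of `E_d` at `t = τ`. -/
def fiberA {K : Type*} [Field K] (d : ℕ) (τ : K) : K :=
  open scoped Classical in if τ = 0 then 0 else τ ^ (2 * d)

/-- The coefficient of `x` of the reduction of `E_d` at `t = τ`. -/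
def fiberB {K : Type*} [Field K] (d : ℕ) (τ : K) : K :=
  open scoped Classical in
  if τ = 0 then (if Even d then -4 else 0) else -4 * τ ^ (2 * d)

theorem map_fiberA {k K : Type*} [Field k] [Field K] (φ : k →+* K) (d : ℕ) (τ : k) :
    φ (fiberA d τ) = fiberA d (φ τ) := by
  by_cases h : τ = 0
  · simp [fiberA, h]
  · simp [fiberA, h]

theorem map_fiberB {k K : Type*} [Field k] [Field K] (φ : k →+* K) (d : ℕ) (τ : k) :
    φ (fiberB d τ) = fiberB d (φ τ) := by
  by_cases h : τ = 0
  · by_cases hd : Even d <;> simp [fiberB, h, hd, map_ofNat φ 4]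
  · simp [fiberB, h, map_ofNat φ 4]

end LocalCoefficients

/-! ### Minimal models at the finite places -/

section FinitePlace

variable {F : Type*} [Field F] {P : F[X]} (hm : P.Monic) (hi : Irreducible P)

theorem isUnit_polyToRing_iff (h : F[X]) : IsUnit (polyToRing hm hi h) ↔ ¬ P ∣ h := by
  rw [← polyResidue_eq_zero_iff hm hi, ← IsLocalRing.residue_ne_zero_iff_isUnit]
  rfl

theorem isUnit_two_ring (h2 : (2 : F) ≠ 0) : IsUnit (2 : (Place.finite P hm hi).ring) := by
  have h : (2 : (Place.finite P hm hi).ring) = polyToRing hm hi (C 2) := by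
    rw [show (C 2 : F[X]) = 2 from map_ofNat C 2, map_ofNat]
  rw [h, isUnit_polyToRing_iff]
  intro hd
  have := natDegree_le_of_dvd hd (by simpa using h2)
  rw [natDegree_C] at this
  exact absurd hi.natDegree_pos (by omega)

theorem coe_polyToRing_X :
    ((polyToRing hm hi X : (Place.finite P hm hi).ring) : RatFunc F) = RatFunc.X := by
  rw [coe_polyToRing, RatFunc.algebraMap_X]

/-- Writing `w = n / e` with `e` prime to `P`, a non-unit `w` forces `P ∣ n`. -/
theorem polyToRing_dvd_of_not_isUnit {w : (Place.finite P hm hi).ring} (hw : ¬ IsUnit w) :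
    polyToRing hm hi P ∣ w := by
  obtain ⟨n, ⟨e, he⟩, hne⟩ := (Place.primeOf P hi).exists_primeCompl_mul_eq_of_integer
    (K := RatFunc F) (w : RatFunc F) w.2
  have h1 : w * polyToRing hm hi e = polyToRing hm hi n := Subtype.ext hne
  have h2 : IsUnit (polyToRing hm hi e) := by
    rw [isUnit_polyToRing_iff]
    intro h
    exact he (Ideal.mem_span_singleton.mpr h)
  have h3 : P ∣ n := by
    by_contra h
    rw [← isUnit_polyToRing_iff hm hi, ← h1] at h
    exact hw (isUnit_of_mul_isUnit_left h)
  rw [← h2.dvd_mul_right, h1]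
  exact map_dvd _ h3

/-- An integral model of `E_d` at a finite place which satisfies the minimality criterion. -/
theorem exists_model_finite (h2 : (2 : F) ≠ 0) {d : ℕ} (hd : d ≠ 0) :
    ∃ (u : (RatFunc F)ˣ) (a₀ b₀ : (Place.finite P hm hi).ring),
      (RatFunc.X ^ (2 * d) : RatFunc F) = u ^ 2 * algebraMap _ (RatFunc F) a₀ ∧
      (-4 * RatFunc.X ^ (2 * d) : RatFunc F) = u ^ 4 * algebraMap _ (RatFunc F) b₀ ∧
      b₀ * (a₀ ^ 2 - 4 * b₀) ≠ 0 ∧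
      (∀ u : (Place.finite P hm hi).ring,
        u ^ 12 ∣ b₀ ^ 2 * (a₀ ^ 2 - 4 * b₀) → u ^ 4 ∣ a₀ ^ 2 - 3 * b₀ → IsUnit u) ∧
      IsLocalRing.residue _ a₀ = fiberA d (polyResidue hm hi X) ∧
      IsLocalRing.residue _ b₀ = fiberB d (polyResidue hm hi X) := by
  set R := (Place.finite P hm hi).ring
  have h2R : IsUnit (2 : R) := isUnit_two_ring hm hi h2
  have h4R : IsUnit (4 : R) := by
    rw [show (4 : R) = 2 * 2 by norm_num]
    exact h2R.mul h2R
  have h16R : IsUnit (16 : R) := by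
    rw [show (16 : R) = 4 * 4 by norm_num]
    exact h4R.mul h4R
  set t : R := polyToRing hm hi X with ht
  have htX : algebraMap R (RatFunc F) t = RatFunc.X := coe_polyToRing_X hm hi
  have ht0 : t ≠ 0 := fun h => X_ne_zero (polyToRing_injective hm hi (by rw [← ht, h, map_zero]))
  have hXK : (RatFunc.X : RatFunc F) ≠ 0 := RatFunc.X_ne_zero
  have hne : ∀ n : ℕ, n ≠ 0 → t ^ n + 16 ≠ 0 := by
    intro n hn h
    have h1 : polyToRing hm hi (X ^ n + C 16) = 0 := by
      rw [map_add, map_pow, ← ht, ← h, show (C 16 : F[X]) = 16 from map_ofNat C 16, map_ofNat]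
    have h3 : (X ^ n + C 16 : F[X]) = 0 := polyToRing_injective hm hi (by rw [h1, map_zero])
    exact (monic_X_pow_add_C 16 hn).ne_zero h3
  have hres2 : ∀ n : R, IsUnit n → IsLocalRing.residue R n ≠ 0 := fun n hn =>
    (hn.map (IsLocalRing.residue R)).ne_zero
  have hrest : IsLocalRing.residue R t = polyResidue hm hi X := rfl
  by_cases hPX : P ∣ X
  · have hP : P = X := eq_of_monic_of_associated hm monic_X
      ((hi.dvd_irreducible_iff_associated irreducible_X).mp hPX)
    have hres : polyResidue hm hi X = 0 := (polyResidue_eq_zero_iff hm hi X).mpr hPX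
    rcases Nat.even_or_odd' d with ⟨e, he | he⟩
    · have hunit : IsUnit (t ^ (2 * d) + 16) := by
        rw [← IsLocalRing.residue_ne_zero_iff_isUnit, map_add, map_pow, hrest, hres,
          zero_pow (by omega), zero_add]
        exact hres2 16 h16R
      -- At `t = 0` with `d = 2 e`, scaling by `t ^ e` gives `y ^ 2 = x (x ^ 2 + t ^ d x - 4)`,
      -- whose discriminant is a unit: good reduction.
      refine ⟨Units.mk0 _ (pow_ne_zero e hXK), t ^ d, -4, ?_, ?_, ?_, ?_, ?_, ?_⟩
      · rw [Units.val_mk0, map_pow, htX, he]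
        ring
      · rw [Units.val_mk0, map_neg, map_ofNat, he]
        ring
      · refine mul_ne_zero h4R.neg.ne_zero ?_
        convert hunit.ne_zero using 1
        ring
      · intro w hw _
        have : (-4 : R) ^ 2 * ((t ^ d) ^ 2 - 4 * -4) = 16 * (t ^ (2 * d) + 16) := by ring
        rw [this] at hw
        exact (isUnit_pow_iff (by norm_num)).mp (isUnit_of_dvd_unit hw (h16R.mul hunit))
      · rw [map_pow, hrest, hres, zero_pow hd]
        simp [fiberA]
      · rw [map_neg, map_ofNat, hres]
        simp [fiberB, he]
    · have hodd : ¬ Even d := by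
        rw [Nat.not_even_iff_odd]
        exact ⟨e, he⟩
      -- At `t = 0` with `d = 2 e + 1`, scaling by `t ^ e` leaves a discriminant of valuation `6 <
      -- 12`, and the reduction is the cusp `y ^ 2 = x ^ 3`.
      refine ⟨Units.mk0 _ (pow_ne_zero e hXK), t ^ (d + 1), -4 * t ^ 2, ?_, ?_, ?_, ?_, ?_, ?_⟩
      · rw [Units.val_mk0, map_pow, htX, he]
        ring
      · rw [Units.val_mk0, map_mul, map_pow, htX, map_neg, map_ofNat, he]
        ring
      · have : -4 * t ^ 2 * ((t ^ (d + 1)) ^ 2 - 4 * (-4 * t ^ 2)) =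
            -4 * t ^ 4 * (t ^ (2 * d) + 16) := by ring
        rw [this]
        exact mul_ne_zero (mul_ne_zero h4R.neg.ne_zero (pow_ne_zero _ ht0)) (hne _ (by omega))
      · intro w hw _
        by_contra hwu
        have h1 := polyToRing_dvd_of_not_isUnit hm hi hwu
        have h3 : polyToRing hm hi P = t := congrArg (polyToRing hm hi) hP
        rw [h3] at h1
        have h4 := (pow_dvd_pow_of_dvd h1 12).trans hw
        have h5 : (-4 * t ^ 2) ^ 2 * ((t ^ (d + 1)) ^ 2 - 4 * (-4 * t ^ 2)) =
            t ^ 6 * (16 * (t ^ (2 * d) + 16)) := by ring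
        rw [h5, show t ^ 12 = t ^ 6 * t ^ 6 by ring,
          mul_dvd_mul_iff_left (pow_ne_zero 6 ht0)] at h4
        obtain ⟨c, hc⟩ := h4
        have h6 := congrArg (IsLocalRing.residue R) hc
        rw [map_mul, map_mul, map_add, map_pow, map_pow, hrest, hres, zero_pow (by omega),
          zero_pow (by norm_num), zero_add, zero_mul, ← map_mul] at h6
        exact hres2 _ (h16R.mul h16R) h6
      · rw [map_pow, hrest, hres, zero_pow (by omega)]
        simp [fiberA]
      · rw [map_mul, map_pow, hrest, hres]
        simp [fiberB, hodd]
  · have htu : IsUnit t := (isUnit_polyToRing_iff hm hi X).mpr hPX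
    have hres : polyResidue hm hi X ≠ 0 := by rwa [Ne, polyResidue_eq_zero_iff]
    refine ⟨1, t ^ (2 * d), -4 * t ^ (2 * d), ?_, ?_, ?_, ?_, ?_, ?_⟩
    · rw [map_pow, htX]
      simp
    · rw [map_mul, map_pow, htX, map_neg, map_ofNat]
      simp
    · have : -4 * t ^ (2 * d) * ((t ^ (2 * d)) ^ 2 - 4 * (-4 * t ^ (2 * d))) =
          -4 * (t ^ (2 * d)) ^ 2 * (t ^ (2 * d) + 16) := by ring
      rw [this]
      exact mul_ne_zero (mul_ne_zero h4R.neg.ne_zero (pow_ne_zero _ (pow_ne_zero _ ht0)))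
        (hne _ (by omega))
    · intro w h1 h3
      by_contra hwu
      have hw0 : IsLocalRing.residue R w = 0 := by
        by_contra h
        exact hwu ((IsLocalRing.residue_ne_zero_iff_isUnit w).mp h)
      have hs : IsLocalRing.residue R (t ^ (2 * d)) ≠ 0 := hres2 _ (htu.pow _)
      obtain ⟨c, hc⟩ := h1
      obtain ⟨c', hc'⟩ := h3
      -- Here `t` is a unit. A non-unit `w` would make the residues of `t ^ (2 d) + 16` and `t ^ (2
      -- d) + 12` both vanish, but their difference is the unit `4`.
      have e1 : (-4 * t ^ (2 * d)) ^ 2 * ((t ^ (2 * d)) ^ 2 - 4 * (-4 * t ^ (2 * d))) =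
          16 * (t ^ (2 * d)) ^ 3 * (t ^ (2 * d) + 16) := by ring
      have e2 : (t ^ (2 * d)) ^ 2 - 3 * (-4 * t ^ (2 * d)) = t ^ (2 * d) * (t ^ (2 * d) + 12) := by
        ring
      rw [e1] at hc
      rw [e2] at hc'
      have f1 := congrArg (IsLocalRing.residue R) hc
      have f2 := congrArg (IsLocalRing.residue R) hc'
      rw [map_mul _ (w ^ 12), map_pow _ w, hw0, zero_pow (by norm_num), zero_mul, map_mul, map_mul,
        map_pow _ (t ^ (2 * d))] at f1
      rw [map_mul _ (w ^ 4), map_pow _ w, hw0, zero_pow (by norm_num), zero_mul, map_mul] at f2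
      have g1 := (mul_eq_zero.mp f1).resolve_left
        (mul_ne_zero (hres2 _ h16R) (pow_ne_zero 3 hs))
      have g2 := (mul_eq_zero.mp f2).resolve_left hs
      have g3 : IsLocalRing.residue R 4 = 0 := by
        rw [show (4 : R) = (t ^ (2 * d) + 16) - (t ^ (2 * d) + 12) by ring, map_sub, g1, g2,
          sub_zero]
      exact hres2 _ h4R g3
    · rw [map_pow, hrest]
      simp [fiberA, hres]
    · rw [map_mul, map_pow, hrest, map_neg, map_ofNat]
      simp [fiberB, hres]

/-- The Euler factor of `E_d` at a finite place. -/
theorem exists_eulerPolynomial_finite [Fintype F] (h2 : (2 : F) ≠ 0) {d : ℕ} (hd : d ≠ 0)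
    (L : Type*) [Field L] [IsAlgClosed L] [CharZero L] :
    ∃ α β : L, (eulerPolynomial (curve F d) (Place.finite P hm hi)).map (Int.castRingHom L) =
      (1 - C α * X ^ P.natDegree) * (1 - C β * X ^ P.natDegree) ∧
      ∀ (K : Type*) [Field K] [Fintype K] [Algebra F K] (τ : K), minpoly F τ = P →
        (cubicTrace (fiberA d τ) (fiberB d τ) : L) =
          α ^ (Module.finrank F K / P.natDegree) + β ^ (Module.finrank F K / P.natDegree) := by
  have hfin := finite_residueField hm hi
  let _ : Fintype (IsLocalRing.ResidueField (Place.finite P hm hi).ring) := Fintype.ofFinite _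
  obtain ⟨u, a₀, b₀, ha, hb, hΔ, hmin, hra, hrb⟩ := exists_model_finite hm hi h2 hd
  have hR2 := isUnit_two_ring hm hi h2
  obtain ⟨h1, h3⟩ := reduction_minimal hR2 u a₀ b₀ ha hb hΔ hmin
  have hchar : ringChar (IsLocalRing.ResidueField (Place.finite P hm hi).ring) ≠ 2 := by
    intro h
    have h4 := (hR2.map (IsLocalRing.residue _)).ne_zero
    have h5 := CharP.cast_eq_zero (IsLocalRing.ResidueField (Place.finite P hm hi).ring)
        (ringChar (IsLocalRing.ResidueField (Place.finite P hm hi).ring))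
    rw [h] at h5
    rw [map_ofNat] at h4
    exact h4 (by exact_mod_cast h5)
  obtain ⟨α, β, hs, hp, hext⟩ := exists_cubicTrace_extension L hchar
    (IsLocalRing.residue _ a₀) (IsLocalRing.residue _ b₀)
  refine ⟨α, β, eulerPolynomial_eq (curve F d) (Place.finite P hm hi) h1 h3 hs hp, ?_⟩
  intro K _ _ _ τ hτ
  -- A root `τ` of `P` embeds the residue field in `K` by `t ↦ τ`, so the extension formula for
  -- traces applies to the fibre at `τ`.
  let _ : Algebra (IsLocalRing.ResidueField (Place.finite P hm hi).ring) K :=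
    (residueLift hm hi hτ).toAlgebra
  have hal : ∀ x, algebraMap (IsLocalRing.ResidueField (Place.finite P hm hi).ring) K x =
    residueLift hm hi hτ x := fun _ => rfl
  have hext' := hext K
  rw [hal, hal, hra, hrb, map_fiberA, map_fiberB, residueLift_polyResidue, aeval_X] at hext'
  have hrank : Module.finrank (IsLocalRing.ResidueField (Place.finite P hm hi).ring) K =
      Module.finrank F K / P.natDegree := by
    have e1 := Module.natCard_eq_pow_finrank (K := F) (V := K)
    rw [Module.natCard_eq_pow_finrank
      (K := IsLocalRing.ResidueField (Place.finite P hm hi).ring) (V := K),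
      natCard_residueField, ← pow_mul] at e1
    have e2 := Nat.pow_right_injective (Finite.one_lt_card (α := F)) e1
    rw [← e2, Nat.mul_div_cancel_left _ hi.natDegree_pos]
  rw [hext', hrank]

end FinitePlace

section InfinitePlace

variable {F : Type*} [Field F] [Fintype F]

/-- The Euler factor of `E_d` at infinity. -/
theorem eulerPolynomial_infinite (h2 : (2 : F) ≠ 0) {d : ℕ} (hd : d ≠ 0)
    (L : Type*) [Field L] : (eulerPolynomial (curve F d) Place.infinite).map (Int.castRingHom L) =
      (1 - C 1 * X) * (1 - C 0 * X) := by
  set R := (Place.infinite : Place F).ring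
  have hfin : Finite (IsLocalRing.ResidueField R) :=
    Finite.of_surjective _ (residue_constToRing_surjective (F := F))
  let _ : Fintype (IsLocalRing.ResidueField R) := Fintype.ofFinite _
  have h2R : IsUnit (2 : R) := by
    rw [← map_ofNat (constToRing (F := F)) 2]
    exact (Ne.isUnit h2).map _
  have hw : IsLocalRing.residue R (invX ^ (2 * d)) = 0 := by
    rw [map_pow, residue_invX, zero_pow (by omega)]
  have hunit : ∀ n : R, IsUnit (1 + n * invX ^ (2 * d)) := by
    intro n
    rw [← IsLocalRing.residue_ne_zero_iff_isUnit, map_add, map_mul, hw, mul_zero, add_zero, map_one]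
    exact one_ne_zero
  have h4R : IsUnit (4 : R) := by
    rw [show (4 : R) = 2 * 2 by norm_num]
    exact h2R.mul h2R
  have hX : (RatFunc.X : RatFunc F) ≠ 0 := RatFunc.X_ne_zero
  have hinv : algebraMap R (RatFunc F) invX = RatFunc.X⁻¹ := rfl
  have hinv0 : (invX : R) ≠ 0 := fun h => inv_ne_zero hX (congrArg Subtype.val h)
  -- Scaling by `t ^ d` gives `a₀ = 1` and `b₀ = -4 t ^ (-2 d)`, with `c₄` a unit. The reduction `y
  -- ^ 2 = x ^ 2 (x + 1)` is a node of trace `λ(1) = 1`.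
  obtain ⟨h1, h3⟩ := reduction_minimal (K := RatFunc F) h2R (a := RatFunc.X ^ (2 * d))
    (b := -4 * RatFunc.X ^ (2 * d)) (Units.mk0 _ (pow_ne_zero d hX)) (1 : R)
    (-4 * invX ^ (2 * d)) (by rw [Units.val_mk0, map_one]; ring) (by
      rw [Units.val_mk0, map_mul, map_neg, map_ofNat, map_pow, hinv]
      have h : (RatFunc.X ^ d : RatFunc F) ^ 4 * (RatFunc.X⁻¹) ^ (2 * d) = RatFunc.X ^ (2 * d) := by
        rw [inv_pow, show (RatFunc.X ^ d : RatFunc F) ^ 4 = RatFunc.X ^ (2 * d) * RatFunc.X ^ (2 * d)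
          by ring, mul_assoc, mul_inv_cancel₀ (pow_ne_zero _ hX), mul_one]
      rw [mul_left_comm, h]) (by
      refine mul_ne_zero (mul_ne_zero h4R.neg.ne_zero (pow_ne_zero _ hinv0)) ?_
      rw [show (1 : R) ^ 2 - 4 * (-4 * invX ^ (2 * d)) = 1 + 16 * invX ^ (2 * d) by ring]
      exact (hunit 16).ne_zero) (by
      intro w _ h
      refine (isUnit_pow_iff (n := 4) (by norm_num)).mp (isUnit_of_dvd_unit h ?_)
      rw [show (1 : R) ^ 2 - 3 * (-4 * invX ^ (2 * d)) = 1 + 12 * invX ^ (2 * d) by ring]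
      exact hunit 12)
  have hb0 : IsLocalRing.residue R (-4 * invX ^ (2 * d)) = 0 := by rw [map_mul, hw, mul_zero]
  have hchar : ringChar (IsLocalRing.ResidueField R) ≠ 2 := by
    intro h
    have h4 := (h2R.map (IsLocalRing.residue _)).ne_zero
    have h5 := CharP.cast_eq_zero (IsLocalRing.ResidueField R)
        (ringChar (IsLocalRing.ResidueField R))
    rw [h] at h5
    rw [map_ofNat] at h4
    exact h4 (by exact_mod_cast h5)
  rw [hb0] at h1 h3
  rw [eulerPolynomial_eq (curve F d) Place.infinite h1 h3 (α := (1 : L)) (β := 0) (by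
    rw [cubicTrace_zero_right hchar, map_one]
    simp) (by simp)]
  simp [Place.degree]

end InfinitePlace

end GriffonRank

end

noncomputable section

open Polynomial

namespace GriffonRank

/-! ### Characters of a finite field indexed by `ℤ / D` -/

section IndexedChar

variable {K : Type*} [Field K] {L : Type*} [Field L]

/-- The character `x ↦ ω(x) ^ (N n / D)`, where `N` is the order of `Kˣ`. -/
def indexedChar (ω : Kˣ →* Lˣ) (N D : ℕ) (n : ZMod D) : MulChar K L :=
  MulChar.ofUnitHom (ω ^ (N * n.val / D))

variable {ω : Kˣ →* Lˣ} {N D : ℕ}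

theorem unitHom_pow_eq_one (hN : Nat.card Kˣ = N) (x : Kˣ) : ω x ^ N = 1 := by
  rw [← map_pow, ← hN, pow_card_eq_one', map_one]

theorem indexedChar_apply (n : ZMod D) (x : Kˣ) :
    indexedChar ω N D n x = ((ω x ^ (N * n.val / D) : Lˣ) : L) := by
  rw [indexedChar, MulChar.ofUnitHom_coe]
  rfl

theorem dvd_mul_iff_cast (a : ℕ) : D ∣ N * a ↔ (N : ZMod D) * (a : ZMod D) = 0 := by
  rw [← Nat.cast_mul, ZMod.natCast_eq_zero_iff]

theorem indexedChar_zero : indexedChar ω N D 0 = 1 := by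
  ext x
  rw [indexedChar_apply, ZMod.val_zero, mul_zero, Nat.zero_div, pow_zero, MulChar.one_apply_coe,
    Units.val_one]

variable [NeZero D]

theorem dvd_mul_val_iff (n : ZMod D) : D ∣ N * n.val ↔ (N : ZMod D) * n = 0 := by
  rw [dvd_mul_iff_cast, ZMod.natCast_zmod_val]

/-- Changing the representative by a multiple of `D` changes the exponent by a multiple of `N`,
whether or not the division is exact. -/
theorem indexedChar_natCast_apply (hN : Nat.card Kˣ = N) (a : ℕ) (x : Kˣ) :
    indexedChar ω N D (a : ZMod D) x = ((ω x ^ (N * a / D) : Lˣ) : L) := by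
  have hD : 0 < D := Nat.pos_of_ne_zero (NeZero.ne D)
  rw [indexedChar_apply, ZMod.val_natCast]
  congr 1
  have h1 : N * a = N * (a % D) + D * (N * (a / D)) := by
    conv_lhs => rw [← Nat.mod_add_div a D]
    ring
  rw [h1, Nat.add_mul_div_left _ _ hD, pow_add, pow_mul, unitHom_pow_eq_one hN, one_pow, mul_one]

theorem indexedChar_add (hN : Nat.card Kˣ = N) {m : ZMod D} (hm : (N : ZMod D) * m = 0)
    (n : ZMod D) :
    indexedChar ω N D (m + n) = indexedChar ω N D m * indexedChar ω N D n := by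
  rw [← dvd_mul_val_iff] at hm
  ext x
  have h : m + n = ((m.val + n.val : ℕ) : ZMod D) := by simp
  rw [h, indexedChar_natCast_apply hN, MulChar.mul_apply,
    indexedChar_apply, indexedChar_apply, mul_add, Nat.add_div_of_dvd_right hm, pow_add,
    Units.val_mul]

theorem indexedChar_neg (hN : Nat.card Kˣ = N) {n : ZMod D} (hn : (N : ZMod D) * n = 0) :
    indexedChar ω N D (-n) = (indexedChar ω N D n)⁻¹ := by
  rw [eq_inv_iff_mul_eq_one, ← indexedChar_add hN (by rw [mul_neg, hn, neg_zero]),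
    neg_add_cancel, indexedChar_zero]

variable [Finite K]

/-- Evaluated at a generator of the cyclic group: the exponent `N n / D` lies strictly between `0`
and `N`. -/
theorem indexedChar_ne_one (hω : Function.Injective ω) (hN : Nat.card Kˣ = N) {n : ZMod D}
    (hn : (N : ZMod D) * n = 0) (hn0 : n ≠ 0) : indexedChar ω N D n ≠ 1 := by
  intro h
  have hD : 0 < D := Nat.pos_of_ne_zero (NeZero.ne D)
  obtain ⟨g, hg⟩ := IsCyclic.exists_ofOrder_eq_natCard (α := Kˣ)
  rw [hN] at hg
  have hNpos : 0 < N := by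
    rw [← hN]
    exact Nat.card_pos
  have h1 := congrArg (fun χ : MulChar K L => χ g) h
  simp only [indexedChar_apply, MulChar.one_apply_coe, Units.val_eq_one, ← map_pow] at h1
  rw [map_eq_one_iff ω hω, ← orderOf_dvd_iff_pow_eq_one, hg] at h1
  rw [← dvd_mul_val_iff] at hn
  obtain ⟨c, hc⟩ := hn
  rw [hc, Nat.mul_div_cancel_left _ hD] at h1
  have hv : n.val ≠ 0 := by rwa [Ne, ZMod.val_eq_zero]
  have hlt : n.val < D := ZMod.val_lt n
  have hc0 : 0 < c := by
    rcases Nat.eq_zero_or_pos c with h0 | h0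
    · rw [h0, mul_zero] at hc
      exact absurd hc (mul_ne_zero hNpos.ne' hv)
    · exact h0
  have h2 := Nat.le_of_dvd hc0 h1
  nlinarith

/-- Both cardinalities are `gcd(N, D)`, one in the cyclic group `Kˣ`, the other in `ℤ / D`. -/
theorem card_pow_eq_one (hN : Nat.card Kˣ = N) :
    Nat.card {x : Kˣ // x ^ D = 1} = Nat.card {n : ZMod D // (N : ZMod D) * n = 0} := by
  have h1 := IsCyclic.card_powMonoidHom_ker (G := Kˣ) D
  have h2 := IsAddCyclic.card_nsmulAddMonoidHom_ker (G := ZMod D) N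
  rw [hN] at h1
  rw [Nat.card_zmod, Nat.gcd_comm, ← h1] at h2
  have h3 : Nat.card {n : ZMod D // (N : ZMod D) * n = 0} =
      Nat.card (nsmulAddMonoidHom (α := ZMod D) N).ker :=
    Nat.card_congr (Equiv.subtypeEquivRight fun n => by
      rw [AddMonoidHom.mem_ker, nsmulAddMonoidHom_apply, nsmul_eq_mul])
  rw [h3, h2]
  exact Nat.card_congr (Equiv.subtypeEquivRight fun n => by
      rw [MonoidHom.mem_ker, powMonoidHom_apply])

/-- If `s = g ^ b` for a generator `g`, the hypothesis says that `gcd(N, D) ∣ b`, and Bézout writes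
`b` as a multiple of `D` modulo `N`. -/
theorem exists_pow_eq_of_pow_eq_one {D : ℕ} (hN : Nat.card Kˣ = N) {s : Kˣ}
    (hs : s ^ (N / N.gcd D) = 1) : ∃ x : Kˣ, x ^ D = s := by
  obtain ⟨g, hg⟩ := IsCyclic.exists_generator (α := Kˣ)
  have hNpos : 0 < N := by
    rw [← hN]
    exact Nat.card_pos
  have hgo : orderOf g = N := by rw [orderOf_eq_card_of_forall_mem_zpowers hg, hN]
  obtain ⟨b, rfl⟩ := Subgroup.mem_zpowers_iff.mp (hg s)
  obtain ⟨c, hc⟩ := Nat.gcd_dvd_left N D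
  have hgpos : 0 < N.gcd D := Nat.gcd_pos_of_pos_left _ hNpos
  have hc0 : 0 < c := by
    rcases Nat.eq_zero_or_pos c with h | h
    · rw [h, mul_zero] at hc
      omega
    · exact h
  have hdiv : N / N.gcd D = c := Nat.div_eq_of_eq_mul_right hgpos hc
  rw [hdiv, ← zpow_natCast, ← zpow_mul, ← orderOf_dvd_iff_zpow_eq_one, hgo, hc] at hs
  push_cast at hs
  have hb : ((N.gcd D : ℕ) : ℤ) ∣ b := by
    obtain ⟨e, he⟩ := hs
    refine ⟨e, mul_right_cancel₀ (b := (c : ℤ)) (by exact_mod_cast hc0.ne') ?_⟩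
    rw [he]
    ring
  obtain ⟨e, he⟩ := hb
  rw [Nat.gcd_eq_gcd_ab] at he
  refine ⟨g ^ (N.gcdB D * e), ?_⟩
  rw [← zpow_natCast, ← zpow_mul, he]
  have h1 : ((N : ℤ) * N.gcdA D + D * N.gcdB D) * e =
    N * (N.gcdA D * e) + N.gcdB D * e * D := by ring
  rw [h1, zpow_add, zpow_mul g (N : ℤ), zpow_natCast, ← hgo, pow_orderOf_eq_one, one_zpow, one_mul]

variable [Fintype K]

open scoped Classical in
/-- The number of solutions of `x ^ D = s` as a sum of characters. -/
theorem sum_indexedChar (hω : Function.Injective ω) (hN : Nat.card Kˣ = N) (s : Kˣ) :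
    ∑ n : ZMod D with (N : ZMod D) * n = 0, indexedChar ω N D n s =
      (Finset.univ.filter fun x : Kˣ => x ^ D = s).card := by
  have hD : 0 < D := Nat.pos_of_ne_zero (NeZero.ne D)
  by_cases hs : ∃ x : Kˣ, x ^ D = s
  · obtain ⟨y, rfl⟩ := hs
    have h1 : ∀ n ∈ Finset.univ.filter (fun n : ZMod D => (N : ZMod D) * n = 0),
        indexedChar ω N D n ((y ^ D : Kˣ) : K) = 1 := by
      intro n hn
      have hn := (Finset.mem_filter.mp hn).2
      rw [← dvd_mul_val_iff] at hn
      rw [indexedChar_apply, map_pow, ← pow_mul, Nat.mul_div_cancel' hn, pow_mul,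
        unitHom_pow_eq_one hN, one_pow, Units.val_one]
    rw [Finset.sum_congr rfl h1, Finset.sum_const, nsmul_eq_mul, mul_one]
    congr 1
    have h2 := card_pow_eq_one (K := K) (D := D) hN
    rw [Nat.card_eq_fintype_card, Nat.card_eq_fintype_card, Fintype.card_subtype,
      Fintype.card_subtype] at h2
    rw [← h2]
    refine Finset.card_equiv (Equiv.mulLeft y) fun x => ?_
    simp [mul_pow]
  · have h0 : (Finset.univ.filter fun x : Kˣ => x ^ D = s) = ∅ := by
      rw [Finset.filter_eq_empty_iff]
      exact fun x _ hx => hs ⟨x, hx⟩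
    rw [h0, Finset.card_empty, Nat.cast_zero]
    have he : D / N.gcd D * N.gcd D = D := Nat.div_mul_cancel (Nat.gcd_dvd_right N D)
    have he' : N / N.gcd D * N.gcd D = N := Nat.div_mul_cancel (Nat.gcd_dvd_left N D)
    have heq : N * (D / N.gcd D) = D * (N / N.gcd D) := by
      calc N * (D / N.gcd D) = N / N.gcd D * N.gcd D * (D / N.gcd D) := by rw [he']
        _ = D / N.gcd D * N.gcd D * (N / N.gcd D) := by ring
        _ = D * (N / N.gcd D) := by rw [he]
    have hn0 : (N : ZMod D) * ((D / N.gcd D : ℕ) : ZMod D) = 0 :=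
      (dvd_mul_iff_cast _).mp (heq ▸ dvd_mul_right _ _)
    -- The character of index `D / gcd(N, D)` is `ω ^ (N / gcd(N, D))`, which detects `D`-th powers.
    -- Translating the sum by this index multiplies it by a number other than `1`, so it vanishes.
    have hne : indexedChar ω N D ((D / N.gcd D : ℕ) : ZMod D) s ≠ 1 := by
      rw [indexedChar_natCast_apply hN, heq,
        Nat.mul_div_cancel_left _ hD, Ne, Units.val_eq_one, ← map_pow, map_eq_one_iff ω hω]
      exact fun h => hs (exists_pow_eq_of_pow_eq_one hN h)
    have hshift : ∑ n : ZMod D with (N : ZMod D) * n = 0, indexedChar ω N D n s =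
        indexedChar ω N D ((D / N.gcd D : ℕ) : ZMod D) s *
          ∑ n : ZMod D with (N : ZMod D) * n = 0, indexedChar ω N D n s := by
      rw [Finset.mul_sum]
      symm
      refine Finset.sum_equiv (Equiv.addLeft ((D / N.gcd D : ℕ) : ZMod D)) (fun n => ?_) fun n hn => ?_
      · simp [mul_add, hn0]
      · rw [Equiv.coe_addLeft, indexedChar_add hN hn0,
          MulChar.mul_apply]
    by_contra h
    exact hne (mul_right_cancel₀ h (by rw [one_mul]; exact hshift.symm))

end IndexedChar

end GriffonRank

end

noncomputable section

open Polynomial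

namespace GriffonRank

/-! ### The sum of the traces of the fibres -/

section FiberSum

variable {K : Type*} [Field K] [Fintype K] {L : Type*} [Field L]
  {ω : Kˣ →* Lˣ} {N : ℕ}

theorem card_eq_succ (hN : Nat.card Kˣ = N) : Fintype.card K = N + 1 := by
  have h1 := Nat.card_units K
  have h2 := Finite.one_lt_card (α := K)
  rw [← Nat.card_eq_fintype_card]
  omega

theorem even_of_card_units (hK : ringChar K ≠ 2) (hN : Nat.card Kˣ = N) : 2 ∣ N := by
  have h1 := FiniteField.odd_card_of_char_ne_two hK
  rw [card_eq_succ hN] at h1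
  omega

/-- The exponent is `N / 2`, and Euler's criterion identifies the resulting sign. -/
theorem indexedChar_half (hK : ringChar K ≠ 2) (hω : Function.Injective ω)
    (hN : Nat.card Kˣ = N) {d : ℕ} [NeZero d] :
    indexedChar ω N (2 * d) (d : ZMod (2 * d)) = quadChar K L := by
  classical
  obtain ⟨M, rfl⟩ := even_of_card_units hK hN
  have hd : 0 < d := Nat.pos_of_ne_zero (NeZero.ne d)
  have hdiv : 2 * M * d / (2 * d) = M :=
    Nat.div_eq_of_eq_mul_right (by positivity) (by ring)
  ext x
  have hcard : Fintype.card K / 2 = M := by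
    rw [card_eq_succ hN]
    omega
  rw [indexedChar_natCast_apply hN, hdiv, quadChar_apply]
  by_cases hx : x ^ M = 1
  · have h1 : quadraticChar K (x : K) = 1 := by
      rw [quadraticChar_one_iff_isSquare x.ne_zero, FiniteField.isSquare_iff hK x.ne_zero, hcard,
        ← Units.val_pow_eq_pow_val, hx, Units.val_one]
    rw [← map_pow, hx, h1]
    simp
  · have h1 : quadraticChar K (x : K) = -1 := by
      rw [quadraticChar_neg_one_iff_not_isSquare, FiniteField.isSquare_iff hK x.ne_zero, hcard,
        ← Units.val_pow_eq_pow_val, Units.val_eq_one]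
      exact hx
    have h2 : ((ω x ^ M : Lˣ) : L) ^ 2 = 1 := by
      rw [← Units.val_pow_eq_pow_val, ← pow_mul, mul_comm, unitHom_pow_eq_one hN, Units.val_one]
    have h3 : ((ω x ^ M : Lˣ) : L) ≠ 1 := by
      rw [Ne, Units.val_eq_one, ← map_pow, map_eq_one_iff ω hω]
      exact hx
    rw [h1, (mul_self_eq_one_iff.mp ((sq _).symm.trans h2)).resolve_left h3]
    simp

variable [CharZero L]

open scoped Classical

/-- The fibre depends on `s = τ ^ (2 d)` only, and the number of `τ` over `s` is a sum of
characters. Exchanging the sums leaves the twisted cubic sums; index `0` gives the cardinality of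
the field. -/
theorem sum_fiber_ne_zero (hK : ringChar K ≠ 2) (hω : Function.Injective ω)
    (hN : Nat.card Kˣ = N) {d : ℕ} [NeZero d] :
    ∑ τ : Kˣ, (cubicTrace (fiberA d (τ : K)) (fiberB d (τ : K)) : L) =
      -(Fintype.card K : L) - ∑ n : ZMod (2 * d) with (N : ZMod (2 * d)) * n = 0 ∧ n ≠ 0,
        jacobiProduct (indexedChar ω N (2 * d) n) := by
  have h1 : ∀ τ : Kˣ, (cubicTrace (fiberA d (τ : K)) (fiberB d (τ : K)) : L) =
      (cubicTrace ((τ ^ (2 * d) : Kˣ) : K) (-4 * ((τ ^ (2 * d) : Kˣ) : K)) : L) := by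
    intro τ
    rw [fiberA, fiberB, if_neg τ.ne_zero, if_neg τ.ne_zero, Units.val_pow_eq_pow_val]
  have h2 : ∀ s : K, (cubicTrace s (-4 * s) : L) =
      -∑ x : K, quadChar K L (x * (x ^ 2 + s * x + -4 * s)) := by
    intro s
    rw [cubicTrace]
    push_cast
    rfl
  rw [Finset.sum_congr rfl fun τ _ => h1 τ, ← Finset.sum_fiberwise (s := Finset.univ)
    (g := fun τ : Kˣ => τ ^ (2 * d))]
  have h3 : ∀ s : Kˣ, ∑ τ : Kˣ with τ ^ (2 * d) = s,
      (cubicTrace ((τ ^ (2 * d) : Kˣ) : K) (-4 * ((τ ^ (2 * d) : Kˣ) : K)) : L) =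
      ∑ n : ZMod (2 * d) with (N : ZMod (2 * d)) * n = 0,
        indexedChar ω N (2 * d) n s * (cubicTrace (s : K) (-4 * (s : K)) : L) := by
    intro s
    rw [← Finset.sum_mul, sum_indexedChar hω hN, ← nsmul_eq_mul, ← Finset.sum_const]
    refine Finset.sum_congr rfl fun τ hτ => ?_
    rw [(Finset.mem_filter.mp hτ).2]
  rw [Finset.sum_congr rfl fun s _ => h3 s, Finset.sum_comm]
  have h4 : ∀ χ : MulChar K L, ∑ s : Kˣ, χ s * (cubicTrace (s : K) (-4 * (s : K)) : L) =
      -∑ s : K, χ s * ∑ x : K, quadChar K L (x * (x ^ 2 + s * x + -4 * s)) := by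
    intro χ
    rw [← Finset.sum_neg_distrib, ← Finset.add_sum_erase _ _ (Finset.mem_univ (0 : K)),
      MulChar.map_zero, zero_mul, neg_zero, zero_add]
    refine Finset.sum_bij (fun s _ => (s : K)) (fun s _ => by simp)
      (fun s _ s' _ h => Units.ext h) (fun x hx => ⟨Units.mk0 x (Finset.ne_of_mem_erase hx),
        Finset.mem_univ _, rfl⟩) fun s _ => ?_
    rw [h2, mul_neg]
  simp only [h4]
  rw [← Finset.add_sum_erase _ _ (a := (0 : ZMod (2 * d))) (by simp), indexedChar_zero, sum_untwisted_cubic hK, sub_eq_add_neg,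
    ← Finset.sum_neg_distrib]
  congr 1
  refine Finset.sum_congr (by ext; simp [and_comm]) fun n hn => ?_
  obtain ⟨-, h5, h6⟩ := Finset.mem_filter.mp hn
  rw [sum_twisted_cubic hK (indexedChar_ne_one hω hN h5 h6)]

theorem natCast_ne_of_lt {D a b : ℕ} (ha : a < b) (hb : b < D) : (a : ZMod D) ≠ b := by
  rw [Ne, ZMod.natCast_eq_natCast_iff', Nat.mod_eq_of_lt (ha.trans hb), Nat.mod_eq_of_lt hb]
  exact ha.ne

/-- The sum of the traces over all the fibres of the family. -/
theorem sum_fiber (hK : ringChar K ≠ 2) (hω : Function.Injective ω)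
    (hN : Nat.card Kˣ = N) {d : ℕ} [NeZero d] :
    ∑ τ : K, (cubicTrace (fiberA d τ) (fiberB d τ) : L) =
      -(Fintype.card K : L) - 1 -
        ∑ n : ZMod (2 * d) with (N : ZMod (2 * d)) * n = 0 ∧ n ∈ indexSet d,
          jacobiProduct (indexedChar ω N (2 * d) n) := by
  have hd : 0 < d := Nat.pos_of_ne_zero (NeZero.ne d)
  have h2N := even_of_card_units hK hN
  have hdS : (N : ZMod (2 * d)) * (d : ZMod (2 * d)) = 0 :=
    (dvd_mul_iff_cast d).mp (mul_dvd_mul_right h2N d)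
  have hd0 : (d : ZMod (2 * d)) ≠ 0 := by
    have := natCast_ne_of_lt hd (show d < 2 * d by omega)
    rw [Nat.cast_zero] at this
    exact this.symm
  have hsplit : ∑ τ : K, (cubicTrace (fiberA d τ) (fiberB d τ) : L) =
      (cubicTrace (fiberA d (0 : K)) (fiberB d (0 : K)) : L) +
        ∑ τ : Kˣ, (cubicTrace (fiberA d (τ : K)) (fiberB d (τ : K)) : L) := by
    rw [← Finset.add_sum_erase _ _ (Finset.mem_univ (0 : K))]
    congr 1
    symm
    exact Finset.sum_bij (fun s _ => (s : K)) (fun s _ => by simp)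
      (fun s _ s' _ h => Units.ext h) (fun x hx => ⟨Units.mk0 x (Finset.ne_of_mem_erase hx),
        Finset.mem_univ _, rfl⟩) fun s _ => rfl
  rw [hsplit, sum_fiber_ne_zero hK hω hN]
  have hmemd : (d : ZMod (2 * d)) ∈
      Finset.univ.filter fun n : ZMod (2 * d) => (N : ZMod (2 * d)) * n = 0 ∧ n ≠ 0 := by
    simp [hdS, hd0]
  rw [← Finset.add_sum_erase _ _ hmemd, indexedChar_half hK hω hN, jacobiProduct_quadChar hK]
  by_cases hev : Even d
  · have hA : fiberA d (0 : K) = 0 := if_pos rfl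
    have hB : fiberB d (0 : K) = -4 := by rw [fiberB, if_pos rfl, if_pos hev]
    rw [hA, hB]
    obtain ⟨e, he⟩ := hev.two_dvd
    have he2 : d / 2 = e := by omega
    have hZ : indexSet d = {0, (e : ZMod (2 * d)), (d : ZMod (2 * d)),
        ((3 * e : ℕ) : ZMod (2 * d))}ᶜ := by rw [indexSet, if_pos hev, he2]
    have hmem : ∀ n : ZMod (2 * d), n ∈ indexSet d ↔
        n ≠ 0 ∧ n ≠ (e : ZMod (2 * d)) ∧ n ≠ (d : ZMod (2 * d)) ∧
          n ≠ ((3 * e : ℕ) : ZMod (2 * d)) := by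
      intro n
      rw [hZ]
      simp
    have hiff : ∀ c : ℕ, Odd c →
        ((N : ZMod (2 * d)) * ((c * e : ℕ) : ZMod (2 * d)) = 0 ↔ 4 ∣ N) := by
      intro c hc
      rw [← dvd_mul_iff_cast, he, show 2 * (2 * e) = 4 * e by ring, ← mul_assoc,
        Nat.mul_dvd_mul_iff_right (by omega)]
      refine ⟨fun h => ?_, fun h => h.mul_right c⟩
      refine Nat.Coprime.dvd_of_dvd_mul_right ?_ h
      rw [show 4 = 2 ^ 2 by norm_num]
      exact Nat.Coprime.pow_left 2 (Nat.coprime_two_left.mpr hc)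
    have h1 := hiff 1 odd_one
    have h3 := hiff 3 (by decide)
    rw [one_mul] at h1
    -- If `4 ∣ N` the indices `d / 2` and `3 d / 2` belong to the sum, are inverse characters of
    -- square `λ`, and cancel the fibre at `0`. Otherwise they do not occur, the field has `3`
    -- modulo `4` elements, and that fibre has trace zero.
    by_cases h4 : 4 ∣ N
    · have hsq : (indexedChar ω N (2 * d) (e : ZMod (2 * d))) ^ 2 = quadChar K L := by
        rw [sq, ← indexedChar_add hN (h1.mpr h4), ← indexedChar_half hK hω hN (d := d), ← Nat.cast_add]
        congr 2
        omega
      have hinv : (indexedChar ω N (2 * d) (e : ZMod (2 * d)))⁻¹ =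
          indexedChar ω N (2 * d) ((3 * e : ℕ) : ZMod (2 * d)) := by
        rw [← indexedChar_neg hN (h1.mpr h4)]
        congr 1
        rw [neg_eq_iff_add_eq_zero, ← Nat.cast_add, ZMod.natCast_eq_zero_iff]
        exact ⟨1, by omega⟩
      rw [cubicTrace_zero_neg_four hK hsq, hinv]
      have e0 : (0 : ZMod (2 * d)) ≠ e := by
        simpa using natCast_ne_of_lt (a := 0) (show 0 < e by omega) (show e < 2 * d by omega)
      have e1 : (e : ZMod (2 * d)) ≠ d := natCast_ne_of_lt (by omega) (by omega)
      have e2 : (d : ZMod (2 * d)) ≠ ((3 * e : ℕ) : ZMod (2 * d)) :=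
        natCast_ne_of_lt (by omega) (by omega)
      have e3 : (e : ZMod (2 * d)) ≠ ((3 * e : ℕ) : ZMod (2 * d)) :=
        natCast_ne_of_lt (by omega) (by omega)
      have e4 : (0 : ZMod (2 * d)) ≠ ((3 * e : ℕ) : ZMod (2 * d)) := by
        simpa using natCast_ne_of_lt (a := 0) (show 0 < 3 * e by omega)
          (show 3 * e < 2 * d by omega)
      rw [← Finset.add_sum_erase _ _ (a := (e : ZMod (2 * d)))
        (by simp [e1, e0.symm, h1.mpr h4]),
        ← Finset.add_sum_erase _ _ (a := ((3 * e : ℕ) : ZMod (2 * d))) (by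
          simp only [Finset.mem_erase, Finset.mem_filter, Finset.mem_univ, true_and]
          exact ⟨e3.symm, e2.symm, h3.mpr h4, e4.symm⟩)]
      have hset : ((((Finset.univ.filter fun n : ZMod (2 * d) =>
          (N : ZMod (2 * d)) * n = 0 ∧ n ≠ 0).erase (d : ZMod (2 * d))).erase
          (e : ZMod (2 * d))).erase ((3 * e : ℕ) : ZMod (2 * d))) =
          Finset.univ.filter fun n : ZMod (2 * d) => (N : ZMod (2 * d)) * n = 0 ∧ n ∈ indexSet d := by
        ext n
        simp only [Finset.mem_erase, Finset.mem_filter, Finset.mem_univ, true_and, hmem]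
        tauto
      rw [hset]
      ring
    · have hcard : Fintype.card K % 4 = 3 := by
        rw [card_eq_succ hN]
        omega
      have hset : ((Finset.univ.filter fun n : ZMod (2 * d) =>
          (N : ZMod (2 * d)) * n = 0 ∧ n ≠ 0).erase (d : ZMod (2 * d))) =
          Finset.univ.filter fun n : ZMod (2 * d) => (N : ZMod (2 * d)) * n = 0 ∧ n ∈ indexSet d := by
        ext n
        simp only [Finset.mem_erase, Finset.mem_filter, Finset.mem_univ, true_and, hmem]
        refine ⟨fun ⟨g1, g2, g3⟩ => ⟨g2, g3, ?_, g1, ?_⟩, fun ⟨g1, g2, _, g3, _⟩ => ⟨g3, g1, g2⟩⟩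
        · rintro rfl
          exact h4 (h1.mp g2)
        · rintro rfl
          exact h4 (h3.mp g2)
      rw [cubicTrace_zero_eq_zero hcard, hset]
      push_cast
      ring
  · have hA : fiberA d (0 : K) = 0 := if_pos rfl
    have hB : fiberB d (0 : K) = 0 := by rw [fiberB, if_pos rfl, if_neg hev]
    have hset : ((Finset.univ.filter fun n : ZMod (2 * d) =>
          (N : ZMod (2 * d)) * n = 0 ∧ n ≠ 0).erase (d : ZMod (2 * d))) =
          Finset.univ.filter fun n : ZMod (2 * d) => (N : ZMod (2 * d)) * n = 0 ∧ n ∈ indexSet d := by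
      ext n
      rw [indexSet, if_neg hev]
      simp only [Finset.mem_erase, Finset.mem_filter, Finset.mem_univ, true_and, Set.mem_compl_iff,
        Set.mem_insert_iff, Set.mem_singleton_iff]
      tauto
    rw [hA, hB, cubicTrace_zero_right hK, quadraticChar_zero, hset]
    push_cast
    ring

end FiberSum

end GriffonRank

end

noncomputable section

open Polynomial

namespace GriffonRank

/-! ### Orbits of multiplication by `q` -/

section OrbitLength

variable {q D : ℕ}

theorem iterate_mul_apply (n : ZMod D) (j : ℕ) :
    (fun x : ZMod D => (q : ZMod D) * x)^[j] n = (q : ZMod D) ^ j * n := by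
  rw [mul_left_iterate]

theorem isPeriodicPt_iff (n : ZMod D) (m : ℕ) :
    Function.IsPeriodicPt (fun x : ZMod D => (q : ZMod D) * x) m n ↔ (q : ZMod D) ^ m * n = n := by
  rw [Function.IsPeriodicPt, Function.IsFixedPt, iterate_mul_apply]

theorem exists_pow_mul_eq_self [NeZero D] (hq : q.Coprime D) :
    ∃ m : ℕ, 0 < m ∧ ∀ n : ZMod D, (q : ZMod D) ^ m * n = n := by
  refine ⟨D.totient, Nat.totient_pos.mpr (Nat.pos_of_ne_zero (NeZero.ne D)), fun n => ?_⟩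
  have h := congrArg Units.val (ZMod.pow_totient (ZMod.unitOfCoprime q hq))
  rw [Units.val_pow_eq_pow_val, ZMod.coe_unitOfCoprime, Units.val_one] at h
  rw [h, one_mul]

theorem ncard_qOrbit [NeZero D] (hq : q.Coprime D) (n : ZMod D) : (qOrbit q n).ncard =
    Function.minimalPeriod (fun x : ZMod D => (q : ZMod D) * x) n := by
  set g := fun x : ZMod D => (q : ZMod D) * x with hg
  obtain ⟨m, hm, h⟩ := exists_pow_mul_eq_self hq
  have hper : n ∈ Function.periodicPts g := ⟨m, hm, (isPeriodicPt_iff n m).mpr (h n)⟩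
  have hpos := Function.minimalPeriod_pos_of_mem_periodicPts hper
  have himg : qOrbit q n = (fun j => g^[j] n) '' Set.Iio (Function.minimalPeriod g n) := by
    ext x
    constructor
    · rintro ⟨j, rfl⟩
      refine ⟨j % Function.minimalPeriod g n, Nat.mod_lt _ hpos, ?_⟩
      change g^[j % Function.minimalPeriod g n] n = _
      rw [Function.iterate_mod_minimalPeriod_eq, iterate_mul_apply]
    · rintro ⟨j, -, rfl⟩
      exact ⟨j, (iterate_mul_apply n j).symm⟩
  rw [himg, Set.InjOn.ncard_image Function.iterate_injOn_Iio_minimalPeriod,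
    ← Finset.coe_Iio, Set.ncard_coe_finset, Nat.card_Iio]

theorem pow_mul_eq_self_iff [NeZero D] (hq : q.Coprime D) (n : ZMod D) (m : ℕ) :
    (q : ZMod D) ^ m * n = n ↔ (qOrbit q n).ncard ∣ m := by
  rw [ncard_qOrbit hq, ← isPeriodicPt_iff, Function.isPeriodicPt_iff_minimalPeriod_dvd]

theorem qOrbit_mul [NeZero D] (hq : q.Coprime D) (n : ZMod D) :
    qOrbit q ((q : ZMod D) * n) = qOrbit q n := by
  obtain ⟨m, hm, h⟩ := exists_pow_mul_eq_self hq
  ext x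
  constructor
  · rintro ⟨j, rfl⟩
    exact ⟨j + 1, by simp only [pow_succ, mul_assoc]⟩
  · rintro ⟨j, rfl⟩
    -- Orbits consist of forward iterates only; going once around a period of length `m` replaces
    -- the inverse of multiplication by `q`.
    refine ⟨j + m - 1, ?_⟩
    change (q : ZMod D) ^ (j + m - 1) * ((q : ZMod D) * n) = (q : ZMod D) ^ j * n
    rw [← mul_assoc, ← pow_succ, show j + m - 1 + 1 = j + m by omega, pow_add, mul_assoc, h]

theorem mem_qOrbit_self (n : ZMod D) : n ∈ qOrbit q n := ⟨0, by simp⟩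

theorem qOrbit_eq_of_mem [NeZero D] (hq : q.Coprime D) {n n' : ZMod D} (h : n' ∈ qOrbit q n) :
    qOrbit q n' = qOrbit q n := by
  obtain ⟨j, rfl⟩ := h
  change qOrbit q ((q : ZMod D) ^ j * n) = _
  induction j with
  | zero => simp
  | succ j ih => rw [pow_succ', mul_assoc, qOrbit_mul hq, ih]

/-- Links the condition that `n` indexes a genuine character of the field with `q ^ m` elements to
the periodicity of `n` under multiplication by `q`. -/
theorem sub_one_mul_eq_zero_iff (hq : q ≠ 0) (n : ZMod D) (m : ℕ) :
    ((q ^ m - 1 : ℕ) : ZMod D) * n = 0 ↔ (q : ZMod D) ^ m * n = n := by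
  rw [Nat.cast_sub (Nat.one_le_iff_ne_zero.mpr (pow_ne_zero m hq)), sub_mul, sub_eq_zero]
  simp

end OrbitLength

/-! ### The finite subfields of an algebraically closed field -/

section FiniteSubfield

variable {κ : Type*} [Field κ] {p : ℕ} [Fact p.Prime] [CharP κ p]

theorem mem_finiteSubfield {e : ℕ} {x : κ} : x ∈ finiteSubfield κ p e ↔ x ^ p ^ e = x := by
  rw [← iterateFrobenius_def p e x]
  rfl

theorem natCard_finiteSubfield [IsAlgClosed κ] {e : ℕ} (he : e ≠ 0) :
    Nat.card (finiteSubfield κ p e) = p ^ e := by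
  classical
  have hp := (Fact.out : p.Prime)
  have h1 : 1 < p ^ e := Nat.one_lt_pow he hp.one_lt
  have h0 : (X ^ (p ^ e) - X : κ[X]) ≠ 0 := FiniteField.X_pow_card_sub_X_ne_zero κ h1
  have h2 := card_rootSet_eq_natDegree (F := κ) (K := κ)
    (galois_poly_separable (K := κ) p (p ^ e) (dvd_pow_self p he)) (IsAlgClosed.splits _)
  rw [FiniteField.X_pow_card_sub_X_natDegree_eq κ h1] at h2
  rw [← h2, ← Nat.card_eq_fintype_card]
  refine Nat.card_congr (Equiv.subtypeEquivRight fun x => ?_)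
  rw [mem_finiteSubfield, mem_rootSet_of_ne h0]
  simp [sub_eq_zero]

theorem finiteSubfield_le {e e' : ℕ} (h : e ∣ e') : finiteSubfield κ p e ≤ finiteSubfield κ p e' := by
  obtain ⟨c, rfl⟩ := h
  intro x hx
  rw [mem_finiteSubfield] at hx ⊢
  induction c with
  | zero => simp
  | succ c ih => rw [mul_add, mul_one, pow_add, pow_mul, ih, hx]

theorem charP_finiteSubfield (e : ℕ) : CharP (finiteSubfield κ p e) p :=
  (finiteSubfield κ p e).subtype.charP (finiteSubfield κ p e).subtype_injective p

theorem ringChar_finiteSubfield (e : ℕ) : ringChar (finiteSubfield κ p e) = p :=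
  have := charP_finiteSubfield (κ := κ) (p := p) e
  ringChar.eq (finiteSubfield κ p e) p

end FiniteSubfield

/-! ### Jacobi sums over the finite subfields -/

section BetaAt

variable {κ : Type*} [Field κ] {p : ℕ} [Fact p.Prime] [CharP κ p] {L : Type*} [Field L]

/-- The restriction of a character of `κˣ` to a subfield. -/
def subfieldHom (t : κˣ →* Lˣ) (K : Subfield κ) : Kˣ →* Lˣ :=
  t.comp (Units.map (K.subtype : K →* κ))

theorem subfieldHom_injective {t : κˣ →* Lˣ} (ht : Function.Injective t) (K : Subfield κ) :
    Function.Injective (subfieldHom t K) :=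
  ht.comp (Units.map_injective K.subtype_injective)

/-- The Jacobi sums of the field with `(p ^ f) ^ m` elements attached to the characters of index
`n`. -/
def betaAt (p f d : ℕ) [Fact p.Prime] [CharP κ p] (t : κˣ →* Lˣ) (n : ZMod (2 * d)) (m : ℕ)
    [NeZero (f * m)] : L :=
  letI : Fintype (finiteSubfield κ p (f * m)) := Fintype.ofFinite _
  jacobiProduct (indexedChar (subfieldHom t (finiteSubfield κ p (f * m))) ((p ^ f) ^ m - 1) (2 * d) n)

/-- The isomorphism is an extension of degree one, so this is Hasse–Davenport with exponent `1`. -/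
theorem jacobiProduct_ringEquiv [CharZero L] {k K : Type*} [Field k] [Field K] [Fintype k]
    [Fintype K] (hk : ringChar k ≠ 2) (e : k ≃+* K) {χ : MulChar k L} {χ' : MulChar K L}
    (hχ' : χ' ≠ 1) (h : ∀ x, χ' (e x) = χ x) : jacobiProduct χ' = jacobiProduct χ := by
  have hχ : χ ≠ 1 := by
    rintro rfl
    refine hχ' (MulChar.ext fun u => ?_)
    obtain ⟨y, hy⟩ := e.surjective u
    have hy0 : y ≠ 0 := by
      rintro rfl
      exact u.ne_zero (by rw [← hy, map_zero])
    rw [← hy, h, MulChar.one_apply hy0.isUnit, hy, MulChar.one_apply_coe]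
  let _ : Algebra k K := e.toRingHom.toAlgebra
  have hrank : Module.finrank k K = 1 := by
    have h1 := Module.natCard_eq_pow_finrank (K := k) (V := K)
    rw [← Nat.card_congr e.toEquiv] at h1
    have h2 : (Nat.card k) ^ 1 = Nat.card k ^ Module.finrank k K := by rw [pow_one, ← h1]
    exact (Nat.pow_right_injective (Finite.one_lt_card (α := k)) h2).symm
  rw [jacobiProduct_extension hk hχ (χ' := χ'), hrank, pow_one]
  intro x
  obtain ⟨y, rfl⟩ := e.surjective x
  have h3 : Algebra.norm k (e y) = y := by
    have := Algebra.norm_algebraMap (S := K) y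
    rw [hrank, pow_one] at this
    exact this
  rw [h, h3]

variable [IsAlgClosed κ] {f d : ℕ} [NeZero d] {t : κˣ →* Lˣ}

theorem natCard_units_finiteSubfield (m : ℕ) [NeZero (f * m)] :
    Nat.card (finiteSubfield κ p (f * m))ˣ = (p ^ f) ^ m - 1 := by
  rw [Nat.card_units, natCard_finiteSubfield (NeZero.ne (f * m)), pow_mul]

/-- The Hasse–Davenport relation for the numbers `betaAt`. -/
theorem betaAt_of_dvd [CharZero L] (hp : p ≠ 2) (ht : Function.Injective t) {n : ZMod (2 * d)}
    (hn0 : n ≠ 0) {m m' : ℕ} [NeZero (f * m)] [NeZero (f * m')] (hm : m ∣ m')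
    (hn : (((p ^ f) ^ m - 1 : ℕ) : ZMod (2 * d)) * n = 0) :
    betaAt p f d t n m' = betaAt p f d t n m ^ (m' / m) := by
  let _ : Fintype (finiteSubfield κ p (f * m)) := Fintype.ofFinite _
  let _ : Fintype (finiteSubfield κ p (f * m')) := Fintype.ofFinite _
  let _ : Algebra (finiteSubfield κ p (f * m)) (finiteSubfield κ p (f * m')) :=
    (Subfield.inclusion (finiteSubfield_le (mul_dvd_mul_left f hm))).toAlgebra
  have hcard := natCard_finiteSubfield (κ := κ) (p := p) (NeZero.ne (f * m))
  have hcard' := natCard_finiteSubfield (κ := κ) (p := p) (NeZero.ne (f * m'))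
  have hm0 : m ≠ 0 := right_ne_zero_of_mul (NeZero.ne (f * m))
  have hf0 : f ≠ 0 := left_ne_zero_of_mul (NeZero.ne (f * m))
  have hq1 : 1 < p ^ f := Nat.one_lt_pow hf0 (Fact.out : p.Prime).one_lt
  obtain ⟨c, rfl⟩ := hm
  have hrank : Module.finrank (finiteSubfield κ p (f * m)) (finiteSubfield κ p (f * (m * c))) = c := by
    have h1 := Module.natCard_eq_pow_finrank (K := finiteSubfield κ p (f * m))
      (V := finiteSubfield κ p (f * (m * c)))
    rw [hcard, hcard', show p ^ (f * (m * c)) = (p ^ (f * m)) ^ c by ring] at h1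
    exact (Nat.pow_right_injective (Nat.one_lt_pow (NeZero.ne (f * m)) (Fact.out : p.Prime).one_lt)
      h1).symm
  have hk : ringChar (finiteSubfield κ p (f * m)) ≠ 2 := by rwa [ringChar_finiteSubfield]
  have hN := natCard_units_finiteSubfield (κ := κ) (p := p) (f := f) m
  have hχ := indexedChar_ne_one (subfieldHom_injective ht _) hN hn hn0
  have key : betaAt p f d t n (m * c) = betaAt p f d t n m ^
      Module.finrank (finiteSubfield κ p (f * m)) (finiteSubfield κ p (f * (m * c))) := by
    refine jacobiProduct_extension hk hχ fun x => ?_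
    by_cases hx : x = 0
    · rw [hx, Algebra.norm_zero, MulChar.map_zero, MulChar.map_zero]
    have hy : Algebra.norm (finiteSubfield κ p (f * m)) x ≠ 0 := by
      rwa [Ne, Algebra.norm_eq_zero_iff]
    set u := Units.mk0 x hx
    set w := Units.mk0 _ hy
    have hnorm := FiniteField.algebraMap_norm_eq_pow (K := finiteSubfield κ p (f * m)) (x := x)
    rw [hcard, hcard', pow_mul p f m, pow_mul p f (m * c)] at hnorm
    have hdvd : (p ^ f) ^ m - 1 ∣ (p ^ f) ^ (m * c) - 1 := by
      rw [pow_mul]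
      exact Nat.sub_one_dvd_pow_sub_one _ _
    obtain ⟨r, hr⟩ := hdvd
    have hNpos : 0 < (p ^ f) ^ m - 1 := Nat.sub_pos_of_lt (Nat.one_lt_pow hm0 hq1)
    rw [hr, Nat.mul_div_cancel_left _ hNpos] at hnorm
    -- The norm is the power with exponent `r = (q ^ (m c) - 1) / (q ^ m - 1)`, and the exponent
    -- defining the character of index `n` is multiplied by the same `r`. Hence the larger character
    -- is the smaller one composed with the norm.
    have huw : subfieldHom t (finiteSubfield κ p (f * m)) w =
        subfieldHom t (finiteSubfield κ p (f * (m * c))) u ^ r := by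
      rw [← map_pow]
      change t _ = t _
      congr 1
      ext
      exact congrArg Subtype.val hnorm
    change indexedChar _ _ _ n (u : finiteSubfield κ p (f * (m * c))) =
      indexedChar _ _ _ n (w : finiteSubfield κ p (f * m))
    rw [← dvd_mul_val_iff] at hn
    have hexp : ((p ^ f) ^ m - 1) * r * n.val / (2 * d) =
        r * (((p ^ f) ^ m - 1) * n.val / (2 * d)) := by
      rw [mul_comm _ r, mul_assoc, Nat.mul_div_assoc _ hn]
    rw [indexedChar_apply, indexedChar_apply, huw, hr, hexp, pow_mul]
  rw [key, hrank, Nat.mul_div_cancel_left _ (Nat.pos_of_ne_zero hm0)]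

/-- The invariance of `betaAt` under the Frobenius. -/
theorem betaAt_mul [CharZero L] (hp : p ≠ 2) (ht : Function.Injective t) {n : ZMod (2 * d)}
    (hn0 : n ≠ 0) {m : ℕ} [NeZero (f * m)]
    (hn : (((p ^ f) ^ m - 1 : ℕ) : ZMod (2 * d)) * n = 0) :
    betaAt p f d t (((p ^ f : ℕ) : ZMod (2 * d)) * n) m = betaAt p f d t n m := by
  let _ : Fintype (finiteSubfield κ p (f * m)) := Fintype.ofFinite _
  have hk : ringChar (finiteSubfield κ p (f * m)) ≠ 2 := by rwa [ringChar_finiteSubfield]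
  have hN := natCard_units_finiteSubfield (κ := κ) (p := p) (f := f) m
  have hχ := indexedChar_ne_one (subfieldHom_injective ht _) hN hn hn0
  have := charP_finiteSubfield (κ := κ) (p := p) (f * m)
  -- The automorphism `x ↦ x ^ q` carries the character of index `n` to that of index `q n`.
  let e : finiteSubfield κ p (f * m) ≃+* finiteSubfield κ p (f * m) :=
    RingEquiv.ofBijective (iterateFrobenius (finiteSubfield κ p (f * m)) p f)
      (Finite.injective_iff_bijective.mp (iterateFrobenius (finiteSubfield κ p (f * m)) p f).injective)
  symm
  refine jacobiProduct_ringEquiv hk e hχ fun x => ?_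
  · by_cases hx : x = 0
    · rw [hx, map_zero, MulChar.map_zero, MulChar.map_zero]
    set u := Units.mk0 x hx
    have he : e x = ((u ^ p ^ f : (finiteSubfield κ p (f * m))ˣ) : finiteSubfield κ p (f * m)) := by
      change iterateFrobenius (finiteSubfield κ p (f * m)) p f x = _
      rw [iterateFrobenius_def, Units.val_pow_eq_pow_val]
      rfl
    have hc : ((p ^ f : ℕ) : ZMod (2 * d)) * n = ((p ^ f * n.val : ℕ) : ZMod (2 * d)) := by simp
    rw [← dvd_mul_val_iff] at hn
    rw [he, hc]
    change _ = indexedChar _ _ _ _ (u : finiteSubfield κ p (f * m))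
    rw [indexedChar_natCast_apply hN, indexedChar_apply, map_pow, ← pow_mul, mul_left_comm,
      Nat.mul_div_assoc _ hn]

end BetaAt

end GriffonRank

end

noncomputable section

open Polynomial

namespace GriffonRank

/-! ### The numbers `β(n)` -/

section IndexSet

theorem natCast_mul_eq_zero_iff {d c e : ℕ} [NeZero d] (he : 2 * d = c * e) (n : ZMod (2 * d)) :
    (c : ZMod (2 * d)) * n = 0 ↔ ∃ i < c, n = ((i * e : ℕ) : ZMod (2 * d)) := by
  have hd : 0 < d := Nat.pos_of_ne_zero (NeZero.ne d)
  have hc : 0 < c := Nat.pos_of_mul_pos_right (he ▸ (by positivity : 0 < 2 * d))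
  rw [← dvd_mul_val_iff]
  constructor
  · intro h
    obtain ⟨i, hi⟩ := (Nat.mul_dvd_mul_iff_left hc).mp (he.symm.dvd.trans h)
    refine ⟨i, ?_, ?_⟩
    · have h1 := (ZMod.val_lt n).trans_eq he
      rw [hi, mul_comm c] at h1
      exact lt_of_mul_lt_mul_left h1 (Nat.zero_le e)
    · rw [mul_comm i e, ← hi, ZMod.natCast_zmod_val]
  · rintro ⟨i, -, rfl⟩
    rw [dvd_mul_val_iff, ← Nat.cast_mul, ZMod.natCast_eq_zero_iff]
    exact ⟨i, by rw [he]; ring⟩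

/-- The removed indices are those killed by `4` (even `d`) or `2` (odd `d`). In this form stability
under multiplication by the unit `q` is clear. -/
theorem mem_indexSet_iff {d : ℕ} [NeZero d] (n : ZMod (2 * d)) :
    n ∈ indexSet d ↔ (((if Even d then 4 else 2 : ℕ)) : ZMod (2 * d)) * n ≠ 0 := by
  by_cases hev : Even d
  · have he : 2 * d = 4 * (d / 2) := by
      have := hev.two_dvd
      omega
    rw [if_pos hev, Ne, natCast_mul_eq_zero_iff he, indexSet, if_pos hev,
      Set.mem_compl_iff, not_iff_not]
    simp only [Set.mem_insert_iff, Set.mem_singleton_iff]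
    have h2 : 2 * (d / 2) = d := by omega
    constructor
    · rintro (h | h | h | h)
      · exact ⟨0, by norm_num, by simpa using h⟩
      · exact ⟨1, by norm_num, by rwa [one_mul]⟩
      · exact ⟨2, by norm_num, by rwa [h2]⟩
      · exact ⟨3, by norm_num, h⟩
    · rintro ⟨i, hi, h⟩
      interval_cases i
      · left; simpa using h
      · right; left; rwa [one_mul] at h
      · right; right; left; rwa [h2] at h
      · right; right; right; exact h
  · rw [if_neg hev, Ne, natCast_mul_eq_zero_iff rfl, indexSet, if_neg hev, Set.mem_compl_iff,
      not_iff_not]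
    simp only [Set.mem_insert_iff, Set.mem_singleton_iff]
    constructor
    · rintro (h | h)
      · exact ⟨0, by norm_num, by simpa using h⟩
      · exact ⟨1, by norm_num, by rwa [one_mul]⟩
    · rintro ⟨i, hi, h⟩
      interval_cases i
      · left; simpa using h
      · right; rwa [one_mul] at h

theorem ne_zero_of_mem_indexSet {d : ℕ} [NeZero d] {n : ZMod (2 * d)} (hn : n ∈ indexSet d) :
    n ≠ 0 := by
  rintro rfl
  rw [mem_indexSet_iff, mul_zero] at hn
  exact hn rfl

end IndexSet

section BetaOrbit

theorem coprime_two_mul {p f d : ℕ} [Fact p.Prime] (hp : p ≠ 2) (hdq : d.Coprime (p ^ f)) :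
    (p ^ f).Coprime (2 * d) := by
  refine Nat.Coprime.mul_right ?_ hdq.symm
  exact Nat.Coprime.pow_left f ((Nat.coprime_primes Fact.out Nat.prime_two).mpr hp)

theorem betaAt_congr {L : Type*} [Field L] {p f d : ℕ} [Fact p.Prime] {κ : Type*} [Field κ]
    [CharP κ p] (t : κˣ →* Lˣ) (n : ZMod (2 * d))
    {m m' : ℕ} [NeZero (f * m)] [NeZero (f * m')] (h : m = m') :
    betaAt p f d t n m = betaAt p f d t n m' := by
  subst h
  rfl

variable {L : Type*} [Field L] [IsAlgClosed L]

attribute [local instance] Ideal.Quotient.field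

/-- A monic polynomial over the residue field lifts to a monic polynomial over the algebraic
integers; its roots in `L` are again algebraic integers and reduce to roots. -/
theorem isAlgClosed_residueField (𝔓 : Ideal (integralClosure ℤ L)) [𝔓.IsMaximal] :
    IsAlgClosed (integralClosure ℤ L ⧸ 𝔓) := by
  refine IsAlgClosed.of_exists_root _ fun P hP hi => ?_
  obtain ⟨G, hG, hdeg, hmon⟩ := lifts_and_natDegree_eq_and_monic
    ((mem_lifts P).mpr (map_surjective (Ideal.Quotient.mk 𝔓) Ideal.Quotient.mk_surjective P)) hP
  have hd : (G.map (algebraMap (integralClosure ℤ L) L)).degree ≠ 0 := by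
    rw [hmon.degree_map, degree_eq_natDegree hmon.ne_zero, hdeg]
    exact_mod_cast hi.natDegree_pos.ne'
  obtain ⟨z, hz⟩ := IsAlgClosed.exists_root _ hd
  rw [IsRoot.def, eval_map] at hz
  have hzi : IsIntegral (integralClosure ℤ L) z := ⟨G, hmon, hz⟩
  have hzi' : IsIntegral ℤ z := isIntegral_trans z hzi
  refine ⟨Ideal.Quotient.mk 𝔓 ⟨z, hzi'⟩, ?_⟩
  have h0 : G.eval ⟨z, hzi'⟩ = 0 := by
    apply Subtype.val_injective
    change algebraMap (integralClosure ℤ L) L _ = _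
    rw [← eval₂_at_apply]
    exact hz
  rw [← hG, eval_map, eval₂_at_apply, h0, map_zero]

variable [CharZero L] {p f d : ℕ} [Fact p.Prime] (𝔓 : Ideal (integralClosure ℤ L)) [𝔓.IsMaximal]
  [CharP (integralClosure ℤ L ⧸ 𝔓) p]

theorem teichmuller_injective : Function.Injective (teichmuller p 𝔓) := by
  have h1 : Function.Injective
      (Units.map ((integralClosure ℤ L).val : integralClosure ℤ L →* L)) :=
    Units.map_injective Subtype.val_injective
  exact (h1.comp Subtype.val_injective).comp (MulEquiv.injective _)

theorem beta_eq_betaAt [NeZero f] [NeZero d] (n : ZMod (2 * d))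
    [NeZero (f * (qOrbit (p ^ f) n).ncard)] :
    beta p f d 𝔓 n = betaAt p f d (teichmuller p 𝔓) n (qOrbit (p ^ f) n).ncard :=
  rfl

variable [NeZero d]

theorem sub_one_mul_eq_zero_iff_dvd (hp : p ≠ 2) (hdq : d.Coprime (p ^ f))
    (n : ZMod (2 * d)) (m : ℕ) :
    (((p ^ f) ^ m - 1 : ℕ) : ZMod (2 * d)) * n = 0 ↔ (qOrbit (p ^ f) n).ncard ∣ m := by
  rw [sub_one_mul_eq_zero_iff (pow_ne_zero f (Fact.out : p.Prime).ne_zero),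
    pow_mul_eq_self_iff (coprime_two_mul hp hdq)]

theorem mul_mem_indexSet (hp : p ≠ 2) (hdq : d.Coprime (p ^ f))
    {n : ZMod (2 * d)} (hn : n ∈ indexSet d) :
    ((p ^ f : ℕ) : ZMod (2 * d)) * n ∈ indexSet d := by
  have hu : IsUnit (((p ^ f : ℕ) : ZMod (2 * d))) :=
    (ZMod.isUnit_iff_coprime _ _).mpr (coprime_two_mul hp hdq)
  rw [mem_indexSet_iff] at hn ⊢
  rwa [mul_left_comm, Ne, hu.mul_right_eq_zero]

theorem qOrbit_subset_indexSet (hp : p ≠ 2) (hdq : d.Coprime (p ^ f))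
    {n : ZMod (2 * d)} (hn : n ∈ indexSet d) :
    qOrbit (p ^ f) n ⊆ indexSet d := by
  rintro x ⟨j, rfl⟩
  change ((p ^ f : ℕ) : ZMod (2 * d)) ^ j * n ∈ _
  induction j with
  | zero => rwa [pow_zero, one_mul]
  | succ j ih =>
    rw [pow_succ', mul_assoc]
    exact mul_mem_indexSet hp hdq ih

variable [NeZero f]

/-- The Jacobi sums over the larger fields are powers of `β(n)`. -/
theorem betaAt_eq_beta_pow (hp : p ≠ 2) (hdq : d.Coprime (p ^ f))
    {n : ZMod (2 * d)} (hn0 : n ≠ 0) {m : ℕ}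
    [NeZero (f * m)] (hm : (qOrbit (p ^ f) n).ncard ∣ m) :
    betaAt p f d (teichmuller p 𝔓) n m = beta p f d 𝔓 n ^ (m / (qOrbit (p ^ f) n).ncard) := by
  have := isAlgClosed_residueField 𝔓
  have : NeZero (f * (qOrbit (p ^ f) n).ncard) :=
    ⟨mul_ne_zero (NeZero.ne f) (qOrbit_ncard_ne_zero (p ^ f) n)⟩
  rw [beta_eq_betaAt]
  exact betaAt_of_dvd hp (teichmuller_injective 𝔓) hn0 hm
    ((sub_one_mul_eq_zero_iff_dvd hp hdq n _).mpr dvd_rfl)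

theorem beta_mul (hp : p ≠ 2) (hdq : d.Coprime (p ^ f)) {n : ZMod (2 * d)} (hn0 : n ≠ 0) :
    beta p f d 𝔓 (((p ^ f : ℕ) : ZMod (2 * d)) * n) = beta p f d 𝔓 n := by
  have := isAlgClosed_residueField 𝔓
  have : NeZero (f * (qOrbit (p ^ f) n).ncard) :=
    ⟨mul_ne_zero (NeZero.ne f) (qOrbit_ncard_ne_zero (p ^ f) n)⟩
  have : NeZero (f * (qOrbit (p ^ f) (((p ^ f : ℕ) : ZMod (2 * d)) * n)).ncard) :=
    ⟨mul_ne_zero (NeZero.ne f) (qOrbit_ncard_ne_zero (p ^ f) _)⟩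
  rw [beta_eq_betaAt, beta_eq_betaAt,
    betaAt_congr _ _ (congrArg Set.ncard (qOrbit_mul (coprime_two_mul hp hdq) n))]
  exact betaAt_mul hp (teichmuller_injective 𝔓) hn0
    ((sub_one_mul_eq_zero_iff_dvd hp hdq n _).mpr dvd_rfl)

theorem beta_eq_of_mem_qOrbit (hp : p ≠ 2) (hdq : d.Coprime (p ^ f))
    {n n' : ZMod (2 * d)} (hn0 : n ≠ 0) (h : n' ∈ qOrbit (p ^ f) n) :
    beta p f d 𝔓 n' = beta p f d 𝔓 n := by
  obtain ⟨j, rfl⟩ := h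
  have hu : IsUnit (((p ^ f : ℕ) : ZMod (2 * d))) :=
    (ZMod.isUnit_iff_coprime _ _).mpr (coprime_two_mul hp hdq)
  change beta p f d 𝔓 (((p ^ f : ℕ) : ZMod (2 * d)) ^ j * n) = _
  induction j with
  | zero => rw [pow_zero, one_mul]
  | succ j ih =>
    rw [pow_succ', mul_assoc, beta_mul 𝔓 hp hdq, ih]
    rwa [Ne, (hu.pow j).mul_right_eq_zero]

open scoped Classical in
/-- The power sums attached to the curve, over the field with `(p ^ f) ^ m` elements. -/
theorem sum_fiber_eq (hp : p ≠ 2) (hdq : d.Coprime (p ^ f)) {m : ℕ} [NeZero (f * m)] :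
    letI : Fintype (residueSubfield p f 𝔓 m) := Fintype.ofFinite _
    1 + ∑ τ : residueSubfield p f 𝔓 m, (cubicTrace (fiberA d τ) (fiberB d τ) : L) =
      -((p : L) ^ f) ^ m - ∑ n : ZMod (2 * d) with
        n ∈ indexSet d ∧ (qOrbit (p ^ f) n).ncard ∣ m,
          beta p f d 𝔓 n ^ (m / (qOrbit (p ^ f) n).ncard) := by
  have := isAlgClosed_residueField 𝔓
  let _ : Fintype (residueSubfield p f 𝔓 m) := Fintype.ofFinite _
  have hK : ringChar (residueSubfield p f 𝔓 m) ≠ 2 := by rwa [ringChar_finiteSubfield]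
  have hN := natCard_units_finiteSubfield (κ := integralClosure ℤ L ⧸ 𝔓) (p := p) (f := f) m
  have hcard : (Fintype.card (residueSubfield p f 𝔓 m) : L) = ((p : L) ^ f) ^ m := by
    rw [← Nat.card_eq_fintype_card, natCard_finiteSubfield (NeZero.ne (f * m)), pow_mul]
    push_cast
    rfl
  have h := sum_fiber (L := L) (d := d) hK
    (subfieldHom_injective (teichmuller_injective (p := p) 𝔓) (residueSubfield p f 𝔓 m)) hN
  change 1 + ∑ τ : residueSubfield p f 𝔓 m, (cubicTrace (fiberA d τ) (fiberB d τ) : L) = _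
  -- The `1` from infinity cancels the `-1` left by the quadratic character.
  rw [h, hcard, show ∀ a b : L, 1 + (-a - 1 - b) = -a - b by intros; ring]
  congr 1
  refine Finset.sum_congr ?_ fun n hn => ?_
  · ext n
    simp only [Finset.mem_filter, Finset.mem_univ, true_and,
      sub_one_mul_eq_zero_iff_dvd hp hdq, and_comm]
  · obtain ⟨-, h1, h2⟩ := Finset.mem_filter.mp hn
    exact betaAt_eq_beta_pow 𝔓 hp hdq (ne_zero_of_mem_indexSet h1) h2

end BetaOrbit

end GriffonRank

end

noncomputable section

open Polynomial

namespace GriffonRank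

/-! ### The Euler product -/

section EulerProduct

variable {F : Type*} [Field F]

theorem Place.degree_pos (v : Place F) : 0 < v.degree := by
  cases v with
  | finite P hm hi => exact hi.natDegree_pos
  | infinite => exact one_pos

theorem X_pow_degree_dvd_eulerPolynomial_sub_one (W : WeierstrassCurve (RatFunc F))
    (v : Place F) : X ^ v.degree ∣ eulerPolynomial W v - 1 := by
  rw [eulerPolynomial]
  split_ifs
  · refine ⟨-C (traceAt W v) + C (residueCard v : ℤ) * X ^ v.degree, ?_⟩
    ring
  · refine ⟨-C (traceAt W v), ?_⟩
    ring

theorem eulerPolynomial_mul_eulerFactor (W : WeierstrassCurve (RatFunc F)) (v : Place F) :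
    (eulerPolynomial W v : PowerSeries ℤ) * eulerFactor W v = 1 := by
  refine PowerSeries.mul_invOfUnit _ 1 ?_
  obtain ⟨c, hc⟩ := X_pow_degree_dvd_eulerPolynomial_sub_one W v
  rw [sub_eq_iff_eq_add.mp hc, ← PowerSeries.coeff_zero_eq_constantCoeff_apply,
    Polynomial.coeff_coe, coeff_add, coeff_X_pow_mul', if_neg (by have := v.degree_pos; omega)]
  simp

theorem X_pow_degree_dvd_eulerFactor_sub_one (W : WeierstrassCurve (RatFunc F)) (v : Place F) :
    (PowerSeries.X : PowerSeries ℤ) ^ v.degree ∣ eulerFactor W v - 1 := by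
  obtain ⟨c, hc⟩ := X_pow_degree_dvd_eulerPolynomial_sub_one W v
  have h1 := eulerPolynomial_mul_eulerFactor W v
  rw [sub_eq_iff_eq_add.mp hc] at h1
  push_cast at h1
  refine ⟨-(c : PowerSeries ℤ) * eulerFactor W v, ?_⟩
  linear_combination h1

theorem finite_setOf_degree_le [Fintype F] (N : ℕ) : {v : Place F | v.degree ≤ N}.Finite := by
  refine Set.Finite.subset (((irreds F N).attach.finite_toSet.image fun P =>
    Place.finite P.1 (mem_irreds.mp P.2).1 (mem_irreds.mp P.2).2.1).insert Place.infinite)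
    fun v hv => ?_
  cases v with
  | finite P hm hi =>
    exact Or.inr ⟨⟨P, mem_irreds.mpr ⟨hm, hi, hv⟩⟩, Finset.mem_coe.mpr (Finset.mem_attach _ _), rfl⟩
  | infinite => exact Or.inl rfl

open scoped PowerSeries.WithPiTopology in
theorem eulerProductConverges [Fintype F] (W : WeierstrassCurve (RatFunc F)) :
    EulerProductConverges W :=
  (hasProd_of_X_pow_dvd (X_pow_degree_dvd_eulerFactor_sub_one W) finite_setOf_degree_le).multipliable

variable {L : Type*} [Field L] {W : WeierstrassCurve (RatFunc F)}

/-- The power sums attached to an Euler factor. -/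
theorem isLogDeriv_eulerFactor {v : Place F} {α β : L}
    (h : (eulerPolynomial W v).map (Int.castRingHom L) =
      (1 - C α * X ^ v.degree) * (1 - C β * X ^ v.degree)) :
    IsLogDeriv (PowerSeries.map (Int.castRingHom L) (eulerFactor W v))
      (fun n => if v.degree ∣ n ∧ n ≠ 0 then
        (v.degree : L) * (α ^ (n / v.degree) + β ^ (n / v.degree)) else 0) := by
  have h1 := congrArg (PowerSeries.map (Int.castRingHom L)) (eulerPolynomial_mul_eulerFactor W v)
  rw [map_mul, map_one, ← Polynomial.polynomial_map_coe, h] at h1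
  have h2 := ((isLogDeriv_one_sub α v.degree_pos.ne').mul
    (isLogDeriv_one_sub β v.degree_pos.ne')).of_mul_eq_one
    (H := PowerSeries.map (Int.castRingHom L) (eulerFactor W v)) (by
      push_cast at h1
      exact h1)
  refine h2.congr fun n => ?_
  simp only [Pi.neg_apply, Pi.add_apply]
  split_ifs
  · ring
  · simp

/-- The power sums attached to the `L`-function. -/
theorem isLogDeriv_lFunction [Fintype F] {α β : Place F → L}
    (h : ∀ v, (eulerPolynomial W v).map (Int.castRingHom L) =
      (1 - C (α v) * X ^ v.degree) * (1 - C (β v) * X ^ v.degree)) :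
    IsLogDeriv (PowerSeries.map (Int.castRingHom L) (lFunction W))
      (fun n => ∑ v ∈ (finite_setOf_degree_le (F := F) n).toFinset,
        if v.degree ∣ n ∧ n ≠ 0 then
          (v.degree : L) * (α v ^ (n / v.degree) + β v ^ (n / v.degree)) else 0) := by
  refine IsLogDeriv.of_approx fun N => ⟨_, _, IsLogDeriv.prod
    (finite_setOf_degree_le (F := F) N).toFinset fun v _ => isLogDeriv_eulerFactor (h v),
    fun i hi => ⟨?_, ?_⟩⟩
  · rw [PowerSeries.coeff_map, ← map_prod, PowerSeries.coeff_map, lFunction,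
      coeff_tprod_eq (X_pow_degree_dvd_eulerFactor_sub_one W) finite_setOf_degree_le hi]
  · refine Finset.sum_subset (fun v hv => ?_) fun v _ hv => if_neg fun hvi => hv ?_
    · rw [Set.Finite.mem_toFinset] at hv ⊢
      exact le_trans hv hi
    · rw [Set.Finite.mem_toFinset]
      exact Nat.le_of_dvd (Nat.pos_of_ne_zero hvi.2) hvi.1

theorem sum_places [Fintype F] (r : Place F → L) (n : ℕ) (hn : n ≠ 0) (G : F[X] → L)
    (hG : ∀ P hm hi, G P = r (Place.finite P hm hi)) :
    ∑ v ∈ (finite_setOf_degree_le (F := F) n).toFinset, r v =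
      r Place.infinite + ∑ P ∈ irreds F n, G P := by
  classical
  rw [← Finset.add_sum_erase _ _ (a := (Place.infinite : Place F)) (by
    rw [Set.Finite.mem_toFinset]
    exact Nat.one_le_iff_ne_zero.mpr hn)]
  congr 1
  symm
  refine Finset.sum_bij (fun P hP => Place.finite P (mem_irreds.mp hP).1 (mem_irreds.mp hP).2.1)
    (fun P hP => ?_) (fun P hP P' hP' h => ?_) (fun v hv => ?_) fun P hP => hG _ _ _
  · rw [Finset.mem_erase, Set.Finite.mem_toFinset]
    exact ⟨by simp, (mem_irreds.mp hP).2.2⟩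
  · injection h
  · rw [Finset.mem_erase, Set.Finite.mem_toFinset] at hv
    cases v with
    | finite P hm hi => exact ⟨P, mem_irreds.mpr ⟨hm, hi, hv.2⟩, rfl⟩
    | infinite => exact absurd rfl hv.1

/-- The power sums attached to the `L`-function of `E_d`, as sums of traces of the fibres. -/
theorem isLogDeriv_lFunction_curve [Fintype F] (h2 : (2 : F) ≠ 0) {d : ℕ} (hd : d ≠ 0)
    [IsAlgClosed L] [CharZero L] {K : ℕ → Type*} [∀ m, Field (K m)] [∀ m, Fintype (K m)]
    [∀ m, Algebra F (K m)] (hK : ∀ m ≠ 0, Module.finrank F (K m) = m) :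
    IsLogDeriv (PowerSeries.map (Int.castRingHom L) (lFunction (curve F d)))
      (fun m => if m = 0 then 0 else
        1 + ∑ τ : K m, (cubicTrace (fiberA d τ) (fiberB d τ) : L)) := by
  classical
  -- The properties special to finite and infinite places are stated as implications, so that a
  -- single choice of `α` and `β` serves all places.
  have hex : ∀ v : Place F, ∃ α β : L, (eulerPolynomial (curve F d) v).map (Int.castRingHom L) =
      (1 - C α * X ^ v.degree) * (1 - C β * X ^ v.degree) ∧
      (∀ P hm hi, v = Place.finite P hm hi → ∀ m ≠ 0, ∀ τ : K m, minpoly F τ = P →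
        (cubicTrace (fiberA d τ) (fiberB d τ) : L) =
          α ^ (m / P.natDegree) + β ^ (m / P.natDegree)) ∧
      (v = Place.infinite → α = 1 ∧ β = 0) := by
    intro v
    cases v with
    | finite P hm hi =>
      obtain ⟨α, β, h1, h3⟩ := exists_eulerPolynomial_finite hm hi h2 hd L
      refine ⟨α, β, h1, ?_, by simp⟩
      intro P' hm' hi' h m hm0 τ hτ
      injection h with h
      subst h
      rw [h3 (K m) τ hτ, hK m hm0]
    | infinite =>
      refine ⟨1, 0, ?_, by simp, fun _ => ⟨rfl, rfl⟩⟩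
      rw [eulerPolynomial_infinite h2 hd L]
      simp [Place.degree]
  choose α β hαβ hfin hinf using hex
  refine (isLogDeriv_lFunction hαβ).congr fun m => ?_
  by_cases hm : m = 0
  · rw [if_pos hm]
    exact Finset.sum_eq_zero fun v _ => if_neg fun h => h.2 hm
  rw [if_neg hm]
  set G : F[X] → L := fun P => if h : P.Monic ∧ Irreducible P then
    α (Place.finite P h.1 h.2) ^ (m / P.natDegree) + β (Place.finite P h.1 h.2) ^ (m / P.natDegree)
    else 0 with hG
  have hGP : ∀ P (hm : P.Monic) (hi : Irreducible P), G P =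
      α (Place.finite P hm hi) ^ (m / P.natDegree) +
        β (Place.finite P hm hi) ^ (m / P.natDegree) := fun P hm hi => dif_pos ⟨hm, hi⟩
  rw [sum_places _ m hm (fun P => if P.natDegree ∣ m then (P.natDegree : L) * G P else 0)]
  · have hinf' := hinf Place.infinite rfl
    congr 1
    · rw [hinf'.1, hinf'.2]
      simp [Place.degree, hm]
    -- The primes of degree dividing `m`, weighted by their degree, are traded for the points `τ` of
    -- the field of degree `m` by way of their minimal polynomials.
    · have h3 := sum_minpoly (k := F) (K := K m) G
      rw [hK m hm] at h3
      rw [← Finset.sum_filter, ← h3]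
      refine Finset.sum_congr rfl fun τ _ => ?_
      have hint : IsIntegral F τ := Algebra.IsIntegral.isIntegral τ
      rw [hGP _ (minpoly.monic hint) (minpoly.irreducible hint),
        hfin _ _ _ _ rfl m hm τ rfl]
  · intro P hm' hi'
    rw [hGP P hm' hi']
    simp only [Place.degree, ne_eq, hm, not_false_eq_true, and_true]

end EulerProduct

end GriffonRank

end

noncomputable section

open Polynomial

namespace GriffonRank

/-! ### The `L`-function of `E_d` -/

section RootMultiplicity

variable {L : Type*} [Field L]

theorem one_sub_C_mul_X_pow_ne_zero (b : L) {k : ℕ} (hk : k ≠ 0) : (1 - C b * X ^ k : L[X]) ≠ 0 := by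
  intro h
  have := congrArg (eval 0) h
  simp [hk] at this

-- If `b = a ^ k`, the derivative `-b k X ^ (k - 1)` does not vanish at `a⁻¹` in characteristic
-- zero, so the zero is simple.
open scoped Classical in
theorem rootMultiplicity_one_sub [CharZero L] (b : L) {k : ℕ} (hk : k ≠ 0) {a : L} (ha : a ≠ 0) :
    (1 - C b * X ^ k : L[X]).rootMultiplicity a⁻¹ = if b = a ^ k then 1 else 0 := by
  have h0 := one_sub_C_mul_X_pow_ne_zero b hk
  have hroot : (1 - C b * X ^ k : L[X]).IsRoot a⁻¹ ↔ b = a ^ k := by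
    rw [IsRoot.def, eval_sub, eval_one, eval_mul, eval_C, eval_pow, eval_X, inv_pow, sub_eq_zero,
      eq_comm, mul_inv_eq_one₀ (pow_ne_zero k ha)]
  split_ifs with h
  · refine le_antisymm (not_lt.mp fun h1 => ?_) ((rootMultiplicity_pos h0).mpr (hroot.mpr h))
    have h2 := ((one_lt_rootMultiplicity_iff_isRoot h0).mp h1).2
    rw [IsRoot.def, derivative_sub, derivative_one, derivative_C_mul_X_pow, eval_sub, eval_zero,
      eval_mul, eval_C, eval_pow, eval_X, zero_sub, neg_eq_zero, h] at h2
    simp [hk, ha] at h2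
  · exact rootMultiplicity_eq_zero fun h1 => h (hroot.mp h1)

theorem rootMultiplicity_finset_prod {ι : Type*} (s : Finset ι) (g : ι → L[X])
    (hg : ∀ i ∈ s, g i ≠ 0) (a : L) :
    (∏ i ∈ s, g i).rootMultiplicity a = ∑ i ∈ s, (g i).rootMultiplicity a := by
  classical
  induction s using Finset.induction_on with
  | empty =>
    rw [Finset.prod_empty, Finset.sum_empty]
    exact rootMultiplicity_eq_zero (by simp)
  | insert i s hi ih =>
    have h1 := fun j hj => hg j (Finset.mem_insert_of_mem hj)
    rw [Finset.prod_insert hi, Finset.sum_insert hi, rootMultiplicity_mul, ih h1]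
    exact mul_ne_zero (hg i (Finset.mem_insert_self i s)) (Finset.prod_ne_zero_iff.mpr h1)

/-- A power series over `ℤ` which becomes a polynomial over a field of characteristic zero is a
polynomial. -/
theorem exists_polynomial_of_map_eq [CharZero L] {G : PowerSeries ℤ} {H : L[X]}
    (h : PowerSeries.map (Int.castRingHom L) G = H) :
    ∃ P : ℤ[X], (P : PowerSeries ℤ) = G ∧ P.map (Int.castRingHom L) = H := by
  have hP : ((PowerSeries.trunc (H.natDegree + 1) G : ℤ[X]) : PowerSeries ℤ) = G := by
    ext n
    rw [coeff_coe, PowerSeries.coeff_trunc]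
    split_ifs with hn
    · rfl
    · have h1 := congrArg (PowerSeries.coeff n) h
      rw [PowerSeries.coeff_map, coeff_coe, coeff_eq_zero_of_natDegree_lt (by omega)] at h1
      symm
      simpa using h1
  refine ⟨_, hP, coe_injective L ?_⟩
  rw [polynomial_map_coe, hP, h]

end RootMultiplicity

/-! ### Factorization of the `L`-function over the orbits -/

section LFunctionCurve

attribute [local instance] Ideal.Quotient.field

variable {F : Type*} [Field F] [Fintype F] {p f : ℕ} [Fact p.Prime] [NeZero f]
  {L : Type*} [Field L] [IsAlgClosed L]
  (𝔓 : Ideal (integralClosure ℤ L)) [𝔓.IsMaximal] [CharP (integralClosure ℤ L ⧸ 𝔓) p]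

theorem nonempty_ringHom_residueSubfield (hF : Fintype.card F = p ^ f) (m : ℕ) :
    Nonempty (F →+* residueSubfield p f 𝔓 m) := by
  have := isAlgClosed_residueField 𝔓
  have : NeZero (f * 1) := ⟨by simpa using NeZero.ne f⟩
  let _ : Fintype (residueSubfield p f 𝔓 1) := Fintype.ofFinite _
  have h : Fintype.card F = Fintype.card (residueSubfield p f 𝔓 1) := by
    rw [hF, ← Nat.card_eq_fintype_card, natCard_finiteSubfield (NeZero.ne (f * 1)), mul_one]
  exact ⟨(Subfield.inclusion (finiteSubfield_le (mul_dvd_mul_left f (one_dvd m)))).comp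
    (FiniteField.ringEquivOfCardEq h).toRingHom⟩

theorem finrank_residueSubfield (hF : Fintype.card F = p ^ f) {m : ℕ} (hm : m ≠ 0)
    [Algebra F (residueSubfield p f 𝔓 m)] :
    Module.finrank F (residueSubfield p f 𝔓 m) = m := by
  have := isAlgClosed_residueField 𝔓
  have hfm : f * m ≠ 0 := mul_ne_zero (NeZero.ne f) hm
  have : NeZero (f * m) := ⟨hfm⟩
  have h1 := Module.natCard_eq_pow_finrank (K := F) (V := residueSubfield p f 𝔓 m)
  rw [natCard_finiteSubfield hfm, Nat.card_eq_fintype_card, hF, pow_mul] at h1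
  exact (Nat.pow_right_injective (Nat.one_lt_pow (NeZero.ne f) (Fact.out : p.Prime).one_lt) h1).symm

variable [CharZero L] {d : ℕ} [NeZero d]

open scoped Classical in
/-- The value of `β` on an orbit. -/
def orbitBeta (p f : ℕ) [Fact p.Prime] [NeZero f] (𝔓 : Ideal (integralClosure ℤ L)) [𝔓.IsMaximal]
    [CharP (integralClosure ℤ L ⧸ 𝔓) p] (o : Set (ZMod (2 * d))) : L :=
  if h : o.Nonempty then beta p f d 𝔓 h.some else 0

theorem orbitBeta_qOrbit (hp : p ≠ 2) (hdq : d.Coprime (p ^ f)) {n : ZMod (2 * d)} (hn : n ≠ 0) :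
    orbitBeta p f 𝔓 (qOrbit (p ^ f) n) = beta p f d 𝔓 n := by
  have hne : (qOrbit (p ^ f) n).Nonempty := ⟨n, mem_qOrbit_self n⟩
  rw [orbitBeta, dif_pos hne]
  exact beta_eq_of_mem_qOrbit 𝔓 hp hdq hn hne.some_mem

/-- The set of orbits of `Z_{2d}`, as a finite set. -/
def orbitFinset (q d : ℕ) [NeZero d] : Finset (Set (ZMod (2 * d))) :=
  (Set.toFinite (orbits q (indexSet d))).toFinset

theorem mem_orbitFinset {q : ℕ} {o : Set (ZMod (2 * d))} :
    o ∈ orbitFinset q d ↔ ∃ n ∈ indexSet d, qOrbit q n = o := by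
  rw [orbitFinset, Set.Finite.mem_toFinset]
  rfl

-- Each orbit collects `|o|` equal terms, and this multiplicity is exactly the factor `k` in the
-- power sums of `1 - β T ^ k`.
open scoped Classical in
theorem sum_indexSet_eq_sum_orbits (hp : p ≠ 2) (hdq : d.Coprime (p ^ f)) (m : ℕ) :
    ∑ n : ZMod (2 * d) with n ∈ indexSet d ∧ (qOrbit (p ^ f) n).ncard ∣ m,
        beta p f d 𝔓 n ^ (m / (qOrbit (p ^ f) n).ncard) =
      ∑ o ∈ orbitFinset (p ^ f) d, if o.ncard ∣ m then
        (o.ncard : L) * orbitBeta p f 𝔓 o ^ (m / o.ncard) else 0 := by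
  have hcop := coprime_two_mul hp hdq
  rw [← Finset.filter_filter, Finset.sum_filter, ← Finset.sum_fiberwise_of_maps_to
    (g := fun n => qOrbit (p ^ f) n) (t := orbitFinset (p ^ f) d)
    fun n hn => mem_orbitFinset.mpr ⟨n, (Finset.mem_filter.mp hn).2, rfl⟩]
  refine Finset.sum_congr rfl fun o ho => ?_
  obtain ⟨n₀, hn₀, rfl⟩ := mem_orbitFinset.mp ho
  have hset : (Finset.univ.filter fun n : ZMod (2 * d) => n ∈ indexSet d).filter
      (fun n => qOrbit (p ^ f) n = qOrbit (p ^ f) n₀) =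
      (Set.toFinite (qOrbit (p ^ f) n₀)).toFinset := by
    ext n
    simp only [Finset.mem_filter, Finset.mem_univ, true_and, Set.Finite.mem_toFinset]
    refine ⟨fun h => h.2 ▸ mem_qOrbit_self n, fun h => ⟨qOrbit_subset_indexSet hp hdq hn₀ h,
      qOrbit_eq_of_mem hcop h⟩⟩
  rw [hset, orbitBeta_qOrbit 𝔓 hp hdq (ne_zero_of_mem_indexSet hn₀)]
  have hterm : ∀ n ∈ (Set.toFinite (qOrbit (p ^ f) n₀)).toFinset,
      (if (qOrbit (p ^ f) n).ncard ∣ m then beta p f d 𝔓 n ^ (m / (qOrbit (p ^ f) n).ncard) else 0) =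
      if (qOrbit (p ^ f) n₀).ncard ∣ m then
        beta p f d 𝔓 n₀ ^ (m / (qOrbit (p ^ f) n₀).ncard) else 0 := by
    intro n hn
    rw [Set.Finite.mem_toFinset] at hn
    rw [qOrbit_eq_of_mem hcop hn,
      beta_eq_of_mem_qOrbit 𝔓 hp hdq (ne_zero_of_mem_indexSet hn₀) hn]
  rw [Finset.sum_congr rfl hterm, Finset.sum_const, nsmul_eq_mul, ← Set.ncard_eq_toFinset_card]
  split_ifs
  · rfl
  · rw [mul_zero]

/-- The `L`-function of `E_d`, as a polynomial over `L`. -/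
theorem map_lFunction_curve (hp : p ≠ 2) (hF : Fintype.card F = p ^ f)
    (hdq : d.Coprime (p ^ f)) :
    PowerSeries.map (Int.castRingHom L) (lFunction (curve F d)) =
      (((1 - C ((p : L) ^ f) * X ^ 1) * ∏ o ∈ orbitFinset (p ^ f) d,
        (1 - C (orbitBeta p f 𝔓 o) * X ^ o.ncard) : L[X]) : PowerSeries L) := by
  classical
  have h2 : (2 : F) ≠ 0 := by
    intro h
    have h1 : (p : F) = 0 := by
      have h3 := FiniteField.cast_card_eq_zero F
      rw [hF, Nat.cast_pow] at h3
      exact pow_eq_zero_iff (NeZero.ne f) |>.mp h3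
    have h4 : (Nat.gcd p 2 : F) = 1 := by
      rw [(Nat.coprime_primes Fact.out Nat.prime_two).mpr hp, Nat.cast_one]
    have h5 : ((Nat.gcd p 2 : ℤ) : F) = 0 := by
      rw [Nat.gcd_eq_gcd_ab]
      push_cast
      rw [h1, h]
      ring
    exact one_ne_zero (h4.symm.trans (by exact_mod_cast h5))
  have hfin : ∀ m, NeZero (f * (m + 1)) := fun m => ⟨mul_ne_zero (NeZero.ne f) m.succ_ne_zero⟩
  -- The index `m - 1 + 1` equals `m` for `m ≠ 0` and avoids `m = 0`, where the defining condition
  -- `x ^ 1 = x` gives the whole infinite residue field.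
  let K : ℕ → Type _ := fun m => residueSubfield p f 𝔓 (m - 1 + 1)
  let _ : ∀ m, Field (K m) := fun m => inferInstanceAs (Field (residueSubfield p f 𝔓 (m - 1 + 1)))
  let _ : ∀ m, Fintype (K m) := fun m => Fintype.ofFinite (residueSubfield p f 𝔓 (m - 1 + 1))
  let _ : ∀ m, Algebra F (K m) := fun m =>
    (nonempty_ringHom_residueSubfield 𝔓 hF (m - 1 + 1)).some.toAlgebra
  have hK : ∀ m ≠ 0, Module.finrank F (K m) = m := fun m hm =>
    (finrank_residueSubfield 𝔓 hF (m - 1).succ_ne_zero).trans (by omega)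
  have hL := isLogDeriv_lFunction_curve (L := L) h2 (NeZero.ne d) (K := K) hK
  have hR := (isLogDeriv_one_sub ((p : L) ^ f) one_ne_zero).mul (IsLogDeriv.prod
    (orbitFinset (p ^ f) d) fun o ho => isLogDeriv_one_sub (orbitBeta p f 𝔓 o) (k := o.ncard) (by
      obtain ⟨n, -, rfl⟩ := mem_orbitFinset.mp ho
      exact qOrbit_ncard_ne_zero _ _))
  have hcoe : (((1 - C ((p : L) ^ f) * X ^ 1) * ∏ o ∈ orbitFinset (p ^ f) d,
        (1 - C (orbitBeta p f 𝔓 o) * X ^ o.ncard) : L[X]) : PowerSeries L) =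
      (1 - PowerSeries.C ((p : L) ^ f) * PowerSeries.X ^ 1) * ∏ o ∈ orbitFinset (p ^ f) d,
        (1 - PowerSeries.C (orbitBeta p f 𝔓 o) * PowerSeries.X ^ o.ncard) := by
    rw [← coeToPowerSeries.ringHom_apply, map_mul, map_prod]
    simp only [coeToPowerSeries.ringHom_apply, coe_sub, coe_one, coe_mul, coe_C, coe_pow, coe_X]
  rw [hcoe]
  -- Both sides have constant term `1`, so it remains to compare the power sums.
  refine IsLogDeriv.left_unique ?_ (if_pos rfl) hL (hR.congr fun m => ?_)
  · have h0 : PowerSeries.constantCoeff (lFunction (curve F d)) = 1 := by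
      rw [← PowerSeries.coeff_zero_eq_constantCoeff_apply, lFunction,
        coeff_tprod_eq (X_pow_degree_dvd_eulerFactor_sub_one (curve F d)) finite_setOf_degree_le
          le_rfl, Finset.prod_eq_one, PowerSeries.coeff_zero_one]
      intro v hv
      rw [Set.Finite.mem_toFinset] at hv
      exact absurd v.degree_pos (not_lt.mpr hv)
    have h1 : PowerSeries.constantCoeff (PowerSeries.map (Int.castRingHom L)
        (lFunction (curve F d))) = 1 := by
      rw [← PowerSeries.coeff_zero_eq_constantCoeff_apply, PowerSeries.coeff_map,
        PowerSeries.coeff_zero_eq_constantCoeff_apply, h0, map_one]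
    rw [h1, map_mul, map_prod, Finset.prod_eq_one]
    · simp
    · intro o ho
      obtain ⟨n, -, rfl⟩ := mem_orbitFinset.mp ho
      simp [qOrbit_ncard_ne_zero (p ^ f) n]
  · cases m with
    | zero => simp
    | succ m =>
      rw [if_neg m.succ_ne_zero]
      refine Eq.trans ?_ (sum_fiber_eq 𝔓 hp hdq (m := m + 1)).symm
      rw [sum_indexSet_eq_sum_orbits 𝔓 hp hdq, sub_eq_add_neg, ← Finset.sum_neg_distrib]
      simp only [Pi.add_apply, one_dvd, ne_eq, Nat.succ_ne_zero, not_false_eq_true, and_true,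
        if_true, Nat.cast_one, one_mul, Nat.div_one]
      congr 1
      refine Finset.sum_congr rfl fun o _ => ?_
      split_ifs
      · rfl
      · rw [neg_zero]

/-- The order of vanishing of the `L`-function of `E_d` at `T = q⁻¹`. -/
theorem rootMultiplicity_eq (hp : p ≠ 2) (hdq : d.Coprime (p ^ f)) :
    ((1 - C ((p : L) ^ f) * X ^ 1) * ∏ o ∈ orbitFinset (p ^ f) d,
      (1 - C (orbitBeta p f 𝔓 o) * X ^ o.ncard) : L[X]).rootMultiplicity ((p : L) ^ f)⁻¹ =
      1 + {o ∈ orbits (p ^ f) (indexSet d) |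
        ∀ n ∈ o, beta p f d 𝔓 n = ((p : L) ^ f) ^ o.ncard}.ncard := by
  classical
  have hq : (p : L) ^ f ≠ 0 := pow_ne_zero f (by exact_mod_cast (Fact.out : p.Prime).ne_zero)
  have hcard : ∀ o ∈ orbitFinset (p ^ f) d, o.ncard ≠ 0 := by
    intro o ho
    obtain ⟨n, -, rfl⟩ := mem_orbitFinset.mp ho
    exact qOrbit_ncard_ne_zero _ _
  have hne : ∀ o ∈ orbitFinset (p ^ f) d, (1 - C (orbitBeta p f 𝔓 o) * X ^ o.ncard : L[X]) ≠ 0 :=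
    fun o ho => one_sub_C_mul_X_pow_ne_zero _ (hcard o ho)
  rw [rootMultiplicity_mul (mul_ne_zero (one_sub_C_mul_X_pow_ne_zero _ one_ne_zero)
    (Finset.prod_ne_zero_iff.mpr hne)), rootMultiplicity_finset_prod _ _ hne,
    rootMultiplicity_one_sub _ one_ne_zero hq, if_pos (pow_one _).symm,
    Finset.sum_congr rfl fun o ho => rootMultiplicity_one_sub _ (hcard o ho) hq,
    Finset.sum_boole, Nat.cast_id, ← Set.ncard_coe_finset]
  congr 2
  ext o
  rw [Finset.mem_coe, Finset.mem_filter, mem_orbitFinset]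
  refine and_congr_right ?_
  rintro ⟨n₀, hn₀, rfl⟩
  have h0 := ne_zero_of_mem_indexSet hn₀
  rw [orbitBeta_qOrbit 𝔓 hp hdq h0]
  exact ⟨fun h n hn => (beta_eq_of_mem_qOrbit 𝔓 hp hdq h0 hn).trans h,
    fun h => h n₀ (mem_qOrbit_self n₀)⟩

end LFunctionCurve

end GriffonRank

end

theorem corollary3p3 {F : Type*} [Field F] [Fintype F]
    (p f : ℕ) [Fact p.Prime] [NeZero f] (hp : p ≠ 2) (hF : Fintype.card F = p ^ f)
    {L : Type*} [Field L] [IsAlgClosed L] [CharZero L]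
    (𝔓 : Ideal (integralClosure ℤ L)) [𝔓.IsMaximal] [CharP (integralClosure ℤ L ⧸ 𝔓) p]
    (d : ℕ) [NeZero d] (hd : 2 ≤ d) (hdq : d.Coprime (p ^ f)) :
    GriffonRank.EulerProductConverges (GriffonRank.curve F d) ∧
    ∃ P : Polynomial ℤ,
      (P : PowerSeries ℤ) = GriffonRank.lFunction (GriffonRank.curve F d) ∧
      (P.map (Int.castRingHom ℚ)).rootMultiplicity (((p : ℚ) ^ f)⁻¹) =
        1 + {o ∈ GriffonRank.orbits (p ^ f) (GriffonRank.indexSet d) |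
          ∀ n ∈ o, GriffonRank.beta p f d 𝔓 n = ((p : L) ^ f) ^ o.ncard}.ncard := by
  obtain ⟨P, hP, hPL⟩ := GriffonRank.exists_polynomial_of_map_eq
    (GriffonRank.map_lFunction_curve (F := F) (d := d) 𝔓 hp hF hdq)
  refine ⟨GriffonRank.eulerProductConverges _, P, hP, ?_⟩
  -- The multiplicity at a rational point is unchanged by passing from `ℚ` to `L`, where the
  -- factorization is available.
  rw [Polynomial.eq_rootMultiplicity_map (algebraMap ℚ L).injective, Polynomial.map_map,
    ← GriffonRank.rootMultiplicity_eq 𝔓 hp hdq, ← hPL]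
  congr 1
  · simp
  · congr 1
    exact RingHom.ext_int _ _
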